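/- Let $\mathbb K$ be a field and let $S$ be a singular affine normal toric surface over $\mathbb K$, i.e. $S=\operatorname{Spec}\mathbb K[x^u : u\in\sigma^\vee\cap\mathbb Z^2]$, where $\sigma$ is the cone generated by $(1,0)$ and $(p,q)$ for coprime integers $0<p<q$. Let $O$ be its singular (torus-fixed) point, and let $$\frac qp=[c_2,\dots,c_{e-1}]=c_2-\cfrac{1}{c_3-\cfrac{1}{\ddots-\cfrac{1}{c_{e-1}}}},\qquad c_t\ge 2,$$ be the Hirzebruch–Jung continued fraction expansion. For $m\ge 1$ let $S_m$ be the $m$-th jet scheme of $S$ (its $A$-points are the $A[t]/(t^{m+1})$-points of $S$), $\pi_m:S_m\to S$ the projection, $S_m^0=\pi_m^{-1}(O)$, and $N(m)$ the number of irreducible components of $S_m^0$ (for every $m$ there are finitely many). (1) $\dim S_1^0=e$, and the multiset $\{c_2,\dots,c_{e-1}\}$ is obtained from $e$ and the function $N$ as follows. If $e=3$, then $N(m)$ is constant for $m$ large, and $c_2$ is this constant plus $1$. If $e\ge4$, put, for integers $c\ge2$, $m\ge1$, $1\le s\le\lceil m/2\rceil$, $$N_c^s(m)=\begin{cases} sc-(2s-1)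 & \text{if } s\le\lfloor m/c\rfloor,\\ m-(2s-2)&\text{otherwise,}\end{cases}$$ and for a finite multiset $L$ of integers $\ge2$ $$\tilde N_L(m)=\sum_{s=1}^{\lceil m/2\rceil}\Bigl(1+\sum_{c\in L}\bigl(N_c^s(m)-1\bigr)+(e-2-\#L)(m+1-2s)\Bigr).$$ Start with $L=\emptyset$. As long as $\#L<e-2$, let $m_0=\min\{m\ge1: N(m)<\tilde N_L(m)\}$ and add $m_0$ to $L$ with multiplicity $\tilde N_L(m_0)-N(m_0)$. After at most $e-2$ steps this stops with $L=\{c_2,\dots,c_{e-1}\}$ as multisets. (2) Consequently the number of irreducible components of the $S_m^0$ and their dimensions determine the multiset $\{c_t\}$: if $S$ and $S'$ are two such surfaces over $\mathbb K$ such that, for every $m\ge1$, $S_m^0$ and $S_m'^0$ have the same number of irreducible components and the same set of dimensions of irreducible components, then $\{c_2,\dots,c_{e-1}\}=\{c'_2,\dots,c'_{e'-1}\}$ as multisets. -/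

import Mathlib

namespace ToricJets

open Polynomial

noncomputable section

section JetSchemes

variable (K : Type*) [Field K] (R : Type*) (m : ℕ)

/-- Polynomial ring over `K` in symbols `f⁽ⁱ⁾` (`f ∈ R`, `0 ≤ i ≤ m`), the symbol `f⁽ⁱ⁾` standing for
the coefficient of `tⁱ` of the image of `f` in the universal `m`-jet. -/
abbrev JetVars : Type _ := MvPolynomial (R × Fin (m + 1)) K

variable {R} in
/-- The polynomial `f⁽⁰⁾ + f⁽¹⁾ t + ⋯ + f⁽ᵐ⁾ tᵐ`. -/
def formalJet (f : R) : (JetVars K R m)[X] :=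
  ∑ i : Fin (m + 1), Polynomial.C (MvPolynomial.X (f, i)) * Polynomial.X ^ (i : ℕ)

lemma coeff_zero_formalJet (f : R) :
    (formalJet K m f).coeff 0 = MvPolynomial.X (f, (0 : Fin (m + 1))) := by
  unfold formalJet
  rw [Polynomial.finsetSum_coeff, Finset.sum_eq_single (0 : Fin (m + 1))]
  · simp
  · intro i _ hi
    have : (i : ℕ) ≠ 0 := fun h => hi (Fin.ext h)
    rw [Polynomial.coeff_C_mul_X_pow, if_neg this.symm]
  · simp

variable [CommRing R] [Algebra K R]

/-- The polynomials in `t` which have to vanish modulo `t ^ (m + 1)` in order that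
`f ↦ f⁽⁰⁾ + ⋯ + f⁽ᵐ⁾ tᵐ` be a homomorphism of `K`-algebras. -/
inductive IsJetRelation : (JetVars K R m)[X] → Prop
  | add (f g : R) :
      IsJetRelation (formalJet K m (f + g) - (formalJet K m f + formalJet K m g))
  | mul (f g : R) :
      IsJetRelation (formalJet K m (f * g) - formalJet K m f * formalJet K m g)
  | const (a : K) :
      IsJetRelation (formalJet K m (algebraMap K R a) - Polynomial.C (MvPolynomial.C a))

/-- The ideal generated by the coefficients of `1, t, …, tᵐ` of all the jet relations. -/
def jetIdeal : Ideal (JetVars K R m) :=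
  Ideal.span {x | ∃ F, IsJetRelation K R m F ∧ ∃ i ≤ m, x = F.coeff i}

/-- The coordinate ring of the `m`-th jet scheme of `X = Spec R`: the `K`-algebra homomorphisms
from it to a `K`-algebra `A` are the `K`-algebra homomorphisms `R → A[t]/(t ^ (m + 1))`. -/
abbrev JetAlgebra : Type _ := JetVars K R m ⧸ jetIdeal K R m

lemma coeff_eq_zero_of_isJetRelation {F : (JetVars K R m)[X]} (hF : IsJetRelation K R m F) :
    Ideal.Quotient.mk (jetIdeal K R m) (F.coeff 0) = 0 :=
  Ideal.Quotient.eq_zero_iff_mem.2 (Ideal.subset_span ⟨F, hF, 0, Nat.zero_le m, rfl⟩)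

/-- The homomorphism `f ↦ f⁽⁰⁾` of coordinate rings which induces the projection
`π_m : X_m → X_0 = X`. -/
def jetProj : R →+* JetAlgebra K R m where
  toFun f := Ideal.Quotient.mk (jetIdeal K R m) (MvPolynomial.X (f, (0 : Fin (m + 1))))
  map_add' f g := by
    have h := coeff_eq_zero_of_isJetRelation K R m (.add f g)
    simpa only [Polynomial.coeff_sub, Polynomial.coeff_add, coeff_zero_formalJet, map_sub,
      map_add, sub_eq_zero] using h
  map_mul' f g := by
    have h := coeff_eq_zero_of_isJetRelation K R m (.mul f g)
    simpa only [Polynomial.coeff_sub, Polynomial.mul_coeff_zero, coeff_zero_formalJet, map_sub,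
      map_mul, sub_eq_zero] using h
  map_zero' := by
    have h := coeff_eq_zero_of_isJetRelation K R m (.const 0)
    rw [Polynomial.coeff_sub, Polynomial.coeff_C_zero, coeff_zero_formalJet, map_sub, map_zero,
      map_zero, map_zero, sub_zero] at h
    exact h
  map_one' := by
    have h := coeff_eq_zero_of_isJetRelation K R m (.const 1)
    rw [Polynomial.coeff_sub, Polynomial.coeff_C_zero, coeff_zero_formalJet, map_sub, map_one,
      map_one, map_one, sub_eq_zero] at h
    exact h

end JetSchemes

section ToricSurfaces

/-- The semigroup `σ^∨ ∩ M`, where `M = ℤ²` is the dual of the lattice `N = ℤ²` and `σ` is the cone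
generated by `(1, 0)` and `(p, q)`: the `u ∈ M` with `⟨u, (1, 0)⟩ ≥ 0` and `⟨u, (p, q)⟩ ≥ 0`. -/
def dualSemigroup (p q : ℕ) : AddSubmonoid (ℤ × ℤ) where
  carrier := {u | 0 ≤ u.1 ∧ 0 ≤ u.1 * p + u.2 * q}
  zero_mem' := by simp
  add_mem' := by
    rintro u v ⟨hu₁, hu₂⟩ ⟨hv₁, hv₂⟩
    refine ⟨add_nonneg hu₁ hv₁, ?_⟩
    have : (u + v).1 * (p : ℤ) + (u + v).2 * q
        = (u.1 * p + u.2 * q) + (v.1 * p + v.2 * q) := by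
      simp only [Prod.fst_add, Prod.snd_add]; ring
    rw [this]
    exact add_nonneg hu₂ hv₂

variable (K : Type*) [Field K] (p q : ℕ)

/-- The coordinate ring `K[x^u, u ∈ σ^∨ ∩ M]` of the affine toric surface `S`. -/
abbrev ToricRing : Type _ := AddMonoidAlgebra K (dualSemigroup p q)

/-- The ideal, generated by the monomials `x^u` with `u ≠ 0`, of the torus-fixed point `O` of `S`;
for coprime `0 < p < q` this is the unique singular point of `S`. -/
def originIdeal : Ideal (ToricRing K p q) :=
  Ideal.span {x | ∃ u : dualSemigroup p q, u ≠ 0 ∧ x = AddMonoidAlgebra.single u 1}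

/-- `S_m^0`, the fibre over `O` of the projection `π_m : S_m → S`, as a subspace of the
`m`-th jet scheme `S_m`. -/
def jetFiber (m : ℕ) : Set (PrimeSpectrum (JetAlgebra K (ToricRing K p q) m)) :=
  {P | (PrimeSpectrum.comap (jetProj K (ToricRing K p q) m) P).asIdeal = originIdeal K p q}

/-- `N(m)`, the number of irreducible components of `S_m^0`. -/
def numComponents (m : ℕ) : ℕ :=
  (irreducibleComponents (jetFiber K p q m)).ncard

/-- The set of the dimensions of the irreducible components of `S_m^0`. -/
def componentDims (m : ℕ) : Set (WithBot ℕ∞) :=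
  {d | ∃ Z ∈ irreducibleComponents (jetFiber K p q m), topologicalKrullDim Z = d}

end ToricSurfaces

section ContinuedFractions

/-- The value `[c₁, c₂, …, cₖ] = c₁ - 1 / (c₂ - 1 / (⋯ - 1 / cₖ))` of a Hirzebruch–Jung continued
fraction. -/
def hjValue : List ℕ → ℚ
  | [] => 0
  | [c] => c
  | c :: d :: l => c - 1 / hjValue (d :: l)

/-- `cs` is the list of entries, all `≥ 2`, of the Hirzebruch–Jung continued fraction
expansion of `x`. -/
def IsHJExpansion (cs : List ℕ) (x : ℚ) : Prop :=
  cs ≠ [] ∧ (∀ c ∈ cs, 2 ≤ c) ∧ hjValue cs = x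

end ContinuedFractions

section Recovery

/-- `N_c^s(m)`: it equals `s c - (2 s - 1)` for `s ≤ ⌊m / c⌋` and `m - (2 s - 2)` for larger `s`. -/
def contactCount (c m s : ℕ) : ℤ :=
  if s ≤ m / c then (s : ℤ) * c - (2 * s - 1) else (m : ℤ) - (2 * s - 2)

/-- The function `Ñ(m)` attached to a multiset `L` of already known entries: the sum over
`1 ≤ s ≤ ⌈m / 2⌉` of
`1 + ∑_{c ∈ L} (N_c^s(m) - 1) + (e - 2 - #L) (m + 1 - 2 s)`. -/
def trialCount (e : ℕ) (L : Multiset ℕ) (m : ℕ) : ℤ :=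
  ∑ s ∈ Finset.Icc 1 ((m + 1) / 2),
    (1 + (L.map fun c => contactCount c m s - 1).sum
      + ((e : ℤ) - 2 - (Multiset.card L : ℤ)) * ((m : ℤ) + 1 - 2 * s))

/-- `min {m ≥ 1 ; N(m) < Ñ(m)}`. -/
def nextEntry (e : ℕ) (N : ℕ → ℕ) (L : Multiset ℕ) : ℕ :=
  sInf {m : ℕ | 1 ≤ m ∧ (N m : ℤ) < trialCount e L m}

/-- One step of the procedure: unless all the `e - 2` entries are known, add the entry
`m₀ = min {m ≥ 1 ; N(m) < Ñ(m)}` with multiplicity `Ñ(m₀) - N(m₀)`. -/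
def recoverStep (e : ℕ) (N : ℕ → ℕ) (L : Multiset ℕ) : Multiset ℕ :=
  if Multiset.card L = e - 2 then L
  else L + Multiset.replicate
    (trialCount e L (nextEntry e N L) - (N (nextEntry e N L) : ℤ)).toNat (nextEntry e N L)

/-- The recovery procedure. If `e = 3`, the only entry is `1` plus the eventually constant
value of `N`. Otherwise one starts from the empty multiset of known entries and repeats the step
`e - 2` times. -/
def recoverEntries (e : ℕ) (N : ℕ → ℕ) : Multiset ℕ :=
  if e = 3 then {sInf {n : ℕ | ∀ᶠ m in Filter.atTop, N m = n} + 1}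
  else (recoverStep e N)^[e - 2] 0

end Recovery

end

end ToricJets

/-! ### Points of the jet scheme of a monoid algebra as truncated multiplicative maps -/

namespace ToricJets

open PowerSeries

universe v

/-! Over a `K`-algebra `A`, a point of the jet scheme is a map `φ` from the semigroup to `A⟦X⟧` that
is multiplicative modulo `X ^ (m + 1)` (`IsJet.eval`, `exists_isJet`), and every prime of the jet
algebra is the kernel of such a jet over its residue field. Closures are compared through kernels:
specializing the parameters of a jet enlarges its kernel.

The semigroup has generators `u 0, …, u (n + 1)` with `u j + u (j + 2) = c (j + 1) • u (j + 1)` and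
`n = e - 2` (`dualChain`). Let `s` be the least order of a jet on the generators. Where it is
attained at `u (j + 1)`, dividing the neighbours by the jet `τ` of `u (j + 1)` gives a chart `ξ η =
τ ^ (c - 2)`. The order `a` of `u j` then lies between `s` and `s (c - 1)` and is visible only up to
`m + 1 - s`: the top `s` coefficients on the generators are free, because in products they meet a
factor of order at least `s` (`IsJet.add_perturbation`). The triples `(s, j, a)` thus index
irreducible families, with parameters in a localized polynomial ring of transcendence degree `2 (m +
1) + (n - 2) s`. A jet which is minimal at an end of the chain deforms to one minimal at the
neighbour too (`exists_deformation`), so the closures of the families cover the fibre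
(`exists_famPrime_le`), and `a = s` is needed only for `j = 0`.

No closure contains another (`CanonIndex.eq_of_famPrime_le`). For equal `s` the orders of suitable
generators separate the families; a family of larger `s` cannot contain one of smaller `s` in its
closure by semicontinuity of orders; the converse is excluded by dimension if `n ≥ 2`. For `n = 1`,
the surface `x y = z ^ c`, only `s = 1` survives: moving `z` to `z + λ X` and factoring the new
right-hand side over an integral extension of `L[λ]` shows that every jet is a limit of jets with `s
= 1` (`exists_polynomial_deformation`).

Counting triples gives `N`. For `n ≥ 2` it is `trialCount` at the full multiset, and the excess of
`trialCount` at a partial multiset is the sum of `contactLoss c m` over the missing entries. This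
loss is `0` for `m < c`, `1` for `m = c` and positive afterwards, so the first excess occurs at the
smallest missing entry and equals its multiplicity (`recoverStep_spec`). Finally `S_1^0` is an
affine space of dimension `e` (`exists_jetFiber_one_eq`), so the dimensions for `m = 1` supply `e`
in the second assertion. -/

/-- `φ : Γ → A⟦X⟧` is an `m`-jet if it is multiplicative modulo `X ^ (m + 1)`. -/
structure IsJet {Γ A : Type*} [AddCommMonoid Γ] [CommRing A] (m : ℕ) (φ : Γ → A⟦X⟧) : Prop where
  map_zero : (X : A⟦X⟧) ^ (m + 1) ∣ φ 0 - 1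
  map_add : ∀ u v, (X : A⟦X⟧) ^ (m + 1) ∣ φ (u + v) - φ u * φ v

section

variable {K A A' Γ : Type*} [Field K] [CommRing A] [Algebra K A] [CommRing A'] [Algebra K A']
  [AddCommMonoid Γ] {m : ℕ}

lemma coeff_eq_of_X_pow_dvd_sub {f g : A⟦X⟧} {N i : ℕ} (h : (X : A⟦X⟧) ^ N ∣ f - g) (hi : i < N) :
    coeff i f = coeff i g := by
  have := X_pow_dvd_iff.1 h i hi
  rwa [map_sub, sub_eq_zero] at this

lemma IsJet.map {φ : Γ → A⟦X⟧} (hφ : IsJet m φ) (f : A →+* A') :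
    IsJet m fun u => PowerSeries.map f (φ u) where
  map_zero := by
    have := _root_.map_dvd (PowerSeries.map f) hφ.map_zero
    simpa using this
  map_add u v := by
    have := _root_.map_dvd (PowerSeries.map f) (hφ.map_add u v)
    simpa using this

lemma IsJet.map_sum {φ : Γ → A⟦X⟧} (hφ : IsJet m φ) {ι : Type*} (s : Finset ι) (g : ι → Γ) :
    (X : A⟦X⟧) ^ (m + 1) ∣ φ (∑ i ∈ s, g i) - ∏ i ∈ s, φ (g i) := by
  classical
  induction s using Finset.induction_on with
  | empty => simpa using hφ.map_zero
  | insert a s ha ih =>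
    rw [Finset.sum_insert ha, Finset.prod_insert ha]
    have h := dvd_add (hφ.map_add (g a) (∑ i ∈ s, g i)) (ih.mul_left (φ (g a)))
    convert h using 1
    ring

variable (A m) in
/-- The ideal of `A⟦X⟧` generated by `X ^ (m + 1)`. -/
noncomputable abbrev truncIdeal : Ideal A⟦X⟧ := Ideal.span {(X : A⟦X⟧) ^ (m + 1)}

/-- The homomorphism `K[Γ] → A[X]/(X ^ (m + 1))` attached to an `m`-jet. -/
noncomputable def IsJet.toAlgHom (K : Type*) [Field K] [Algebra K A] {φ : Γ → A⟦X⟧}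
    (hφ : IsJet m φ) : AddMonoidAlgebra K Γ →ₐ[K] A⟦X⟧ ⧸ truncIdeal A m :=
  AddMonoidAlgebra.lift K _ Γ
    { toFun := fun u => Ideal.Quotient.mk _ (φ u.toAdd)
      map_one' := by
        rw [← map_one (Ideal.Quotient.mk _), Ideal.Quotient.eq, Ideal.mem_span_singleton]
        exact hφ.map_zero
      map_mul' := fun u v => by
        rw [← map_mul, Ideal.Quotient.eq, Ideal.mem_span_singleton]
        exact hφ.map_add _ _ }

lemma IsJet.toAlgHom_single {φ : Γ → A⟦X⟧} (hφ : IsJet m φ) (u : Γ) :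
    hφ.toAlgHom K (AddMonoidAlgebra.single u 1) = Ideal.Quotient.mk _ (φ u) := by
  simp [IsJet.toAlgHom]

lemma coeff_formalJet {R : Type*} (f : R) {i : ℕ} (hi : i ≤ m) :
    (formalJet K m f).coeff i = MvPolynomial.X (f, (⟨i, Nat.lt_succ_of_le hi⟩ : Fin (m + 1))) := by
  unfold formalJet
  rw [Polynomial.finsetSum_coeff, Finset.sum_eq_single ⟨i, Nat.lt_succ_of_le hi⟩]
  · simp
  · intro j _ hj
    rw [Polynomial.coeff_C_mul_X_pow, if_neg]
    exact fun h => hj (Fin.ext h.symm)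
  · simp

section

variable {R : Type*} [CommRing R] [Algebra K R]

/-- The truncated power series with coefficients the images of `f⁽⁰⁾, …, f⁽ᵐ⁾`. -/
noncomputable def homSeries (g : JetAlgebra K R m →ₐ[K] A) (f : R) : A⟦X⟧ :=
  ((formalJet K m f).map ((g : JetAlgebra K R m →+* A).comp
    (Ideal.Quotient.mk (jetIdeal K R m))) : Polynomial A)

/-- The image in `JetAlgebra` of the symbol `f⁽ⁱ⁾`. -/
noncomputable def jetCoord (K : Type*) [Field K] {R : Type*} [CommRing R] [Algebra K R] {m : ℕ}
    (f : R) (i : Fin (m + 1)) : JetAlgebra K R m :=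
  Ideal.Quotient.mk (jetIdeal K R m) (MvPolynomial.X (f, i))

lemma coeff_homSeries (g : JetAlgebra K R m →ₐ[K] A) (f : R) {i : ℕ} (hi : i ≤ m) :
    coeff i (homSeries g f) = g (jetCoord K f ⟨i, Nat.lt_succ_of_le hi⟩) := by
  rw [homSeries, Polynomial.coeff_coe, Polynomial.coeff_map, coeff_formalJet _ hi]
  rfl

lemma X_pow_dvd_of_isJetRelation (g : JetAlgebra K R m →ₐ[K] A) {F : Polynomial (JetVars K R m)}
    (hF : IsJetRelation K R m F) :
    (X : A⟦X⟧) ^ (m + 1) ∣ ((F.map ((g : JetAlgebra K R m →+* A).comp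
      (Ideal.Quotient.mk (jetIdeal K R m))) : Polynomial A) : A⟦X⟧) := by
  rw [X_pow_dvd_iff]
  intro i hi
  rw [Polynomial.coeff_coe, Polynomial.coeff_map]
  have : Ideal.Quotient.mk (jetIdeal K R m) (F.coeff i) = 0 :=
    Ideal.Quotient.eq_zero_iff_mem.2 (Ideal.subset_span ⟨F, hF, i, Nat.le_of_lt_succ hi, rfl⟩)
  simp [this]

lemma homSeries_add (g : JetAlgebra K R m →ₐ[K] A) (f₁ f₂ : R) :
    (X : A⟦X⟧) ^ (m + 1) ∣ homSeries g (f₁ + f₂) - (homSeries g f₁ + homSeries g f₂) := by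
  simpa [homSeries] using X_pow_dvd_of_isJetRelation g (.add f₁ f₂)

lemma homSeries_mul (g : JetAlgebra K R m →ₐ[K] A) (f₁ f₂ : R) :
    (X : A⟦X⟧) ^ (m + 1) ∣ homSeries g (f₁ * f₂) - homSeries g f₁ * homSeries g f₂ := by
  simpa [homSeries] using X_pow_dvd_of_isJetRelation g (.mul f₁ f₂)

lemma homSeries_algebraMap (g : JetAlgebra K R m →ₐ[K] A) (a : K) :
    (X : A⟦X⟧) ^ (m + 1) ∣ homSeries g (algebraMap K R a) - algebraMap K A⟦X⟧ a := by
  have h := X_pow_dvd_of_isJetRelation g (.const a)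
  have e : (Ideal.Quotient.mk (jetIdeal K R m)) (MvPolynomial.C a) =
    algebraMap K (JetAlgebra K R m) a := rfl
  simpa [homSeries, e, PowerSeries.algebraMap_apply] using h

/-- The homomorphism `R → A[X]/(X ^ (m + 1))` attached to an `A`-point of the jet scheme. -/
noncomputable def homToTrunc (g : JetAlgebra K R m →ₐ[K] A) : R →ₐ[K] A⟦X⟧ ⧸ truncIdeal A m where
  toFun f := Ideal.Quotient.mk _ (homSeries g f)
  map_one' := by
    rw [← map_one (Ideal.Quotient.mk _), Ideal.Quotient.eq, Ideal.mem_span_singleton]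
    simpa using homSeries_algebraMap g 1
  map_zero' := by
    rw [← map_zero (Ideal.Quotient.mk _), Ideal.Quotient.eq, Ideal.mem_span_singleton]
    simpa using homSeries_algebraMap g 0
  map_add' f₁ f₂ := by
    rw [← map_add (Ideal.Quotient.mk _), Ideal.Quotient.eq, Ideal.mem_span_singleton]
    exact homSeries_add g f₁ f₂
  map_mul' f₁ f₂ := by
    rw [← map_mul (Ideal.Quotient.mk _), Ideal.Quotient.eq, Ideal.mem_span_singleton]
    exact homSeries_mul g f₁ f₂
  commutes' a := by
    rw [IsScalarTower.algebraMap_apply K A⟦X⟧ (A⟦X⟧ ⧸ truncIdeal A m),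
      Ideal.Quotient.algebraMap_eq, Ideal.Quotient.eq, Ideal.mem_span_singleton]
    exact homSeries_algebraMap g a

lemma jetAlgebra_hom_ext {g₁ g₂ : JetAlgebra K R m →ₐ[K] A}
    (h : ∀ f i, g₁ (jetCoord K f i) = g₂ (jetCoord K f i)) : g₁ = g₂ := by
  refine Ideal.Quotient.algHom_ext _ (MvPolynomial.algHom_ext fun x => ?_)
  exact h x.1 x.2

lemma jetAlgebra_hom_ext_trunc {g₁ g₂ : JetAlgebra K R m →ₐ[K] A}
    (h : homToTrunc g₁ = homToTrunc g₂) : g₁ = g₂ := by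
  refine jetAlgebra_hom_ext fun f i => ?_
  have h1 : homToTrunc g₁ f = homToTrunc g₂ f := by rw [h]
  have h2 := Ideal.mem_span_singleton.1 (Ideal.Quotient.eq.1 h1)
  have h3 := coeff_eq_of_X_pow_dvd_sub h2 i.2
  rwa [coeff_homSeries _ _ i.is_le, coeff_homSeries _ _ i.is_le] at h3

/-- The `A`-point of the jet scheme attached to a homomorphism `R → A[X]/(X ^ (m + 1))`. -/
noncomputable def ofTrunc (Φ : R →ₐ[K] A⟦X⟧ ⧸ truncIdeal A m) : JetAlgebra K R m →ₐ[K] A :=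
  Ideal.Quotient.liftₐ (jetIdeal K R m)
    (MvPolynomial.aeval fun x : R × Fin (m + 1) => coeff (x.2 : ℕ) (Quotient.out (Φ x.1))) (by
      set ev := MvPolynomial.aeval (R := K)
        fun x : R × Fin (m + 1) => coeff (x.2 : ℕ) (Quotient.out (Φ x.1))
      -- `T` evaluates the symbols and then truncates; it sends the formal jet of `f` to `Φ f`. The
      -- jet relations therefore go to zero because `Φ` is a homomorphism, and reading off
      -- coefficients kills `jetIdeal`.
      let T : Polynomial (JetVars K R m) →+* A⟦X⟧ ⧸ truncIdeal A m :=
        (Ideal.Quotient.mk _).comp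
          ((Polynomial.coeToPowerSeries.ringHom).comp (Polynomial.mapRingHom (ev : _ →+* A)))
      have hT : ∀ f, T (formalJet K m f) = Φ f := by
        intro f
        have : Φ f = Ideal.Quotient.mk _ (Quotient.out (Φ f)) := (Quotient.out_eq (Φ f)).symm
        rw [this]
        change Ideal.Quotient.mk _ _ = _
        rw [Ideal.Quotient.eq, Ideal.mem_span_singleton, X_pow_dvd_iff]
        intro i hi
        rw [map_sub, sub_eq_zero]
        simp only [Polynomial.coe_mapRingHom, RingHom.comp_apply,
          Polynomial.coeToPowerSeries.ringHom_apply, Polynomial.coeff_coe, Polynomial.coeff_map,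
          coeff_formalJet f (Nat.le_of_lt_succ hi)]
        simp [ev]
      have hC : ∀ a : K, T (Polynomial.C (MvPolynomial.C a)) = algebraMap K _ a := by
        intro a
        change Ideal.Quotient.mk _ _ = _
        rw [IsScalarTower.algebraMap_apply K A⟦X⟧ (A⟦X⟧ ⧸ truncIdeal A m),
          Ideal.Quotient.algebraMap_eq]
        congr 1
        simp [PowerSeries.algebraMap_apply, ev]
      have hrel : ∀ F, IsJetRelation K R m F → T F = 0 := by
        rintro F (⟨f, g⟩ | ⟨f, g⟩ | a)
        · simp [hT]
        · simp [hT]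
        · simp [hT, hC]
      intro x hx
      have hle : jetIdeal K R m ≤ RingHom.ker ev := by
        refine Ideal.span_le.2 ?_
        rintro y ⟨F, hF, i, hi, rfl⟩
        have h1 := hrel F hF
        have h2 : (X : A⟦X⟧) ^ (m + 1) ∣ _ :=
          Ideal.mem_span_singleton.1 (Ideal.Quotient.eq_zero_iff_mem.1 h1)
        have h3 := X_pow_dvd_iff.1 h2 i (Nat.lt_succ_of_le hi)
        simpa using h3
      exact hle hx)

lemma ofTrunc_jetCoord (Φ : R →ₐ[K] A⟦X⟧ ⧸ truncIdeal A m) (f : R) (i : Fin (m + 1)) {x : A⟦X⟧}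
    (hx : Φ f = Ideal.Quotient.mk _ x) : ofTrunc Φ (jetCoord K f i) = coeff (i : ℕ) x := by
  have h1 : ofTrunc Φ (jetCoord K f i) = coeff (i : ℕ) (Quotient.out (Φ f)) := by
    change MvPolynomial.aeval _ (MvPolynomial.X (f, i)) = _
    rw [MvPolynomial.aeval_X]
  rw [h1]
  refine coeff_eq_of_X_pow_dvd_sub (N := m + 1) ?_ i.2
  rw [← Ideal.mem_span_singleton, ← Ideal.Quotient.eq, ← hx]
  exact Quotient.out_eq _

end

/-- The symbol of the coefficient of `Xⁱ` in the jet of the monomial `x^u`. -/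
noncomputable def monoCoord (K : Type*) [Field K] {Γ : Type*} [AddCommMonoid Γ] {m : ℕ} (u : Γ)
    (i : Fin (m + 1)) : JetAlgebra K (AddMonoidAlgebra K Γ) m :=
  jetCoord K (AddMonoidAlgebra.single u (1 : K)) i

/-- The `A`-point of the jet scheme of `Spec K[Γ]` attached to an `m`-jet. -/
noncomputable def IsJet.eval (K : Type*) [Field K] [Algebra K A] {φ : Γ → A⟦X⟧}
    (hφ : IsJet m φ) : JetAlgebra K (AddMonoidAlgebra K Γ) m →ₐ[K] A :=
  ofTrunc (hφ.toAlgHom K)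

lemma IsJet.eval_monoCoord {φ : Γ → A⟦X⟧} (hφ : IsJet m φ) (u : Γ) (i : Fin (m + 1)) :
    hφ.eval K (monoCoord K u i) = coeff (i : ℕ) (φ u) :=
  ofTrunc_jetCoord _ _ _ (hφ.toAlgHom_single u)

/-- The symbols of arbitrary elements need no separate check: a homomorphism from a monoid algebra
to the truncated series is determined by its values on monomials. -/
lemma hom_ext_monoCoord {g₁ g₂ : JetAlgebra K (AddMonoidAlgebra K Γ) m →ₐ[K] A}
    (h : ∀ u i, g₁ (monoCoord K u i) = g₂ (monoCoord K u i)) : g₁ = g₂ := by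
  refine jetAlgebra_hom_ext_trunc (AddMonoidAlgebra.algHom_ext (fun u => ?_) ?_)
  · refine Ideal.Quotient.eq.2 (Ideal.mem_span_singleton.2 (X_pow_dvd_iff.2 fun i hi => ?_))
    rw [map_sub, coeff_homSeries _ _ (Nat.le_of_lt_succ hi),
      coeff_homSeries _ _ (Nat.le_of_lt_succ hi), sub_eq_zero]
    exact h u _
  · exact AlgHom.ext fun a => by
      rw [Subsingleton.elim (α := K →ₐ[K] _) (AlgHom.comp _ _) _]

/-- The converse of `IsJet.eval`; points of the jet scheme may henceforth be replaced by jets on the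
semigroup. -/
lemma exists_isJet (g : JetAlgebra K (AddMonoidAlgebra K Γ) m →ₐ[K] A) :
    ∃ (φ : Γ → A⟦X⟧) (hφ : IsJet m φ), hφ.eval K = g := by
  have hφ : IsJet m fun u : Γ => homSeries g (AddMonoidAlgebra.single u (1 : K)) :=
    ⟨by simpa [AddMonoidAlgebra.one_def] using homSeries_algebraMap g 1, fun u v => by
      simpa [AddMonoidAlgebra.single_mul_single] using
        homSeries_mul g (AddMonoidAlgebra.single u (1 : K)) (AddMonoidAlgebra.single v 1)⟩
  refine ⟨_, hφ, hom_ext_monoCoord fun u i => ?_⟩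
  rw [hφ.eval_monoCoord, coeff_homSeries _ _ i.is_le]
  rfl

lemma IsJet.eval_congr {φ ψ : Γ → A⟦X⟧} (hφ : IsJet m φ) (hψ : IsJet m ψ)
    (h : ∀ u, (X : A⟦X⟧) ^ (m + 1) ∣ φ u - ψ u) : hφ.eval K = hψ.eval K :=
  hom_ext_monoCoord fun u i => by
    rw [hφ.eval_monoCoord, hψ.eval_monoCoord, coeff_eq_of_X_pow_dvd_sub (h u) i.2]

/-- Naturality in the coefficient ring. All kernel inclusions come from here: evaluation at a
specialized jet factors through evaluation at the original one. -/
lemma IsJet.eval_map {φ : Γ → A⟦X⟧} (hφ : IsJet m φ) (f : A →ₐ[K] A') :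
    (hφ.map (f : A →+* A')).eval K = f.comp (hφ.eval K) :=
  hom_ext_monoCoord fun u i => by
    rw [IsJet.eval_monoCoord, AlgHom.comp_apply, IsJet.eval_monoCoord, PowerSeries.coeff_map]
    rfl

end

end ToricJets

/-! ### Monomial charts, free top coefficients, and congruence of jets -/

namespace ToricJets

open PowerSeries

section Charts

variable {Γ R : Type*} [AddCommMonoid Γ] [CommRing R]

/-- The function which is `τ ^ h * ξ ^ β` where `0 ≤ β` and `τ ^ (h + k β) * η ^ (-β)` where
`β < 0`. -/
def chartFun (β h : Γ →+ ℤ) (k : ℕ) (τ ξ η : R) (u : Γ) : R :=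
  if 0 ≤ β u then τ ^ (h u).toNat * ξ ^ (β u).toNat
  else τ ^ (h u + k * β u).toNat * η ^ (-β u).toNat

variable {β h : Γ →+ ℤ} {k : ℕ} {τ ξ η D : R}

lemma chartFun_zero : chartFun β h k τ ξ η 0 = 1 := by
  simp [chartFun]

lemma map_chartFun {S : Type*} [CommRing S] (f : R →+* S) (u : Γ) :
    f (chartFun β h k τ ξ η u) = chartFun β h k (f τ) (f ξ) (f η) u := by
  unfold chartFun
  split_ifs <;> simp

/-- Only opposite signs of `β` can break multiplicativity: after cancelling common powers, the
defect is a multiple of `τ ^ (p + q) * ((ξ η) ^ g - (τ ^ k) ^ g)`, hence of the same power of `τ`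
times `ξ η - τ ^ k`. -/
lemma dvd_chartFun_add_sub_mul_of_neg (h₀ : ∀ u, 0 ≤ h u) (h₁ : ∀ u, 0 ≤ h u + k * β u)
    (H : ∀ u v, 0 < β u → β v < 0 →
      D ∣ τ ^ ((h u).toNat + (h v + k * β v).toNat) * (ξ * η - τ ^ k))
    {u v : Γ} (hu : 0 ≤ β u) (hv : β v < 0) :
    D ∣ chartFun β h k τ ξ η (u + v) - chartFun β h k τ ξ η u * chartFun β h k τ ξ η v := by
  obtain ⟨b, hb⟩ := Int.eq_ofNat_of_zero_le hu
  obtain ⟨g, hg⟩ := Int.eq_ofNat_of_zero_le (neg_nonneg.2 hv.le)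
  obtain ⟨p, hp⟩ := Int.eq_ofNat_of_zero_le (h₀ u)
  obtain ⟨q, hq⟩ := Int.eq_ofNat_of_zero_le (h₁ v)
  have hg' : β v = -(g : ℤ) := by omega
  have hq' : h v = q + k * g := by rw [hg'] at hq; linarith
  have yu : chartFun β h k τ ξ η u = τ ^ p * ξ ^ b := by
    simp [chartFun, hp, hb]
  have yv : chartFun β h k τ ξ η v = τ ^ q * η ^ g := by
    rw [chartFun, if_neg (by omega), hq, hg]; simp
  -- The divisibility is assumed only for `β u > 0`; when `β u = 0` no product `ξ η` arises and none
  -- is needed.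
  have key : b = 0 ∨ D ∣ τ ^ (p + q) * (ξ * η - τ ^ k) := by
    rcases Nat.eq_zero_or_pos b with h0 | h0
    · exact Or.inl h0
    · right
      have := H u v (by omega) hv
      rwa [hp, hq] at this
  rw [yu, yv]
  by_cases hs : 0 ≤ β (u + v)
  · have hs' : (0 : ℤ) ≤ b - g := by simpa [hb, hg', sub_eq_add_neg] using hs
    obtain ⟨d, rfl⟩ : ∃ d, b = g + d := ⟨b - g, by omega⟩
    have ys : chartFun β h k τ ξ η (u + v) = τ ^ (p + q + k * g) * ξ ^ d := by
      have e1 : h (u + v) = ((p + q + k * g : ℕ) : ℤ) := by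
        rw [map_add, hp, hq']; push_cast; ring
      have e2 : β (u + v) = (d : ℤ) := by rw [map_add, hb, hg']; push_cast; ring
      rw [chartFun, if_pos hs, e1, e2, Int.toNat_natCast, Int.toNat_natCast]
    have key' : D ∣ τ ^ (p + q) * (ξ * η - τ ^ k) := by
      rcases key with h0 | h0
      · omega
      · exact h0
    have e : τ ^ (p + q + k * g) * ξ ^ d - τ ^ p * ξ ^ (g + d) * (τ ^ q * η ^ g)
        = -(ξ ^ d * (τ ^ (p + q) * ((ξ * η) ^ g - (τ ^ k) ^ g))) := by ring
    rw [ys, e, dvd_neg]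
    refine Dvd.dvd.mul_left (key'.trans (mul_dvd_mul_left _ (sub_dvd_pow_sub_pow _ _ _))) _
  · have hs' : (b : ℤ) < g := by
      have : β (u + v) < 0 := not_le.1 hs
      rw [map_add, hb, hg'] at this
      omega
    obtain ⟨d, rfl⟩ : ∃ d, g = b + d := ⟨g - b, by omega⟩
    have ys : chartFun β h k τ ξ η (u + v) = τ ^ (p + q + k * b) * η ^ d := by
      have e2 : -β (u + v) = (d : ℤ) := by rw [map_add, hb, hg']; push_cast; ring
      have e1 : h (u + v) + k * β (u + v) = ((p + q + k * b : ℕ) : ℤ) := by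
        rw [neg_eq_iff_eq_neg.1 e2, map_add, hp, hq']; push_cast; ring
      rw [chartFun, if_neg hs, e1, e2, Int.toNat_natCast, Int.toNat_natCast]
    have e : τ ^ (p + q + k * b) * η ^ d - τ ^ p * ξ ^ b * (τ ^ q * η ^ (b + d))
        = -(η ^ d * (τ ^ (p + q) * ((ξ * η) ^ b - (τ ^ k) ^ b))) := by ring
    rw [ys, e, dvd_neg]
    rcases key with h0 | h0
    · simp [h0]
    · exact Dvd.dvd.mul_left (h0.trans (mul_dvd_mul_left _ (sub_dvd_pow_sub_pow _ _ _))) _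

lemma dvd_chartFun_add_sub_mul (h₀ : ∀ u, 0 ≤ h u) (h₁ : ∀ u, 0 ≤ h u + k * β u)
    (H : ∀ u v, 0 < β u → β v < 0 →
      D ∣ τ ^ ((h u).toNat + (h v + k * β v).toNat) * (ξ * η - τ ^ k)) (u v : Γ) :
    D ∣ chartFun β h k τ ξ η (u + v) - chartFun β h k τ ξ η u * chartFun β h k τ ξ η v := by
  rcases le_or_gt 0 (β u) with hu | hu
  · rcases le_or_gt 0 (β v) with hv | hv
    · have hs : 0 ≤ β (u + v) := by rw [map_add]; exact add_nonneg hu hv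
      have e : chartFun β h k τ ξ η (u + v)
          = chartFun β h k τ ξ η u * chartFun β h k τ ξ η v := by
        rw [chartFun, chartFun, chartFun, if_pos hs, if_pos hu, if_pos hv, map_add, map_add,
          Int.toNat_add (h₀ u) (h₀ v), Int.toNat_add hu hv]
        ring
      simp [e]
    · exact dvd_chartFun_add_sub_mul_of_neg h₀ h₁ H hu hv
  · rcases le_or_gt 0 (β v) with hv | hv
    · have := dvd_chartFun_add_sub_mul_of_neg h₀ h₁ H hv hu
      rwa [add_comm u v, mul_comm (chartFun β h k τ ξ η u)]
    · have hs : ¬ 0 ≤ β (u + v) := by rw [map_add]; omega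
      have e : chartFun β h k τ ξ η (u + v)
          = chartFun β h k τ ξ η u * chartFun β h k τ ξ η v := by
        rw [chartFun, chartFun, chartFun, if_neg hs, if_neg hu.not_ge, if_neg hv.not_ge,
          map_add, map_add,
          show h u + h v + (k : ℤ) * (β u + β v) = (h u + k * β u) + (h v + k * β v) by ring,
          Int.toNat_add (h₁ u) (h₁ v), neg_add,
          Int.toNat_add (a := -β u) (b := -β v) (by omega) (by omega)]
        ring
      simp [e]

lemma dvd_chartFun (h₀ : ∀ u, u ≠ 0 → 1 ≤ h u) (h₁ : ∀ u, u ≠ 0 → 1 ≤ h u + k * β u)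
    (hD : D ∣ τ) {u : Γ} (hu : u ≠ 0) : D ∣ chartFun β h k τ ξ η u := by
  have h2 := h₀ u hu
  have h3 := h₁ u hu
  unfold chartFun
  split_ifs
  · exact ((hD.trans (dvd_pow_self _ (by omega)))).mul_right _
  · exact ((hD.trans (dvd_pow_self _ (by omega)))).mul_right _

end Charts

section Perturbation

variable {Γ A : Type*} [AddCommMonoid Γ] [CommRing A] {m s : ℕ}

/-- Each nonzero element contributes at least one factor `τ`, so the chart equation `ξ η = τ ^ k` is
required only after multiplication by `τ ^ 2`. This slack is what leaves room for the parameter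
`famV`. -/
lemma isJet_chartFun {β h : Γ →+ ℤ} {k : ℕ} {τ ξ η : A⟦X⟧}
    (h₀ : ∀ u, u ≠ 0 → 1 ≤ h u) (h₁ : ∀ u, u ≠ 0 → 1 ≤ h u + k * β u)
    (H : (X : A⟦X⟧) ^ (m + 1) ∣ τ ^ 2 * (ξ * η - τ ^ k)) :
    IsJet m (chartFun β h k τ ξ η) where
  map_zero := by simp [chartFun_zero]
  map_add u v := by
    refine dvd_chartFun_add_sub_mul (fun u => ?_) (fun u => ?_) (fun u v hu hv => ?_) u v
    · rcases eq_or_ne u 0 with rfl | hu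
      · simp
      · exact zero_le_one.trans (h₀ u hu)
    · rcases eq_or_ne u 0 with rfl | hu
      · simp
      · exact zero_le_one.trans (h₁ u hu)
    · refine H.trans (mul_dvd_mul_right (pow_dvd_pow _ ?_) _)
      have hu' := h₀ u (by rintro rfl; simp at hu)
      have hv' := h₁ v (by rintro rfl; simp at hv)
      omega

/-- When `β ≥ 0` the second branch never occurs, so `ξ` is unconstrained; `k = 0` and `η = 0` are
placeholders. -/
lemma isJet_chartFun_of_nonneg {β h : Γ →+ ℤ} {τ ξ : A⟦X⟧}
    (h₀ : ∀ u, 0 ≤ h u) (hβ : ∀ u, 0 ≤ β u) :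
    IsJet m (chartFun β h 0 τ ξ 0) where
  map_zero := by simp [chartFun_zero]
  map_add u v := dvd_chartFun_add_sub_mul h₀ (by simpa using h₀)
    (fun u v _ hv => absurd hv (hβ v).not_gt) u v

/-- A cross term has order at least `(m + 1 - s) + s`, and a product of two perturbations has order
at least `2 (m + 1 - s) ≥ m + 1`; both vanish. As `z` is zero on sums of nonzero elements, the
left-hand side of the multiplicativity relation does not change either. -/
lemma IsJet.add_perturbation {φ z : Γ → A⟦X⟧} (hφ : IsJet m φ) (hs : 2 * s ≤ m + 1)
    (hd : ∀ u, u ≠ 0 → (X : A⟦X⟧) ^ s ∣ φ u) (hz0 : z 0 = 0)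
    (hz : ∀ u v, u ≠ 0 → v ≠ 0 → z (u + v) = 0) :
    IsJet m fun u => φ u + X ^ (m + 1 - s) * z u where
  map_zero := by simpa [hz0] using hφ.map_zero
  map_add u v := by
    have hX0 : (X : A⟦X⟧) ^ (m + 1) ∣ φ 0 - 1 := hφ.map_zero
    have key : ∀ v, (X : A⟦X⟧) ^ (m + 1) ∣ φ (0 + v) + X ^ (m + 1 - s) * z (0 + v) -
        (φ 0 + X ^ (m + 1 - s) * z 0) * (φ v + X ^ (m + 1 - s) * z v) := by
      intro v
      rw [zero_add, hz0]
      have e : φ v + X ^ (m + 1 - s) * z v -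
          (φ 0 + X ^ (m + 1 - s) * 0) * (φ v + X ^ (m + 1 - s) * z v)
          = (φ 0 - 1) * -(φ v + X ^ (m + 1 - s) * z v) := by ring
      rw [e]
      exact hX0.mul_right _
    rcases eq_or_ne u 0 with rfl | hu
    · exact key v
    rcases eq_or_ne v 0 with rfl | hv
    · have := key u
      rwa [add_comm u 0, mul_comm (φ u + _)]
    obtain ⟨p, hp⟩ := hd u hu
    obtain ⟨q, hq⟩ := hd v hv
    have hXs : (X : A⟦X⟧) ^ (m + 1 - s) * X ^ s = X ^ (m + 1) := by
      rw [← pow_add]; congr 1; omega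
    have hXs' : (X : A⟦X⟧) ^ (m + 1 - s) * X ^ (m + 1 - s) = X ^ (m + 1) * X ^ (m + 1 - 2 * s) := by
      rw [← pow_add, ← pow_add]; congr 1; omega
    rw [hz u v hu hv]
    have e : φ (u + v) + X ^ (m + 1 - s) * 0 -
        (φ u + X ^ (m + 1 - s) * z u) * (φ v + X ^ (m + 1 - s) * z v)
        = (φ (u + v) - φ u * φ v) - X ^ (m + 1) *
          (z u * q + z v * p + X ^ (m + 1 - 2 * s) * z u * z v) := by
      rw [hp, hq]
      linear_combination (-(z u * q) - z v * p) * hXs - z u * z v * hXs'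
    rw [e]
    exact dvd_sub (hφ.map_add u v) (dvd_mul_right _ _)

end Perturbation

section Close

variable {Γ A : Type*} [AddCommMonoid Γ] [CommRing A] {m s N : ℕ} {φ ψ : Γ → A⟦X⟧}

lemma IsJet.close_zero (hφ : IsJet m φ) (hψ : IsJet m ψ) (hN : N ≤ m + 1) :
    (X : A⟦X⟧) ^ N ∣ φ 0 - ψ 0 := by
  have := (pow_dvd_pow X hN).trans (dvd_sub hφ.map_zero hψ.map_zero)
  simpa using this

lemma IsJet.close_add (hφ : IsJet m φ) (hψ : IsJet m ψ) (hN : N ≤ m + 1) {u v : Γ}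
    (hu : (X : A⟦X⟧) ^ N ∣ φ u - ψ u) (hv : (X : A⟦X⟧) ^ N ∣ φ v - ψ v) :
    (X : A⟦X⟧) ^ N ∣ φ (u + v) - ψ (u + v) := by
  have h1 := (pow_dvd_pow X hN).trans (hφ.map_add u v)
  have h2 := (pow_dvd_pow X hN).trans (hψ.map_add u v)
  have e : φ (u + v) - ψ (u + v) = (φ (u + v) - φ u * φ v) - (ψ (u + v) - ψ u * ψ v)
      + ((φ u - ψ u) * φ v + ψ u * (φ v - ψ v)) := by ring
  rw [e]
  exact dvd_add (dvd_sub h1 h2) (dvd_add (hu.mul_right _) (hv.mul_left _))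

lemma IsJet.close_nsmul (hφ : IsJet m φ) (hψ : IsJet m ψ) (hN : N ≤ m + 1) {u : Γ}
    (hu : (X : A⟦X⟧) ^ N ∣ φ u - ψ u) (k : ℕ) :
    (X : A⟦X⟧) ^ N ∣ φ (k • u) - ψ (k • u) := by
  induction k with
  | zero => simpa using hφ.close_zero hψ hN
  | succ k ih => rw [succ_nsmul]; exact hφ.close_add hψ hN ih hu

lemma IsJet.close_sum (hφ : IsJet m φ) (hψ : IsJet m ψ) (hN : N ≤ m + 1) {ι : Type*}
    (S : Finset ι) (g : ι → Γ) (h : ∀ i ∈ S, (X : A⟦X⟧) ^ N ∣ φ (g i) - ψ (g i)) :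
    (X : A⟦X⟧) ^ N ∣ φ (∑ i ∈ S, g i) - ψ (∑ i ∈ S, g i) := by
  classical
  induction S using Finset.induction_on with
  | empty => simpa using hφ.close_zero hψ hN
  | insert a S ha ih =>
    rw [Finset.sum_insert ha]
    exact hφ.close_add hψ hN (h a (Finset.mem_insert_self _ _))
      (ih fun i hi => h i (Finset.mem_insert_of_mem hi))

/-- Products of two terms of order `≥ s` gain `s` orders of closeness. -/
lemma IsJet.close_add_add (hφ : IsJet m φ) (hψ : IsJet m ψ) (hs : s ≤ m + 1) {u v w : Γ}
    (hu : (X : A⟦X⟧) ^ (m + 1 - s) ∣ φ u - ψ u) (hv : (X : A⟦X⟧) ^ (m + 1 - s) ∣ φ v - ψ v)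
    (hw : (X : A⟦X⟧) ^ (m + 1 - s) ∣ φ w - ψ w)
    (hu' : (X : A⟦X⟧) ^ s ∣ φ u) (hv' : (X : A⟦X⟧) ^ s ∣ φ v) (hv'' : (X : A⟦X⟧) ^ s ∣ ψ v) :
    (X : A⟦X⟧) ^ (m + 1) ∣ φ (u + v + w) - ψ (u + v + w) := by
  have e : (X : A⟦X⟧) ^ (m + 1) = X ^ (m + 1 - s) * X ^ s := by
    rw [← pow_add]; congr 1; omega
  have h1 : ∀ {χ : Γ → A⟦X⟧}, IsJet m χ →
      (X : A⟦X⟧) ^ (m + 1) ∣ χ (u + v + w) - χ u * χ v * χ w := by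
    intro χ hχ
    have := dvd_add (hχ.map_add (u + v) w) ((hχ.map_add u v).mul_right (χ w))
    convert this using 1
    ring
  have h4 : (X : A⟦X⟧) ^ (m + 1) ∣ (φ v - ψ v) * φ u * ψ w := by
    rw [e]; exact (mul_dvd_mul hv hu').mul_right _
  have h7 : (X : A⟦X⟧) ^ (m + 1) ∣ (φ w - ψ w) * φ v * φ u := by
    rw [e]; exact (mul_dvd_mul hw hv').mul_right _
  have h8 : (X : A⟦X⟧) ^ (m + 1) ∣ (φ u - ψ u) * ψ v * ψ w := by
    rw [e]; exact (mul_dvd_mul hu hv'').mul_right _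
  have e2 : φ (u + v + w) - ψ (u + v + w) = (φ (u + v + w) - φ u * φ v * φ w)
      - (ψ (u + v + w) - ψ u * ψ v * ψ w) + ((φ w - ψ w) * φ v * φ u
      + (φ v - ψ v) * φ u * ψ w + (φ u - ψ u) * ψ v * ψ w) := by ring
  rw [e2]
  exact dvd_add (dvd_sub (h1 hφ) (h1 hψ)) (dvd_add (dvd_add h7 h4) h8)

end Close

end ToricJets

/-! ### Geometry of the chain of generators and propagation of congruences along it -/

namespace ToricJets

open PowerSeries

/-- Generators `u₀, …, u_{n+1}` of a two-dimensional semigroup with the relations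
`u_{i-1} + u_{i+1} = c_i u_i`, together with the functionals `b i` vanishing on `u i` and equal to
`1` on `u (i + 1)`. -/
structure HJChain (Γ : Type*) [AddCommMonoid Γ] where
  n : ℕ
  c : ℕ → ℕ
  u : ℕ → Γ
  b : ℕ → Γ →+ ℤ
  n_pos : 1 ≤ n
  two_le : ∀ i, 2 ≤ c i
  u_rel : ∀ i < n, u i + u (i + 2) = c (i + 1) • u (i + 1)
  b_rel : ∀ i < n, ∀ x, b i x + b (i + 2) x = c (i + 1) * b (i + 1) x
  b_self : ∀ i ≤ n + 1, b i (u i) = 0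
  b_succ : ∀ i ≤ n, b i (u (i + 1)) = 1
  b_pred : ∀ i ≤ n, b (i + 1) (u i) = -1
  b_zero_nonneg : ∀ x, 0 ≤ b 0 x
  b_last_nonpos : ∀ x, b (n + 1) x ≤ 0
  decomp : ∀ i ≤ n, ∀ x, 0 ≤ b i x → b (i + 1) x ≤ 0 →
    x = (-b (i + 1) x).toNat • u i + (b i x).toNat • u (i + 1)
  separates : ∀ x y, b 0 x = b 0 y → b 1 x = b 1 y → x = y

section Convexity

variable {n : ℕ} {c : ℕ → ℕ} {f : ℕ → ℤ}

/-- Since `c ≥ 2`, the recursion makes the second difference `(c - 2) f` nonnegative as long as `f ≥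
0`; a sequence that starts to rise keeps rising. -/
lemma convex_mono_right (hc : ∀ i, 2 ≤ c i)
    (hf : ∀ i < n, f i + f (i + 2) = c (i + 1) * f (i + 1)) {i : ℕ}
    (h0 : 0 ≤ f (i + 1)) (h1 : f i ≤ f (i + 1)) (k : ℕ) (hk : i + k ≤ n) :
    f (i + k) ≤ f (i + k + 1) ∧ f (i + 1) ≤ f (i + k + 1) := by
  induction k with
  | zero => exact ⟨h1, le_rfl⟩
  | succ k ih =>
    obtain ⟨h2, h3⟩ := ih (by omega)
    have h4 := hf (i + k) (by omega)
    have h5 : (2 : ℤ) ≤ c (i + k + 1) := by exact_mod_cast hc _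
    have h6 : 2 * f (i + k + 1) ≤ c (i + k + 1) * f (i + k + 1) :=
      mul_le_mul_of_nonneg_right h5 (by omega)
    have e1 : i + (k + 1) = i + k + 1 := by omega
    have e2 : i + k + 1 + 1 = i + k + 2 := by omega
    rw [e1, e2]
    exact ⟨by linarith, by linarith⟩

lemma convex_mono_left (hc : ∀ i, 2 ≤ c i)
    (hf : ∀ i < n, f i + f (i + 2) = c (i + 1) * f (i + 1)) {i : ℕ} (hi : i ≤ n)
    (h0 : 0 ≤ f i) (h1 : f (i + 1) ≤ f i) (k : ℕ) (hk : k ≤ i) :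
    f (i - k + 1) ≤ f (i - k) ∧ f i ≤ f (i - k) := by
  induction k with
  | zero => exact ⟨h1, le_rfl⟩
  | succ k ih =>
    obtain ⟨h2, h3⟩ := ih (by omega)
    obtain ⟨j, hj⟩ : ∃ j, i - k = j + 1 := ⟨i - k - 1, by omega⟩
    have e1 : i - (k + 1) = j := by omega
    rw [hj] at h2 h3
    rw [e1]
    have h4 := hf j (by omega)
    have h5 : (2 : ℤ) ≤ c (j + 1) := by exact_mod_cast hc _
    have h6 : 2 * f (j + 1) ≤ c (j + 1) * f (j + 1) :=
      mul_le_mul_of_nonneg_right h5 (by omega)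
    have e2 : j + 1 + 1 = j + 2 := by omega
    rw [e2] at h2
    exact ⟨by linarith, by linarith⟩

end Convexity

namespace HJChain

variable {Γ : Type*} [AddCommMonoid Γ] (C : HJChain Γ)

/-- The functional which is `1` on `u i` and on `u (i + 1)`. -/
def h (i : ℕ) : Γ →+ ℤ := C.b i - C.b (i + 1)

lemma h_apply (i : ℕ) (x : Γ) : C.h i x = C.b i x - C.b (i + 1) x := rfl

lemma map_u_rel (f : Γ →+ ℤ) (i : ℕ) (hi : i < C.n) :
    f (C.u i) + f (C.u (i + 2)) = C.c (i + 1) * f (C.u (i + 1)) := by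
  rw [← map_add, C.u_rel i hi, map_nsmul, nsmul_eq_mul]

lemma h_self {i : ℕ} (hi : i ≤ C.n) : C.h i (C.u i) = 1 := by
  rw [h_apply, C.b_self i (by omega), C.b_pred i hi]; norm_num

lemma h_succ {i : ℕ} (hi : i ≤ C.n) : C.h i (C.u (i + 1)) = 1 := by
  rw [h_apply, C.b_self (i + 1) (by omega), C.b_succ i hi]; norm_num

lemma one_le_h_u {i k : ℕ} (hi : i ≤ C.n) (hk : k ≤ C.n + 1) : 1 ≤ C.h i (C.u k) := by
  rcases Nat.lt_or_ge i k with h1 | h1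
  · have := (convex_mono_right C.two_le (C.map_u_rel (C.h i)) (i := i) (by simp [C.h_succ hi])
      (by rw [C.h_succ hi, C.h_self hi]) (k - i - 1) (by omega)).2
    rwa [C.h_succ hi, show i + (k - i - 1) + 1 = k by omega] at this
  · have := (convex_mono_left C.two_le (C.map_u_rel (C.h i)) hi (by simp [C.h_self hi])
      (by rw [C.h_succ hi, C.h_self hi]) (i - k) (by omega)).2
    rwa [C.h_self hi, show i - (i - k) = k by omega] at this

/-- By the recursion the value at `u (k + 1)` is `c k` times that at `u k` minus that at `u (k -
1)`; the values increase from `1`, so it is at least `c k - 1` times the value at `u k`. This bounds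
orders far from the centre of a chart. -/
lemma sub_one_le_h_u {i k : ℕ} (hik : i + 1 ≤ k) (hk : k ≤ C.n) :
    (C.c k : ℤ) - 1 ≤ C.h i (C.u (k + 1)) := by
  have hi : i ≤ C.n := by omega
  obtain ⟨d, rfl⟩ : ∃ d, k = i + d + 1 := ⟨k - i - 1, by omega⟩
  have h1 := convex_mono_right C.two_le (C.map_u_rel (C.h i)) (i := i) (by simp [C.h_succ hi])
      (by rw [C.h_succ hi, C.h_self hi]) d (by omega)
  rw [C.h_succ hi] at h1
  have h2 := C.map_u_rel (C.h i) (i + d) (by omega)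
  have h3 : (2 : ℤ) ≤ C.c (i + d + 1) := by exact_mod_cast C.two_le _
  have h4 : C.h i (C.u (i + d + 2)) = C.h i (C.u (i + d + 1 + 1)) := rfl
  nlinarith

lemma one_le_b_u {i k : ℕ} (hik : i < k) (hk : k ≤ C.n + 1) : 1 ≤ C.b i (C.u k) := by
  have hi : i ≤ C.n := by omega
  have := (convex_mono_right C.two_le (C.map_u_rel (C.b i)) (i := i) (by simp [C.b_succ i hi])
    (by rw [C.b_succ i hi, C.b_self i (by omega)]; norm_num) (k - i - 1) (by omega)).2
  rwa [C.b_succ i hi, show i + (k - i - 1) + 1 = k by omega] at this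

lemma b_u_le_neg_one {i k : ℕ} (hik : k < i) (hi : i ≤ C.n + 1) : C.b i (C.u k) ≤ -1 := by
  obtain ⟨j, rfl⟩ : ∃ j, i = j + 1 := ⟨i - 1, by omega⟩
  have := (convex_mono_left C.two_le (C.map_u_rel (-C.b (j + 1))) (i := j) (by omega)
    (by simp [C.b_pred j (by omega)])
    (by simp [C.b_pred j (by omega), C.b_self (j + 1) hi]) (j - k) (by omega)).2
  rw [show j - (j - k) = k by omega] at this
  simp only [AddMonoidHom.neg_apply, C.b_pred j (by omega)] at this
  omega

lemma u_injOn {i k : ℕ} (hi : i ≤ C.n + 1) (hk : k ≤ C.n + 1) (hik : C.u i = C.u k) : i = k := by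
  rcases lt_trichotomy i k with h1 | h1 | h1
  · have := C.one_le_b_u h1 hk
    rw [← hik, C.b_self i hi] at this
    omega
  · exact h1
  · have := C.one_le_b_u h1 hi
    rw [hik, C.b_self k hk] at this
    omega

/-- Consecutive generators span cones covering the semigroup: the right cone is found at the first
sign change of `b (i + 1) x`. -/
lemma exists_decomp (x : Γ) : ∃ i ≤ C.n, ∃ p q : ℕ, x = p • C.u i + q • C.u (i + 1) := by
  classical
  have hex : ∃ i, C.b (i + 1) x ≤ 0 := ⟨C.n, C.b_last_nonpos x⟩
  have h1 := Nat.find_spec hex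
  have h2 : Nat.find hex ≤ C.n := Nat.find_min' hex (C.b_last_nonpos x)
  refine ⟨Nat.find hex, h2, _, _, C.decomp _ h2 x ?_ h1⟩
  rcases Nat.eq_zero_or_pos (Nat.find hex) with h0 | h0
  · rw [h0]; exact C.b_zero_nonneg x
  · have := Nat.find_min hex (m := Nat.find hex - 1) (by omega)
    rw [Nat.sub_add_cancel h0] at this
    omega

/-- By convexity `h i` is at least `1` on every generator. In a chart this means that every nonzero
element has order at least that of `τ`. -/
lemma one_le_h {i : ℕ} (hi : i ≤ C.n) {x : Γ} (hx : x ≠ 0) : 1 ≤ C.h i x := by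
  obtain ⟨j, hj, p, q, rfl⟩ := C.exists_decomp x
  have h1 := C.one_le_h_u (k := j) hi (by omega)
  have h2 := C.one_le_h_u (k := j + 1) hi (by omega)
  simp only [map_add, map_nsmul, nsmul_eq_mul]
  have h3 : p ≠ 0 ∨ q ≠ 0 := by
    by_contra! h
    exact hx (by simp [h.1, h.2])
  have h4 : (p : ℤ) ≤ p * C.h i (C.u j) := le_mul_of_one_le_right (by positivity) h1
  have h5 : (q : ℤ) ≤ q * C.h i (C.u (j + 1)) := le_mul_of_one_le_right (by positivity) h2
  omega

lemma h_nonneg {i : ℕ} (hi : i ≤ C.n) (x : Γ) : 0 ≤ C.h i x := by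
  rcases eq_or_ne x 0 with rfl | hx
  · simp
  · exact zero_le_one.trans (C.one_le_h hi hx)

lemma u_ne_zero {k : ℕ} (hk : k ≤ C.n + 1) : C.u k ≠ 0 := by
  intro h0
  have := C.one_le_h_u (i := 0) (Nat.zero_le _) hk
  simp [h0] at this

lemma exists_h_u_eq_one {k : ℕ} (hk : k ≤ C.n + 1) : ∃ i ≤ C.n, C.h i (C.u k) = 1 := by
  rcases Nat.lt_or_ge C.n k with h1 | h1
  · obtain rfl : k = C.n + 1 := by omega
    exact ⟨C.n, le_rfl, C.h_succ le_rfl⟩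
  · exact ⟨k, h1, C.h_self h1⟩

/-- The generators are indecomposable. -/
lemma add_ne_u {k : ℕ} (hk : k ≤ C.n + 1) {x y : Γ} (hx : x ≠ 0) (hy : y ≠ 0) :
    x + y ≠ C.u k := by
  intro h0
  obtain ⟨i, hi, h1⟩ := C.exists_h_u_eq_one hk
  have h2 := C.one_le_h hi hx
  have h3 := C.one_le_h hi hy
  rw [← h0, map_add] at h1
  omega

/-- Functions on `Γ` supported on the generators. -/
noncomputable def onGens {R : Type*} [Zero R] (z : Fin (C.n + 2) → R) (x : Γ) : R := by
  classical
  exact if hx : ∃ k : Fin (C.n + 2), x = C.u k then z hx.choose else 0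

lemma onGens_u {R : Type*} [Zero R] (z : Fin (C.n + 2) → R) (k : Fin (C.n + 2)) :
    C.onGens z (C.u k) = z k := by
  have hx : ∃ k' : Fin (C.n + 2), C.u k = C.u k' := ⟨k, rfl⟩
  rw [onGens, dif_pos hx]
  congr 1
  have := hx.choose_spec
  exact Fin.ext (C.u_injOn (Nat.le_of_lt_succ hx.choose.2) (Nat.le_of_lt_succ k.2) this.symm)

lemma onGens_zero {R : Type*} [Zero R] (z : Fin (C.n + 2) → R) : C.onGens z 0 = 0 := by
  rw [onGens, dif_neg]
  rintro ⟨k, hk⟩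
  exact C.u_ne_zero (Nat.le_of_lt_succ k.2) hk.symm

lemma onGens_add {R : Type*} [Zero R] (z : Fin (C.n + 2) → R) (x y : Γ) (hx : x ≠ 0)
    (hy : y ≠ 0) : C.onGens z (x + y) = 0 := by
  rw [onGens, dif_neg]
  rintro ⟨k, hk⟩
  exact C.add_ne_u (Nat.le_of_lt_succ k.2) hx hy hk

lemma map_onGens {R S : Type*} [Zero R] [Zero S] (f : R → S) (hf : f 0 = 0)
    (z : Fin (C.n + 2) → R) (x : Γ) : f (C.onGens z x) = C.onGens (fun k => f (z k)) x := by
  unfold onGens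
  split_ifs <;> simp [hf]

/-- Substitute for cancellation in `Γ`: identities that would require subtraction are verified after
applying homomorphisms to `ℤ`. -/
lemma eq_of_forall_hom (C : HJChain Γ) {x y : Γ} (hxy : ∀ f : Γ →+ ℤ, f x = f y) : x = y :=
  C.separates _ _ (hxy _) (hxy _)

/-- For `i + 2 ≤ j` the sum `u i + u j` is a sum of generators strictly in between. -/
lemma u_add_u (i d : ℕ) (hd : i + d + 2 ≤ C.n + 1) :
    C.u i + C.u (i + d + 2) = C.u (i + 1) + C.u (i + d + 1) +
      ∑ k ∈ Finset.range (d + 1), (C.c (i + k + 1) - 2) • C.u (i + k + 1) := by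
  induction d with
  | zero =>
    have h2 := C.two_le (i + 1)
    rw [show i + 0 + 2 = i + 2 by rfl, C.u_rel i (by omega), zero_add, Finset.sum_range_one,
      show i + 0 + 1 = i + 1 by rfl, ← two_nsmul, ← add_nsmul]
    congr 1; omega
  | succ d ih =>
    have ih' := ih (by omega)
    have h1 := C.u_rel (i + d + 1) (by omega)
    refine C.eq_of_forall_hom fun f => ?_
    have e1 := congrArg f ih'
    have e2 := congrArg f h1
    rw [Finset.sum_range_succ]
    have h2 := C.two_le (i + d + 1 + 1)
    simp only [map_add, map_nsmul, nsmul_eq_mul, map_sum,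
      show i + (d + 1) + 2 = i + d + 1 + 2 by ring, show i + (d + 1) + 1 = i + d + 1 + 1 by ring,
      show i + d + 2 = i + d + 1 + 1 by ring] at e1 e2 ⊢
    rw [Nat.cast_sub h2]
    push_cast at e1 ⊢
    linarith

end HJChain

section Propagation

variable {Γ A : Type*} [AddCommMonoid Γ] [CommRing A] {m s : ℕ} {φ ψ : Γ → A⟦X⟧}

lemma IsJet.close_of_gens (C : HJChain Γ) (hφ : IsJet m φ) (hψ : IsJet m ψ)
    (h : ∀ k ≤ C.n + 1, (X : A⟦X⟧) ^ (m + 1) ∣ φ (C.u k) - ψ (C.u k)) (x : Γ) :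
    (X : A⟦X⟧) ^ (m + 1) ∣ φ x - ψ x := by
  obtain ⟨i, hi, p, q, rfl⟩ := C.exists_decomp x
  exact hφ.close_add hψ le_rfl (hφ.close_nsmul hψ le_rfl (h i (by omega)) p)
    (hφ.close_nsmul hψ le_rfl (h (i + 1) (by omega)) q)

/-- If two jets of order `≥ s` are close at `u i`, `u (i + 1)`, `u (j - 1)`, …, they are close at
`u j`. -/
lemma IsJet.close_mul (hφ : IsJet m φ) (hψ : IsJet m ψ) (hs : s ≤ m + 1) {u v u' v' w : Γ}
    (hrel : u + v = u' + v' + w)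
    (hu : (X : A⟦X⟧) ^ (m + 1 - s) ∣ φ u - ψ u)
    (hu' : (X : A⟦X⟧) ^ (m + 1 - s) ∣ φ u' - ψ u') (hv' : (X : A⟦X⟧) ^ (m + 1 - s) ∣ φ v' - ψ v')
    (hw : (X : A⟦X⟧) ^ (m + 1 - s) ∣ φ w - ψ w)
    (dv : (X : A⟦X⟧) ^ s ∣ φ v) (du' : (X : A⟦X⟧) ^ s ∣ φ u') (dv' : (X : A⟦X⟧) ^ s ∣ φ v')
    (dv'' : (X : A⟦X⟧) ^ s ∣ ψ v') :
    (X : A⟦X⟧) ^ (m + 1) ∣ ψ u * (φ v - ψ v) := by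
  have h1 := hφ.close_add_add hψ hs hu' hv' hw du' dv' dv''
  rw [← hrel] at h1
  have h2 : (X : A⟦X⟧) ^ (m + 1) ∣ (φ u - ψ u) * φ v := by
    rw [show m + 1 = (m + 1 - s) + s by omega, pow_add]
    exact mul_dvd_mul hu dv
  have e : ψ u * (φ v - ψ v) = (φ (u + v) - ψ (u + v)) - (φ (u + v) - φ u * φ v)
      + (ψ (u + v) - ψ u * ψ v) - (φ u - ψ u) * φ v := by ring
  rw [e]
  exact dvd_sub (dvd_add (dvd_sub h1 (hφ.map_add u v)) (hψ.map_add u v)) h2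

variable (C : HJChain Γ)

/-- Replace `u i + u (i + d + 2)` by generators strictly in between (`C.u_add_u`). Two factors of
order `s` raise the precision from `m + 1 - s` to `m + 1`, and cancelling `ψ (C.u i)` costs at most
`s` again, so the induction loses nothing. -/
lemma IsJet.close_right (hφ : IsJet m φ) (hψ : IsJet m ψ) (hs : s ≤ m + 1)
    (dφ : ∀ k ≤ C.n + 1, (X : A⟦X⟧) ^ s ∣ φ (C.u k))
    (dψ : ∀ k ≤ C.n + 1, (X : A⟦X⟧) ^ s ∣ ψ (C.u k)) {i : ℕ}
    (hcancel : ∀ f, (X : A⟦X⟧) ^ (m + 1) ∣ ψ (C.u i) * f → (X : A⟦X⟧) ^ (m + 1 - s) ∣ f)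
    (h0 : (X : A⟦X⟧) ^ (m + 1 - s) ∣ φ (C.u i) - ψ (C.u i))
    (h1 : (X : A⟦X⟧) ^ (m + 1 - s) ∣ φ (C.u (i + 1)) - ψ (C.u (i + 1))) (d : ℕ)
    (hd : i + d ≤ C.n + 1) :
    (X : A⟦X⟧) ^ (m + 1 - s) ∣ φ (C.u (i + d)) - ψ (C.u (i + d)) := by
  induction d using Nat.strong_induction_on with
  | _ d ih =>
  rcases d with _ | _ | d
  · exact h0
  · exact h1
  refine hcancel _ (hφ.close_mul hψ hs (C.u_add_u i d hd) h0 h1 (ih (d + 1) (by omega) (by omega))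
    (hφ.close_sum hψ (by omega) _ _ fun k hk => hφ.close_nsmul hψ (by omega) ?_ _)
    (dφ _ hd) (dφ _ (by omega)) (dφ _ (by omega)) (dψ _ (by omega)))
  have := Finset.mem_range.1 hk
  exact ih (k + 1) (by omega) (by omega)

/-- The mirror image of `IsJet.close_right`: the pivot is now `u (i + 1)`, the right end of the
relation. -/
lemma IsJet.close_left (hφ : IsJet m φ) (hψ : IsJet m ψ) (hs : s ≤ m + 1)
    (dφ : ∀ k ≤ C.n + 1, (X : A⟦X⟧) ^ s ∣ φ (C.u k))
    (dψ : ∀ k ≤ C.n + 1, (X : A⟦X⟧) ^ s ∣ ψ (C.u k)) {i : ℕ} (hi : i ≤ C.n)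
    (hcancel : ∀ f, (X : A⟦X⟧) ^ (m + 1) ∣ ψ (C.u (i + 1)) * f → (X : A⟦X⟧) ^ (m + 1 - s) ∣ f)
    (h0 : (X : A⟦X⟧) ^ (m + 1 - s) ∣ φ (C.u (i + 1)) - ψ (C.u (i + 1)))
    (h1 : (X : A⟦X⟧) ^ (m + 1 - s) ∣ φ (C.u i) - ψ (C.u i)) (d : ℕ) (hd : d ≤ i + 1) :
    (X : A⟦X⟧) ^ (m + 1 - s) ∣ φ (C.u (i + 1 - d)) - ψ (C.u (i + 1 - d)) := by
  induction d using Nat.strong_induction_on with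
  | _ d ih =>
  rcases d with _ | _ | d
  · exact h0
  · exact h1
  obtain ⟨j, rfl⟩ : ∃ j, i = j + d + 1 := ⟨i - d - 1, by omega⟩
  have key := C.u_add_u j d (by omega)
  rw [add_comm (C.u j), add_comm (C.u (j + 1))] at key
  have e1 : j + d + 1 + 1 - (d + 1 + 1) = j := by omega
  rw [e1]
  have hstep : ∀ k ≤ d, (X : A⟦X⟧) ^ (m + 1 - s) ∣
      φ (C.u (j + k + 1)) - ψ (C.u (j + k + 1)) := fun k hk => by
    have := ih (d + 1 - k) (by omega) (by omega)
    rwa [show j + d + 1 + 1 - (d + 1 - k) = j + k + 1 by omega] at this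
  refine hcancel _ (hφ.close_mul hψ hs key h0 h1 (hstep 0 (Nat.zero_le _))
    (hφ.close_sum hψ (by omega) _ _ fun k hk => hφ.close_nsmul hψ (by omega)
      (hstep k (Nat.le_of_lt_succ (Finset.mem_range.1 hk))) _)
    (dφ _ (by omega)) (dφ _ (by omega)) (dφ _ (by omega)) (dψ _ (by omega)))

end Propagation

end ToricJets

/-! ### Continued fractions and the Hilbert basis of the dual cone -/

namespace ToricJets

section Continuants

/-- Numerator and denominator of a Hirzebruch–Jung continued fraction. -/
def hjPair : List ℕ → ℤ × ℤ
  | [] => (1, 0)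
  | c :: l => (c * (hjPair l).1 - (hjPair l).2, (hjPair l).1)

lemma hjPair_nonneg {cs : List ℕ} (h : ∀ c ∈ cs, 2 ≤ c) :
    0 ≤ (hjPair cs).2 ∧ (hjPair cs).2 < (hjPair cs).1 := by
  induction cs with
  | nil => simp [hjPair]
  | cons c l ih =>
    obtain ⟨h1, h2⟩ := ih fun c hc => h c (List.mem_cons_of_mem _ hc)
    have h3 : (2 : ℤ) ≤ c := by exact_mod_cast h c List.mem_cons_self
    simp only [hjPair]
    constructor
    · omega
    · nlinarith

lemma hjPair_isCoprime (cs : List ℕ) : IsCoprime (hjPair cs).1 (hjPair cs).2 := by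
  induction cs with
  | nil => exact isCoprime_one_left
  | cons c l ih =>
    obtain ⟨a, b, hab⟩ := ih
    exact ⟨-b, a + c * b, by simp only [hjPair]; linear_combination hab⟩

lemma hjValue_eq {cs : List ℕ} (h : ∀ c ∈ cs, 2 ≤ c) (hne : cs ≠ []) :
    hjValue cs = ((hjPair cs).1 : ℚ) / (hjPair cs).2 := by
  induction cs with
  | nil => exact absurd rfl hne
  | cons c l ih =>
    rcases l with _ | ⟨d, l⟩
    · simp [hjValue, hjPair]
    · have hl : ∀ c ∈ d :: l, 2 ≤ c := fun c hc => h c (List.mem_cons_of_mem _ hc)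
      have h1 := hjPair_nonneg hl
      have h2 : ((hjPair (d :: l)).1 : ℚ) ≠ 0 := by
        have : (hjPair (d :: l)).1 ≠ 0 := by omega
        exact_mod_cast this
      rw [hjValue, ih hl (by simp), show hjPair (c :: d :: l) =
        (c * (hjPair (d :: l)).1 - (hjPair (d :: l)).2, (hjPair (d :: l)).1) from rfl]
      push_cast
      rw [one_div_div]
      field_simp

/-- The numerator and denominator produced by the recursion are coprime with positive denominator,
as are `q` and `p`; reduced fractions are unique. -/
lemma hjPair_eq {p q : ℕ} {cs : List ℕ} (hp : 0 < p) (hcop : Nat.Coprime p q)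
    (hcs : IsHJExpansion cs ((q : ℚ) / (p : ℚ))) : (hjPair cs).1 = q ∧ (hjPair cs).2 = p := by
  obtain ⟨hne, h2, hv⟩ := hcs
  rw [hjValue_eq h2 hne] at hv
  have h1 := hjPair_nonneg h2
  have hpos : 0 < (hjPair cs).2 := by
    rcases cs with _ | ⟨c, l⟩
    · exact absurd rfl hne
    · have := hjPair_nonneg fun c hc => h2 c (List.mem_cons_of_mem _ hc)
      simp only [hjPair]; omega
  have hv' : ((hjPair cs).1 : ℚ) / ((hjPair cs).2 : ℚ) = ((q : ℤ) : ℚ) / ((p : ℤ) : ℚ) := by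
    rw [hv]; push_cast; rfl
  refine Rat.div_int_inj hpos (by exact_mod_cast hp) ?_ ?_ hv'
  · exact Int.isCoprime_iff_gcd_eq_one.1 (hjPair_isCoprime cs)
  · simpa using hcop.symm

end Continuants

section Vectors

variable (c : ℕ → ℕ)

/-- The vectors `(0, 1), (1, 0), …` with `v_{k} + v_{k+2} = c_{k+1} v_{k+1}`. -/
def hjVec : ℕ → ℤ × ℤ
  | 0 => (0, 1)
  | 1 => (1, 0)
  | k + 2 => ((c (k + 1) : ℤ) * (hjVec (k + 1)).1 - (hjVec k).1,
      (c (k + 1) : ℤ) * (hjVec (k + 1)).2 - (hjVec k).2)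

lemma hjVec_det (k : ℕ) : (hjVec c k).2 * (hjVec c (k + 1)).1
    - (hjVec c k).1 * (hjVec c (k + 1)).2 = 1 := by
  induction k with
  | zero => simp [hjVec]
  | succ k ih => rw [hjVec]; linear_combination ih

lemma hjVec_fst (hc : ∀ i, 2 ≤ c i) (k : ℕ) :
    0 ≤ (hjVec c k).1 ∧ (hjVec c k).1 ≤ (hjVec c (k + 1)).1 := by
  induction k with
  | zero => simp [hjVec]
  | succ k ih =>
    have h2 : (2 : ℤ) ≤ c (k + 1) := by exact_mod_cast hc _
    refine ⟨ih.1.trans ih.2, ?_⟩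
    have h3 : (hjVec c (k + 1 + 1)).1 = c (k + 1) * (hjVec c (k + 1)).1 - (hjVec c k).1 := rfl
    nlinarith

/-- Pairing with `(p, q)` turns the recursion of the vectors into the Euclidean algorithm behind `q
/ p`: the pairings are the continuants of the remaining tail, hence nonnegative, and they end at `1,
0`. -/
lemma hjVec_pairing {p q : ℕ} {cs : List ℕ} (h1 : (hjPair cs).1 = q) (h2 : (hjPair cs).2 = p)
    (hc : ∀ k < cs.length, cs[k]? = some (c (k + 1))) (k : ℕ) (hk : k ≤ cs.length) :
    (hjVec c k).1 * p + (hjVec c k).2 * q = (hjPair (cs.drop k)).1 ∧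
    (hjVec c (k + 1)).1 * p + (hjVec c (k + 1)).2 * q = (hjPair (cs.drop k)).2 := by
  induction k with
  | zero => simp [hjVec, h1, h2]
  | succ k ih =>
    obtain ⟨h3, h4⟩ := ih (by omega)
    have h5 := hc k (by omega)
    rw [List.getElem?_eq_getElem (by omega), Option.some_inj] at h5
    rw [List.drop_eq_getElem_cons (by omega), h5, hjPair] at h3 h4
    refine ⟨h4, ?_⟩
    have h6 : hjVec c (k + 1 + 1) = ((c (k + 1) : ℤ) * (hjVec c (k + 1)).1 - (hjVec c k).1,
      (c (k + 1) : ℤ) * (hjVec c (k + 1)).2 - (hjVec c k).2) := rfl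
    rw [h6]
    simp only at h3 h4 ⊢
    linear_combination (c (k + 1) : ℤ) * h4 - h3

/-- The functional `x ↦ det (x, v_k)`. -/
def detHom (k : ℕ) : ℤ × ℤ →+ ℤ where
  toFun x := (hjVec c k).2 * x.1 - (hjVec c k).1 * x.2
  map_zero' := by simp
  map_add' x y := by simp only [Prod.fst_add, Prod.snd_add]; ring

lemma detHom_apply (k : ℕ) (x : ℤ × ℤ) :
    detHom c k x = (hjVec c k).2 * x.1 - (hjVec c k).1 * x.2 := rfl

/-- Cramer's rule in the basis of two consecutive vectors, whose determinant is `1`. -/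
lemma detHom_decomp (k : ℕ) (x : ℤ × ℤ) :
    x = (-detHom c (k + 1) x) • hjVec c k + detHom c k x • hjVec c (k + 1) := by
  have h := hjVec_det c k
  ext
  · simp only [detHom_apply, Prod.fst_add, Prod.smul_fst, smul_eq_mul]
    linear_combination -x.1 * h
  · simp only [detHom_apply, Prod.snd_add, Prod.smul_snd, smul_eq_mul]
    linear_combination -x.2 * h

end Vectors

section DualSemigroup

variable {p q : ℕ} {cs : List ℕ}

/-- The Hilbert basis of `σ^∨ ∩ M`, read off the Hirzebruch–Jung expansion of `q / p`. -/
noncomputable def dualChain (hp : 0 < p) (hcop : Nat.Coprime p q)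
    (hcs : IsHJExpansion cs ((q : ℚ) / (p : ℚ))) : HJChain (dualSemigroup p q) := by
  -- The value `2` outside the list is arbitrary; it makes `2 ≤ c i` hold for every index.
  let c : ℕ → ℕ := fun k => cs.getD (k - 1) 2
  have hc2 : ∀ i, 2 ≤ c i := fun i => by
    rcases lt_or_ge (i - 1) cs.length with hi | hi
    · rw [show c i = cs[i - 1] from List.getD_eq_getElem _ _ hi]
      exact hcs.2.1 _ (List.getElem_mem hi)
    · rw [show c i = 2 from List.getD_eq_default _ _ hi]
  have hc : ∀ k < cs.length, cs[k]? = some (c (k + 1)) := fun k hk => by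
    rw [List.getElem?_eq_getElem hk, show c (k + 1) = cs[k] from List.getD_eq_getElem _ _ hk]
  have hQ := hjPair_eq hp hcop hcs
  have hpair := hjVec_pairing c hQ.1 hQ.2 hc
  have hmem : ∀ k ≤ cs.length + 1, hjVec c k ∈ dualSemigroup p q := by
    intro k hk
    refine ⟨(hjVec_fst c hc2 k).1, ?_⟩
    rcases k with _ | k
    · rw [(hpair 0 (Nat.zero_le _)).1]
      have := hjPair_nonneg (cs := cs.drop 0) fun c hc => hcs.2.1 c (List.mem_of_mem_drop hc)
      omega
    · rw [(hpair k (by omega)).2]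
      exact (hjPair_nonneg (cs := cs.drop k) fun c hc =>
        hcs.2.1 c (List.mem_of_mem_drop hc)).1
  -- The last two pairings with `(p, q)` are `1` and `0`. Expanding `x` in the last two vectors
  -- therefore identifies this determinant with minus the second inequality defining the cone.
  have hlast : ∀ x, detHom c (cs.length + 1) x = -(x.1 * p + x.2 * q) := by
    intro x
    have h1 := hpair cs.length le_rfl
    rw [List.drop_length] at h1
    simp only [hjPair] at h1
    have h2 := detHom_decomp c cs.length x
    have h3 := congrArg Prod.fst h2
    have h4 := congrArg Prod.snd h2
    simp only [Prod.fst_add, Prod.smul_fst, Prod.snd_add, Prod.smul_snd, smul_eq_mul] at h3 h4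
    linear_combination (p : ℤ) * h3 + (q : ℤ) * h4 - detHom c (cs.length + 1) x * h1.1
      + detHom c cs.length x * h1.2
  let u : ℕ → dualSemigroup p q := fun k =>
    if hk : k ≤ cs.length + 1 then ⟨hjVec c k, hmem k hk⟩ else 0
  have hu : ∀ k ≤ cs.length + 1, ((u k : dualSemigroup p q) : ℤ × ℤ) = hjVec c k :=
    fun k hk => by simp only [u, dif_pos hk]
  have hrec : ∀ k, hjVec c (k + 2) = ((c (k + 1) : ℤ) * (hjVec c (k + 1)).1 - (hjVec c k).1,
      (c (k + 1) : ℤ) * (hjVec c (k + 1)).2 - (hjVec c k).2) := fun k => rfl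
  exact
  { n := cs.length
    c := c
    u := u
    b := fun k => (detHom c k).comp (dualSemigroup p q).subtype
    n_pos := List.length_pos_of_ne_nil hcs.1
    two_le := hc2
    u_rel := fun i hi => by
      apply Subtype.ext
      rw [AddSubmonoid.coe_add, AddSubmonoidClass.coe_nsmul, hu i (by omega), hu (i + 2) (by omega),
        hu (i + 1) (by omega), hrec]
      ext <;> simp
    b_rel := fun i hi x => by
      simp only [AddMonoidHom.comp_apply, detHom_apply, hrec]
      ring
    b_self := fun i hi => by
      simp only [AddMonoidHom.comp_apply, detHom_apply, AddSubmonoid.subtype_apply, hu i hi]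
      ring
    b_succ := fun i hi => by
      simp only [AddMonoidHom.comp_apply, detHom_apply, AddSubmonoid.subtype_apply,
        hu (i + 1) (by omega)]
      exact hjVec_det c i
    b_pred := fun i hi => by
      simp only [AddMonoidHom.comp_apply, detHom_apply, AddSubmonoid.subtype_apply,
        hu i (by omega)]
      linear_combination -hjVec_det c i
    b_zero_nonneg := fun x => by
      simp only [AddMonoidHom.comp_apply, detHom_apply, AddSubmonoid.subtype_apply, hjVec]
      simpa using x.2.1
    b_last_nonpos := fun x => by
      simp only [AddMonoidHom.comp_apply, AddSubmonoid.subtype_apply, hlast]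
      have := x.2.2
      linarith
    decomp := fun i hi x h0 h1 => by
      apply Subtype.ext
      rw [AddSubmonoid.coe_add, AddSubmonoidClass.coe_nsmul, AddSubmonoidClass.coe_nsmul, hu i (by omega),
        hu (i + 1) (by omega), ← natCast_zsmul, ← natCast_zsmul, Int.toNat_of_nonneg h0,
        Int.toNat_of_nonneg (by omega)]
      exact detHom_decomp c i x
    separates := fun x y h0 h1 => by
      simp only [AddMonoidHom.comp_apply, detHom_apply, AddSubmonoid.subtype_apply, hjVec] at h0 h1
      apply Subtype.ext
      ext <;> linarith }

lemma dualChain_c (hp : 0 < p) (hcop : Nat.Coprime p q)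
    (hcs : IsHJExpansion cs ((q : ℚ) / (p : ℚ))) (k : ℕ) :
    (dualChain hp hcop hcs).c (k + 1) = cs.getD k 2 := rfl

end DualSemigroup

end ToricJets

/-! ### Families of jets with prescribed contact orders -/

namespace ToricJets

open PowerSeries

section Series

variable {A A' : Type*} [CommRing A] [CommRing A'] {N : ℕ}

/-- The power series with coefficients `f 0, …, f (N - 1), 0, 0, …`. -/
noncomputable def finSeries (f : Fin N → A) : A⟦X⟧ :=
  PowerSeries.mk fun k => if h : k < N then f ⟨k, h⟩ else 0

lemma coeff_finSeries (f : Fin N → A) (k : Fin N) : coeff (k : ℕ) (finSeries f) = f k := by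
  simp [finSeries]

lemma map_finSeries (g : A →+* A') (f : Fin N → A) :
    PowerSeries.map g (finSeries f) = finSeries fun k => g (f k) := by
  ext k
  simp only [finSeries, coeff_map, coeff_mk]
  split_ifs <;> simp

lemma X_pow_dvd_sub_finSeries (f : A⟦X⟧) :
    (X : A⟦X⟧) ^ N ∣ f - finSeries fun k : Fin N => coeff (k : ℕ) f := by
  rw [X_pow_dvd_iff]
  intro k hk
  rw [map_sub, coeff_finSeries _ ⟨k, hk⟩, sub_self]

/-- The power series `f 0 + ⋯ + f (N - 1) X ^ (N - 1) + X ^ N`. -/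
noncomputable def monicSeries (f : Fin N → A) : A⟦X⟧ := finSeries f + X ^ N

lemma coeff_monicSeries (f : Fin N → A) (k : Fin N) : coeff (k : ℕ) (monicSeries f) = f k := by
  rw [monicSeries, map_add, coeff_finSeries, coeff_X_pow, if_neg k.2.ne, add_zero]

lemma map_monicSeries (g : A →+* A') (f : Fin N → A) :
    PowerSeries.map g (monicSeries f) = monicSeries fun k => g (f k) := by
  simp [monicSeries, map_finSeries]

lemma X_pow_dvd_sub_monicSeries (f : A⟦X⟧) :
    (X : A⟦X⟧) ^ N ∣ f - monicSeries fun k : Fin N => coeff (k : ℕ) f := by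
  have := dvd_sub (X_pow_dvd_sub_finSeries (N := N) f) (dvd_refl (X ^ N))
  rwa [sub_sub] at this

lemma constantCoeff_monicSeries_of_pos (f : Fin N → A) (hN : 0 < N) :
    constantCoeff (monicSeries f) = f ⟨0, hN⟩ := by
  rw [← coeff_zero_eq_constantCoeff_apply, ← coeff_monicSeries f ⟨0, hN⟩]

/-- The added `X ^ N` makes a series without free coefficients equal to the unit `1`. Thus `famW` is
automatically invertible in the boundary case `a + s = m + 1`. -/
lemma monicSeries_zero (f : Fin N → A) (hN : N = 0) : monicSeries f = 1 := by
  subst hN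
  ext k
  simp [monicSeries, finSeries]

lemma isUnit_constantCoeff_monicSeries {f : A⟦X⟧} (hf : IsUnit (constantCoeff f)) :
    IsUnit (constantCoeff (monicSeries fun k : Fin N => coeff (k : ℕ) f)) := by
  rcases Nat.eq_zero_or_pos N with h0 | h0
  · simp [monicSeries_zero _ h0]
  · rw [constantCoeff_monicSeries_of_pos _ h0]
    simpa using hf

end Series

variable {Γ : Type*} [AddCommMonoid Γ] (C : HJChain Γ) (m s j a : ℕ)

/-- Indices of the parameters of a family of jets. -/
abbrev FamVars : Type :=
  (Fin (m + 1 - 2 * s) ⊕ Fin (m + 1 - s - a)) ⊕ (Fin (a - s) ⊕ (Fin (C.n + 2) × Fin s))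

/-- The index conditions of a family: jets with `ord u (j + 1) = s` and `ord u j = a`. -/
structure FamIndex : Prop where
  lt_n : j < C.n
  one_le : 1 ≤ s
  two_mul_le : 2 * s ≤ m + 1
  le_a : s ≤ a
  -- The product of the jets of `u j` and `u (j + 2)` is a `c (j + 1)`-th power of order `s * c (j +
  -- 1)`, and the second factor has order at least `s`. The next condition caps `a` at `m + 1 - s`,
  -- where the free top coefficients begin.
  a_le : a ≤ s * (C.c (j + 1) - 1)
  a_le' : a + s ≤ m + 1

section Family

variable {A A' : Type*} [CommRing A] [CommRing A'] {C m s a}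

/-- The unit part of the jet of `u (j + 1)`. -/
noncomputable def famU (p : FamVars C m s a → A) : A⟦X⟧ :=
  monicSeries fun k => p (Sum.inl (Sum.inl k))

/-- The unit part of the jet of `u j`. -/
noncomputable def famW (p : FamVars C m s a → A) : A⟦X⟧ :=
  monicSeries fun k => p (Sum.inl (Sum.inr k))

/-- The part of the jet of `u (j + 2)` which is not determined by `u j` and `u (j + 1)`. -/
noncomputable def famV (p : FamVars C m s a → A) : A⟦X⟧ :=
  finSeries fun k => p (Sum.inr (Sum.inl k))

/-- The free top coefficients of the jets of the generators. -/
noncomputable def famZ (p : FamVars C m s a → A) (k : Fin (C.n + 2)) : A⟦X⟧ :=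
  finSeries fun l => p (Sum.inr (Sum.inr (k, l)))

/-- The jet of `u (j + 1)`, up to top coefficients. -/
noncomputable def famTau (p : FamVars C m s a → A) : A⟦X⟧ := X ^ s * famU p

/-- The jet of `u j` divided by that of `u (j + 1)`. -/
noncomputable def famEta (p : FamVars C m s a → A) : A⟦X⟧ := X ^ (a - s) * famW p

/-- The jet of `u (j + 2)` divided by that of `u (j + 1)`; `W'` is the inverse of `famW p`. -/
noncomputable def famXi (j : ℕ) (p : FamVars C m s a → A) (W' : A⟦X⟧) : A⟦X⟧ :=
  X ^ (s * (C.c (j + 1) - 1) - a) * famU p ^ (C.c (j + 1) - 2) * W' +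
    X ^ (m + 1 - s - a) * famV p

/-- The jets of a family without their free top coefficients. -/
noncomputable def famChart (j : ℕ) (p : FamVars C m s a → A) (W' : A⟦X⟧) : Γ → A⟦X⟧ :=
  chartFun (C.b (j + 1)) (C.h (j + 1)) (C.c (j + 1) - 2) (famTau p) (famXi j p W') (famEta p)

/-- The jets of a family. -/
noncomputable def famFun (j : ℕ) (p : FamVars C m s a → A) (W' : A⟦X⟧) (x : Γ) : A⟦X⟧ :=
  famChart j p W' x + X ^ (m + 1 - s) * C.onGens (famZ p) x

lemma map_famFun (f : A →+* A') (p : FamVars C m s a → A) (W' : A⟦X⟧) (x : Γ) :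
    PowerSeries.map f (famFun j p W' x) =
      famFun j (fun v => f (p v)) (PowerSeries.map f W') x := by
  simp only [famFun, famChart, map_add, map_mul, map_chartFun, map_pow, map_X]
  congr 1
  · simp [famTau, famXi, famEta, famU, famW, famV, map_monicSeries, map_finSeries]
  · rw [C.map_onGens (PowerSeries.map f) (map_zero _)]
    simp only [famZ, map_finSeries]
    rfl

/-- The exponent of `τ` in the second branch of the chart is thereby `h j`, so both branches have
exponents at least `1` on nonzero elements. -/
lemma HJChain.h_add_mul (C : HJChain Γ) {j : ℕ} (hj : j < C.n) (x : Γ) :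
    C.h (j + 1) x + ((C.c (j + 1) - 2 : ℕ) : ℤ) * C.b (j + 1) x = C.h j x := by
  have h1 := C.b_rel j hj x
  rw [Nat.cast_sub (C.two_le _), C.h_apply, C.h_apply]
  push_cast
  rw [show j + 1 + 1 = j + 2 from rfl]
  linear_combination -h1

variable {j} (hI : FamIndex C m s j a) {p : FamVars C m s a → A} {W' : A⟦X⟧}

include hI

/-- The product `ξ η` equals `τ ^ (c - 2)` plus `X ^ (m + 1 - 2 s)` times the product of `famV p`
and `famW p`; the error dies after multiplication by `τ ^ 2`, of order at least `2 s`. -/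
lemma isJet_famChart (hW : famW p * W' = 1) : IsJet m (famChart j p W') := by
  have h2 := C.two_le (j + 1)
  refine isJet_chartFun (fun u hu => C.one_le_h (Nat.succ_le_of_lt hI.lt_n) hu)
    (fun u hu => ?_) ?_
  · rw [C.h_add_mul hI.lt_n]
    exact C.one_le_h hI.lt_n.le hu
  · obtain ⟨d, hd⟩ : ∃ d, C.c (j + 1) = d + 2 := ⟨C.c (j + 1) - 2, by omega⟩
    have hs := hI.two_mul_le
    have ha := hI.le_a
    have ha' := hI.a_le
    have ha'' := hI.a_le'
    rw [famXi, famEta, famTau, hd, show d + 2 - 1 = d + 1 by omega, show d + 2 - 2 = d by omega]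
    rw [hd, show d + 2 - 1 = d + 1 by omega] at ha'
    obtain ⟨r, rfl⟩ : ∃ r, a = s + r := ⟨a - s, by omega⟩
    obtain ⟨t, ht⟩ : ∃ t, s * (d + 1) = s + r + t := ⟨s * (d + 1) - (s + r), by omega⟩
    have ht' : s * d = r + t := by rw [mul_add] at ht; omega
    obtain ⟨w, hw⟩ : ∃ w, m + 1 = 2 * s + r + w := ⟨m + 1 - (2 * s + r), by omega⟩
    rw [ht, hw, show s + r + t - (s + r) = t by omega, show s + r - s = r by omega,
      show 2 * s + r + w - s - (s + r) = w by omega, mul_pow (X ^ s) _ 2, mul_pow (X ^ s) _ d,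
      ← pow_mul X s d, ht']
    refine ⟨famU p ^ 2 * famV p * famW p, ?_⟩
    linear_combination X ^ s * X ^ s * famU p ^ 2 * X ^ t * X ^ r * famU p ^ d * hW

lemma X_pow_dvd_famChart {x : Γ} (hx : x ≠ 0) : (X : A⟦X⟧) ^ s ∣ famChart j p W' x := by
  refine dvd_chartFun (fun u hu => C.one_le_h (Nat.succ_le_of_lt hI.lt_n) hu)
    (fun u hu => ?_) (dvd_mul_right _ _) hx
  rw [C.h_add_mul hI.lt_n]
  exact C.one_le_h hI.lt_n.le hu

lemma isJet_famFun (hW : famW p * W' = 1) : IsJet m (famFun j p W') :=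
  (isJet_famChart hI hW).add_perturbation hI.two_mul_le
    (fun _ hu => X_pow_dvd_famChart hI hu) (C.onGens_zero _) (C.onGens_add _)

lemma X_pow_dvd_famFun {x : Γ} (hx : x ≠ 0) : (X : A⟦X⟧) ^ s ∣ famFun j p W' x :=
  dvd_add (X_pow_dvd_famChart hI hx)
    ((pow_dvd_pow _ (by have := hI.two_mul_le; omega)).mul_right _)

lemma famChart_center : famChart j p W' (C.u (j + 1)) = famTau p := by
  have hj := hI.lt_n
  rw [famChart, chartFun, if_pos (by rw [C.b_self (j + 1) (by omega)]),
    C.b_self (j + 1) (by omega), C.h_self (by omega)]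
  simp

lemma famChart_right : famChart j p W' (C.u (j + 2)) = famTau p * famXi j p W' := by
  have hj := hI.lt_n
  have h1 : C.b (j + 1) (C.u (j + 2)) = 1 := C.b_succ (j + 1) (by omega)
  have h2 : C.h (j + 1) (C.u (j + 2)) = 1 := C.h_succ (i := j + 1) (by omega)
  rw [famChart, chartFun, if_pos (by rw [h1]; norm_num), h1, h2]
  simp

lemma famChart_left : famChart j p W' (C.u j) = famTau p * famEta p := by
  have hj := hI.lt_n
  have h1 := C.b_pred j (by omega)
  rw [famChart, chartFun, if_neg (by rw [h1]; norm_num), C.h_add_mul hj, h1,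
    C.h_self (by omega)]
  simp

end Family

section Generic

variable (K : Type*) [Field K]

/-- The constant coefficient of the generic `famW`. -/
noncomputable def famDenom : MvPolynomial (FamVars C m s a) K :=
  constantCoeff (famW (MvPolynomial.X : FamVars C m s a → _))

lemma famDenom_ne_zero : famDenom C m s a K ≠ 0 := by
  unfold famDenom famW
  rcases Nat.eq_zero_or_pos (m + 1 - s - a) with h0 | h0
  · simp [monicSeries_zero _ h0]
  · rw [constantCoeff_monicSeries_of_pos _ h0]
    exact MvPolynomial.X_ne_zero _

/-- The coordinate ring of the parameter space of a family. -/
abbrev FamRing : Type _ := Localization.Away (famDenom C m s a K)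

instance : IsDomain (FamRing C m s a K) :=
  IsLocalization.isDomain_localization
    (powers_le_nonZeroDivisors_of_noZeroDivisors (famDenom_ne_zero C m s a K))

/-- The generic parameters. -/
noncomputable def famGen (v : FamVars C m s a) : FamRing C m s a K :=
  algebraMap (MvPolynomial (FamVars C m s a) K) _ (MvPolynomial.X v)

lemma isUnit_famW_famGen : IsUnit (famW (famGen C m s a K)) := by
  rw [isUnit_iff_constantCoeff]
  have h1 : famW (famGen C m s a K) = PowerSeries.map
      (algebraMap (MvPolynomial (FamVars C m s a) K) (FamRing C m s a K))
      (famW (MvPolynomial.X : FamVars C m s a → _)) := by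
    rw [famW, famW, map_monicSeries]
    rfl
  rw [h1, ← coeff_zero_eq_constantCoeff_apply, coeff_map, coeff_zero_eq_constantCoeff_apply]
  exact IsLocalization.Away.algebraMap_isUnit (famDenom C m s a K)

/-- The inverse of the generic `famW`. -/
noncomputable def famInv : (FamRing C m s a K)⟦X⟧ := ((isUnit_famW_famGen C m s a K).unit⁻¹ : Units _)

lemma famW_mul_famInv : famW (famGen C m s a K) * famInv C m s a K = 1 :=
  IsUnit.mul_val_inv (isUnit_famW_famGen C m s a K)

variable {C m s j a}

/-- The generic jet of a family, as a point of the jet scheme. -/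
noncomputable def famEval (hI : FamIndex C m s j a) :
    JetAlgebra K (AddMonoidAlgebra K Γ) m →ₐ[K] FamRing C m s a K :=
  (isJet_famFun hI (famW_mul_famInv C m s a K)).eval K

/-- The generic point of a family. -/
noncomputable def famPrime (hI : FamIndex C m s j a) :
    Ideal (JetAlgebra K (AddMonoidAlgebra K Γ) m) :=
  RingHom.ker (famEval K hI)

instance (hI : FamIndex C m s j a) : (famPrime K hI).IsPrime := RingHom.ker_isPrime _

variable {K} {A : Type*} [CommRing A] [Algebra K A]

/-- A choice of parameters with `famW p` invertible is a homomorphism from `FamRing`, and by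
uniqueness of inverses it carries the generic jet to the given one. -/
lemma famPrime_le_ker_famFun (hI : FamIndex C m s j a) {p : FamVars C m s a → A} {W' : A⟦X⟧}
    (hW : famW p * W' = 1) : famPrime K hI ≤ RingHom.ker ((isJet_famFun hI hW).eval K) := by
  have hmap : ∀ (B : Type _) [CommRing B] (f : B →+* A) (q : FamVars C m s a → B),
      (∀ v, f (q v) = p v) → PowerSeries.map f (famW q) = famW p := by
    intro B _ f q hq
    rw [famW, famW, map_monicSeries]
    simp only [hq]
  have hunit : IsUnit (MvPolynomial.aeval (R := K) p (famDenom C m s a K)) := by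
    have h1 := hmap _ (MvPolynomial.aeval (R := K) p : MvPolynomial _ K →ₐ[K] A).toRingHom
      (MvPolynomial.X) (fun v => by simp)
    have h2 : IsUnit (constantCoeff (famW p)) :=
      isUnit_iff_constantCoeff.1 (IsUnit.of_mul_eq_one _ hW)
    rw [← h1, ← coeff_zero_eq_constantCoeff_apply, coeff_map,
      coeff_zero_eq_constantCoeff_apply] at h2
    exact h2
  let θ : FamRing C m s a K →ₐ[K] A :=
    IsLocalization.liftAlgHom (M := Submonoid.powers (famDenom C m s a K))
      (f := MvPolynomial.aeval (R := K) p) (by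
        rintro ⟨_, n, rfl⟩
        simpa using hunit.pow n)
  have hθ : ∀ v, θ (famGen C m s a K v) = p v := by
    intro v
    simp [θ, famGen]
  have h1 : PowerSeries.map (θ : FamRing C m s a K →+* A) (famW (famGen C m s a K)) = famW p :=
    hmap _ _ _ hθ
  have h2 : PowerSeries.map (θ : FamRing C m s a K →+* A) (famInv C m s a K) = W' := by
    have h3 := congrArg (PowerSeries.map (θ : FamRing C m s a K →+* A))
      (famW_mul_famInv C m s a K)
    rw [map_mul, h1, map_one] at h3
    calc _ = (famW p * W') * PowerSeries.map (θ : FamRing C m s a K →+* A) (famInv C m s a K) := by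
          rw [hW, one_mul]
      _ = W' := by rw [mul_right_comm, h3, one_mul]
  have h4 : (isJet_famFun hI hW).eval K = θ.comp (famEval K hI) := by
    rw [famEval, ← IsJet.eval_map]
    refine IsJet.eval_congr _ _ fun u => ?_
    rw [map_famFun, h2]
    simp only [RingHom.coe_coe, hθ, sub_self, dvd_zero]
  intro x hx
  have : famEval K hI x = 0 := hx
  refine RingHom.mem_ker.2 ?_
  rw [h4, AlgHom.comp_apply, this, map_zero]

/-- Jets which agree on the generators with a member of the family up to top coefficients lie in
the closure of the family. -/
lemma famPrime_le_ker (hI : FamIndex C m s j a) {p : FamVars C m s a → A} {W' : A⟦X⟧}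
    (hW : famW p * W' = 1) {φ : Γ → A⟦X⟧} (hφ : IsJet m φ)
    (h : ∀ k ≤ C.n + 1, (X : A⟦X⟧) ^ (m + 1 - s) ∣ φ (C.u k) - famChart j p W' (C.u k)) :
    famPrime K hI ≤ RingHom.ker (hφ.eval K) := by
  -- The quotients `r` are the discrepancies in the top coefficients; their first `s` coefficients
  -- become the free parameters `famZ`.
  choose r hr using fun k : Fin (C.n + 2) => h k (Nat.le_of_lt_succ k.2)
  let p' : FamVars C m s a → A := Sum.elim (fun v => p (Sum.inl v))
    (Sum.elim (fun v => p (Sum.inr (Sum.inl v))) fun v => coeff (v.2 : ℕ) (r v.1))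
  have hW' : famW p' * W' = 1 := hW
  have key : hφ.eval K = (isJet_famFun hI hW').eval K := by
    refine IsJet.eval_congr _ _ (hφ.close_of_gens C (isJet_famFun hI hW') fun k hk => ?_)
    have h1 := hr ⟨k, Nat.lt_succ_of_le hk⟩
    have h2 := C.onGens_u (famZ p') ⟨k, Nat.lt_succ_of_le hk⟩
    simp only at h1 h2
    have h3 : famChart j p' W' (C.u k) = famChart j p W' (C.u k) := rfl
    have h4 : (X : A⟦X⟧) ^ s ∣ r ⟨k, Nat.lt_succ_of_le hk⟩ - famZ p' ⟨k, Nat.lt_succ_of_le hk⟩ :=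
      X_pow_dvd_sub_finSeries _
    rw [famFun, h2, h3, ← sub_sub, h1, ← mul_sub]
    have hs := hI.two_mul_le
    rw [show m + 1 = (m + 1 - s) + s by omega, pow_add,
      show m + 1 - s + s - s = m + 1 - s by omega]
    exact mul_dvd_mul_left _ h4
  rw [key]
  exact famPrime_le_ker_famFun hI hW'

end Generic

end ToricJets

/-! ### Jets over a field as specializations of a family -/

namespace ToricJets

open PowerSeries

universe w

section FieldSeries

variable {L : Type*} [Field L]

lemma exists_eq_X_pow_mul {f : L⟦X⟧} {s : ℕ} (h1 : (X : L⟦X⟧) ^ s ∣ f)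
    (h2 : ¬ (X : L⟦X⟧) ^ (s + 1) ∣ f) : ∃ U : L⟦X⟧, f = X ^ s * U ∧ constantCoeff U ≠ 0 := by
  obtain ⟨U, rfl⟩ := h1
  refine ⟨U, rfl, fun h0 => h2 ?_⟩
  rw [pow_succ]
  exact mul_dvd_mul_left _ (X_dvd_iff.2 h0)

lemma not_X_pow_succ_dvd {U : L⟦X⟧} (hU : constantCoeff U ≠ 0) (s : ℕ) :
    ¬ (X : L⟦X⟧) ^ (s + 1) ∣ X ^ s * U := by
  rw [pow_succ, mul_dvd_mul_iff_left (pow_ne_zero _ X_ne_zero)]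
  exact fun h => hU (X_dvd_iff.1 h)

lemma isUnit_of_constantCoeff_ne_zero {U : L⟦X⟧} (hU : constantCoeff U ≠ 0) : IsUnit U :=
  isUnit_iff_constantCoeff.2 hU.isUnit

lemma X_pow_dvd_of_dvd_mul {U f : L⟦X⟧} (hU : constantCoeff U ≠ 0) {N s : ℕ} (hs : s ≤ N)
    (h : (X : L⟦X⟧) ^ N ∣ X ^ s * U * f) : (X : L⟦X⟧) ^ (N - s) ∣ f := by
  rw [show N = s + (N - s) by omega, pow_add, mul_assoc,
    mul_dvd_mul_iff_left (pow_ne_zero _ X_ne_zero)] at h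
  exact (isUnit_of_constantCoeff_ne_zero hU).dvd_mul_left.1 h

end FieldSeries

lemma IsJet.map_nsmul {Γ A : Type*} [AddCommMonoid Γ] [CommRing A] {m : ℕ} {φ : Γ → A⟦X⟧}
    (hφ : IsJet m φ) (u : Γ) (k : ℕ) : (X : A⟦X⟧) ^ (m + 1) ∣ φ (k • u) - φ u ^ k := by
  simpa using hφ.map_sum (Finset.range k) fun _ => u

lemma IsJet.rel {Γ A : Type*} [AddCommMonoid Γ] [CommRing A] {m : ℕ} {φ : Γ → A⟦X⟧}
    (hφ : IsJet m φ) (C : HJChain Γ) {j : ℕ} (hj : j < C.n) :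
    (X : A⟦X⟧) ^ (m + 1) ∣
      φ (C.u j) * φ (C.u (j + 2)) - φ (C.u (j + 1)) ^ C.c (j + 1) := by
  have h1 := hφ.map_nsmul (C.u (j + 1)) (C.c (j + 1))
  have h2 := hφ.map_add (C.u j) (C.u (j + 2))
  rw [C.u_rel j hj] at h2
  have := dvd_sub h1 h2
  simpa using this

variable {Γ : Type*} [AddCommMonoid Γ] {C : HJChain Γ} {m s j a : ℕ}
variable {K : Type*} [Field K] {L : Type w} [Field L] [Algebra K L] {φ : Γ → L⟦X⟧}

/-- Setting all coefficients of `famU` to zero leaves `τ = X ^ (m + 1 - s)`, so the chart vanishes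
to the same precision as `φ`. Only `famW` has to stay invertible, and it is built from the
coefficients of `1`. -/
lemma famPrime_le_of_X_pow_dvd (hI : FamIndex C m s j a) (hφ : IsJet m φ)
    (h : ∀ k ≤ C.n + 1, (X : L⟦X⟧) ^ (m + 1 - s) ∣ φ (C.u k)) :
    famPrime K hI ≤ RingHom.ker (hφ.eval K) := by
  let p : FamVars C m s a → L := Sum.elim
    (Sum.elim (fun _ => 0) fun k => coeff (k : ℕ) (1 : L⟦X⟧)) fun _ => 0
  have hW : IsUnit (famW p) :=
    isUnit_iff_constantCoeff.2 (isUnit_constantCoeff_monicSeries (by simp))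
  obtain ⟨W', hW'⟩ := hW.exists_right_inv
  refine famPrime_le_ker hI hW' hφ fun k hk => dvd_sub (h k hk) ?_
  have hU : famU p = X ^ (m + 1 - 2 * s) := by
    ext k
    simp [famU, monicSeries, finSeries, p]
  have hs := hI.two_mul_le
  have hτ : famTau p = X ^ (m + 1 - s) := by
    rw [famTau, hU, ← pow_add]
    congr 1; omega
  rw [← hτ]
  refine dvd_chartFun (fun u hu => C.one_le_h (Nat.succ_le_of_lt hI.lt_n) hu)
    (fun u hu => ?_) dvd_rfl (C.u_ne_zero hk)
  rw [C.h_add_mul hI.lt_n]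
  exact C.one_le_h hI.lt_n.le hu

/-- A jet with the contact orders of a family lies in its closure. -/
lemma famPrime_le_of_contact (hI : FamIndex C m s j a) (hs : 2 * s ≤ m) (hφ : IsJet m φ)
    (hd : ∀ k ≤ C.n + 1, (X : L⟦X⟧) ^ s ∣ φ (C.u k))
    (hc : ¬ (X : L⟦X⟧) ^ (s + 1) ∣ φ (C.u (j + 1)))
    (hl : (X : L⟦X⟧) ^ a ∣ φ (C.u j))
    (hl' : a + s < m + 1 → ¬ (X : L⟦X⟧) ^ (a + 1) ∣ φ (C.u j)) :
    famPrime K hI ≤ RingHom.ker (hφ.eval K) := by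
  have hj := hI.lt_n
  have hsa := hI.le_a
  have ha := hI.a_le
  have ha' := hI.a_le'
  have hc2 := C.two_le (j + 1)
  obtain ⟨U, hU, hU0⟩ := exists_eq_X_pow_mul (hd (j + 1) (by omega)) hc
  set U₁ : L⟦X⟧ := monicSeries fun k : Fin (m + 1 - 2 * s) => coeff (k : ℕ) U with hU₁
  have hUU : (X : L⟦X⟧) ^ (m + 1 - 2 * s) ∣ U - U₁ := X_pow_dvd_sub_monicSeries U
  -- The strict bound `2 * s ≤ m` guarantees that the truncation of `U` retains its constant
  -- coefficient.
  have hU₁0 : constantCoeff U₁ ≠ 0 := by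
    rw [hU₁, constantCoeff_monicSeries_of_pos _ (by omega)]
    simpa using hU0
  -- If `a + s < m + 1`, the order of `u j` is exactly `a` and `W₀` is its unit part divided by `U`.
  -- Otherwise `u j` vanishes to the relevant precision and any unit will do.
  obtain ⟨W₀, hW0, hWl⟩ : ∃ W₀ : L⟦X⟧, constantCoeff W₀ ≠ 0 ∧ ∀ W₁ : L⟦X⟧,
      X ^ (m + 1 - s - a) ∣ W₀ - W₁ → X ^ (m + 1 - s) ∣ φ (C.u j) - X ^ a * (U₁ * W₁) := by
    rcases lt_or_ge (a + s) (m + 1) with h | h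
    · obtain ⟨w, hw, hw0⟩ := exists_eq_X_pow_mul hl (hl' h)
      refine ⟨w * U⁻¹, ?_, fun W₁ hW₁ => ?_⟩
      · rw [map_mul, constantCoeff_inv]
        exact mul_ne_zero hw0 (inv_ne_zero hU0)
      · have e1 : w = U * (w * U⁻¹) := by
          rw [mul_left_comm, PowerSeries.mul_inv_cancel _ hU0, mul_one]
        have e2 : φ (C.u j) - X ^ a * (U₁ * W₁) =
            X ^ a * ((U - U₁) * (w * U⁻¹) + U₁ * (w * U⁻¹ - W₁)) := by
          rw [hw]
          linear_combination (X : L⟦X⟧) ^ a * e1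
        rw [e2, show m + 1 - s = a + (m + 1 - s - a) by omega, pow_add]
        refine mul_dvd_mul_left _ (dvd_add ?_ (hW₁.mul_left _))
        exact ((pow_dvd_pow _ (by omega)).trans hUU).mul_right _
    · refine ⟨1, by simp, fun W₁ _ => ?_⟩
      rw [show m + 1 - s = a by omega]
      exact dvd_sub hl (dvd_mul_right _ _)
  set W₁ : L⟦X⟧ := monicSeries fun k : Fin (m + 1 - s - a) => coeff (k : ℕ) W₀ with hW₁
  have hWu : IsUnit W₁ :=
    isUnit_iff_constantCoeff.2 (isUnit_constantCoeff_monicSeries hW0.isUnit)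
  obtain ⟨W', hW'⟩ := hWu.exists_right_inv
  have hleft := hWl W₁ (X_pow_dvd_sub_monicSeries W₀)
  obtain ⟨x, hx⟩ := hd (j + 2) (by omega)
  obtain ⟨t, ht⟩ : ∃ t, s * (C.c (j + 1) - 1) = a + t := ⟨_, (Nat.add_sub_of_le ha).symm⟩
  obtain ⟨d, hdc⟩ : ∃ d, C.c (j + 1) = d + 2 := ⟨C.c (j + 1) - 2, by omega⟩
  have ht2 : s * (d + 2) = a + s + t := by
    rw [hdc, show d + 2 - 1 = d + 1 by omega] at ht
    rw [show d + 2 = (d + 1) + 1 by omega, mul_add, ht]; ring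
  -- the relation between the three neighbours
  have hrel : (X : L⟦X⟧) ^ (m + 1 - (a + s)) ∣ W₁ * x - X ^ t * U₁ ^ (d + 1) := by
    have h1 := hφ.rel C hj
    rw [hdc, hU, hx] at h1
    have h2 : (X : L⟦X⟧) ^ (m + 1) ∣ (φ (C.u j) - X ^ a * (U₁ * W₁)) * (X ^ s * x) := by
      rw [show m + 1 = (m + 1 - s) + s by omega, pow_add]
      exact mul_dvd_mul hleft (dvd_mul_right _ _)
    have h3 : (X : L⟦X⟧) ^ (m + 1) ∣ X ^ (2 * s) * X ^ (s * d) * (U ^ (d + 2) - U₁ ^ (d + 2)) := by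
      rw [show m + 1 = 2 * s + (m + 1 - 2 * s) by omega, pow_add, mul_assoc]
      exact mul_dvd_mul_left _ ((hUU.trans (sub_dvd_pow_sub_pow _ _ _)).mul_left _)
    have h4 : (X : L⟦X⟧) ^ (m + 1) ∣ X ^ (a + s) * U₁ * (W₁ * x - X ^ t * U₁ ^ (d + 1)) := by
      have e : X ^ (a + s) * U₁ * (W₁ * x - X ^ t * U₁ ^ (d + 1)) =
          (φ (C.u j) * (X ^ s * x) - (X ^ s * U) ^ (d + 2))
          - (φ (C.u j) - X ^ a * (U₁ * W₁)) * (X ^ s * x)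
          + X ^ (2 * s) * X ^ (s * d) * (U ^ (d + 2) - U₁ ^ (d + 2)) := by
        have e1 : (X : L⟦X⟧) ^ (a + s) * X ^ t = X ^ (2 * s) * X ^ (s * d) := by
          rw [← pow_add, ← pow_add, ← ht2]; congr 1; ring
        have e2 : (X ^ s * U) ^ (d + 2) = X ^ (2 * s) * X ^ (s * d) * U ^ (d + 2) := by
          rw [mul_pow, ← pow_mul, ← pow_add]; congr 2; ring
        rw [e2, mul_sub]
        have e3 : X ^ (a + s) * U₁ * (X ^ t * U₁ ^ (d + 1)) =
          (X ^ (a + s) * X ^ t) * U₁ ^ (d + 2) := by ring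
        rw [e3, e1]
        ring
      rw [e]
      exact dvd_add (dvd_sub h1 h2) h3
    exact X_pow_dvd_of_dvd_mul hU₁0 ha' h4
  obtain ⟨g, hg⟩ := hrel
  -- This solves the equation at `u (j + 2)`: there `U₁ * V` must be `g * W'`, and only the first `a
  -- - s` coefficients of `V` matter modulo `X ^ (m + 1 - s)`.
  set V₀ : L⟦X⟧ := g * W' * U₁⁻¹ with hV₀
  let p : FamVars C m s a → L := Sum.elim (Sum.elim (fun k => coeff (k : ℕ) U)
    fun k => coeff (k : ℕ) W₀) (Sum.elim (fun k => coeff (k : ℕ) V₀) fun _ => 0)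
  have hpU : famU p = U₁ := rfl
  have hpW : famW p = W₁ := rfl
  have hWp : famW p * W' = 1 := hW'
  have hVV : (X : L⟦X⟧) ^ (a - s) ∣ V₀ - famV p := X_pow_dvd_sub_finSeries V₀
  have hτ : famTau p = X ^ s * U₁ := rfl
  have hcenter : (X : L⟦X⟧) ^ (m + 1 - s) ∣
      φ (C.u (j + 1)) - famChart j p W' (C.u (j + 1)) := by
    rw [famChart_center hI, hτ, hU, ← mul_sub, show m + 1 - s = s + (m + 1 - 2 * s) by omega,
      pow_add]
    exact mul_dvd_mul_left _ hUU
  have hleft' : (X : L⟦X⟧) ^ (m + 1 - s) ∣ φ (C.u j) - famChart j p W' (C.u j) := by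
    have e : famChart j p W' (C.u j) = X ^ a * (U₁ * W₁) := by
      rw [famChart_left hI, hτ, famEta, hpW]
      have : (X : L⟦X⟧) ^ a = X ^ s * X ^ (a - s) := by rw [← pow_add]; congr 1; omega
      rw [this]; ring
    rw [e]; exact hleft
  have hright : (X : L⟦X⟧) ^ (m + 1 - s) ∣
      φ (C.u (j + 2)) - famChart j p W' (C.u (j + 2)) := by
    have e : φ (C.u (j + 2)) - famChart j p W' (C.u (j + 2)) =
        X ^ s * X ^ (m + 1 - s - a) * U₁ * (V₀ - famV p) := by
      have hgV : g * W' = V₀ * U₁ := by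
        rw [hV₀, mul_assoc, PowerSeries.inv_mul_cancel _ hU₁0, mul_one]
      rw [famChart_right hI, hτ, famXi, hpU, hx, hdc, show d + 2 - 2 = d by omega,
        show s * (d + 2 - 1) - a = t by rw [← hdc, ht]; omega]
      rw [show m + 1 - (a + s) = m + 1 - s - a by omega] at hg
      linear_combination X ^ s * W' * hg - X ^ s * x * hW' + X ^ s * X ^ (m + 1 - s - a) * hgV
    rw [e, show m + 1 - s = s + (m + 1 - s - a) + (a - s) by omega, pow_add, pow_add,
      show s + (m + 1 - s - a) + (a - s) - a = m + 1 - s - a by omega]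
    exact mul_dvd_mul (dvd_mul_right _ _) hVV
  have hjet := isJet_famChart hI hWp
  have dψ : ∀ k ≤ C.n + 1, (X : L⟦X⟧) ^ s ∣ famChart j p W' (C.u k) :=
    fun k hk => X_pow_dvd_famChart hI (C.u_ne_zero hk)
  have hcancel : ∀ f, (X : L⟦X⟧) ^ (m + 1) ∣ famChart j p W' (C.u (j + 1)) * f →
      (X : L⟦X⟧) ^ (m + 1 - s) ∣ f := by
    intro f hf
    rw [famChart_center hI, hτ] at hf
    exact X_pow_dvd_of_dvd_mul hU₁0 (by omega) hf
  refine famPrime_le_ker hI hWp hφ fun k hk => ?_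
  rcases le_or_gt (j + 1) k with h | h
  · have := hφ.close_right C hjet (by omega) hd dψ hcancel hcenter hright (k - (j + 1)) (by omega)
    rwa [show j + 1 + (k - (j + 1)) = k by omega] at this
  · have := hφ.close_left C hjet (by omega) hd dψ (by omega) hcancel hcenter hleft'
      (j + 1 - k) (by omega)
    rwa [show j + 1 - (j + 1 - k) = k by omega] at this

/-- A jet whose order along an extreme generator `u e₀` is minimal is a specialization of a jet
whose order along the neighbour `u e₁` is minimal as well. -/
lemma exists_deformation (hs : 2 * s ≤ m) (hφ : IsJet m φ)
    (hd : ∀ k ≤ C.n + 1, (X : L⟦X⟧) ^ s ∣ φ (C.u k)) {e₀ e₁ : ℕ} (he₀ : e₀ ≤ C.n + 1)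
    (he₁ : e₁ ≤ C.n + 1) {β h : Γ →+ ℤ} (hβ : ∀ u, 0 ≤ β u) (h₀ : ∀ u, u ≠ 0 → 1 ≤ h u)
    (hβ0 : β (C.u e₀) = 0) (hβ1 : β (C.u e₁) = 1) (hh0 : h (C.u e₀) = 1) (hh1 : h (C.u e₁) = 1)
    (hprop : ∀ ψ : Γ → L⟦X⟧, IsJet m ψ → (∀ k ≤ C.n + 1, (X : L⟦X⟧) ^ s ∣ ψ (C.u k)) →
      (∀ f, (X : L⟦X⟧) ^ (m + 1) ∣ ψ (C.u e₀) * f → (X : L⟦X⟧) ^ (m + 1 - s) ∣ f) →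
      (X : L⟦X⟧) ^ (m + 1 - s) ∣ φ (C.u e₀) - ψ (C.u e₀) →
      (X : L⟦X⟧) ^ (m + 1 - s) ∣ φ (C.u e₁) - ψ (C.u e₁) →
      ∀ k ≤ C.n + 1, (X : L⟦X⟧) ^ (m + 1 - s) ∣ φ (C.u k) - ψ (C.u k))
    (hc : ¬ (X : L⟦X⟧) ^ (s + 1) ∣ φ (C.u e₀)) :
    ∃ (L' : Type w) (_ : Field L') (_ : Algebra K L') (φ' : Γ → L'⟦X⟧) (hφ' : IsJet m φ'),
      (∀ k ≤ C.n + 1, (X : L'⟦X⟧) ^ s ∣ φ' (C.u k)) ∧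
      (¬ (X : L'⟦X⟧) ^ (s + 1) ∣ φ' (C.u e₀)) ∧ (¬ (X : L'⟦X⟧) ^ (s + 1) ∣ φ' (C.u e₁)) ∧
      RingHom.ker (hφ'.eval K) ≤ RingHom.ker (hφ.eval K) := by
  have hnn : ∀ u, 0 ≤ h u := fun u => by
    rcases eq_or_ne u 0 with rfl | hu
    · simp
    · exact zero_le_one.trans (h₀ u hu)
  obtain ⟨U, hU, hU0⟩ := exists_eq_X_pow_mul (hd e₀ he₀) hc
  obtain ⟨x, hx⟩ := hd e₁ he₁
  have val0 : ∀ {A : Type w} [CommRing A] (τ ξ : A), chartFun β h 0 τ ξ 0 (C.u e₀) = τ := by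
    intro A _ τ ξ
    rw [chartFun, if_pos (hβ _), hβ0, hh0]; simp
  have val1 : ∀ {A : Type w} [CommRing A] (τ ξ : A),
      chartFun β h 0 τ ξ 0 (C.u e₁) = τ * ξ := by
    intro A _ τ ξ
    rw [chartFun, if_pos (hβ _), hβ1, hh1]; simp
  have hdc : ∀ {A : Type w} [CommRing A] (τ ξ : A⟦X⟧), (X : A⟦X⟧) ^ s ∣ τ → ∀ u, u ≠ 0 →
      (X : A⟦X⟧) ^ s ∣ chartFun β h 0 τ ξ 0 u := fun τ ξ hτ u hu =>
    dvd_chartFun h₀ (by simpa using h₀) hτ hu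
  -- The quotient of the jets of `u e₁` and `u e₀`. Near an end of the chain `β ≥ 0`, so these two
  -- generators determine a chart with no equation.
  set ξ : L⟦X⟧ := x * U⁻¹ with hξ
  have hclose := hprop (chartFun β h 0 (X ^ s * U) ξ 0) (isJet_chartFun_of_nonneg hnn hβ)
    (fun k hk => hdc _ _ (dvd_mul_right _ _) _ (C.u_ne_zero hk))
    (fun f hf => by rw [val0] at hf; exact X_pow_dvd_of_dvd_mul hU0 (by omega) hf)
    (by rw [val0, hU, sub_self]; exact dvd_zero _)
    (by
      have e : X ^ s * x = X ^ s * U * ξ := by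
        rw [hξ, mul_assoc, mul_left_comm U, PowerSeries.mul_inv_cancel _ hU0, mul_one]
      rw [val1, hx, e, sub_self]; exact dvd_zero _)
  choose z hz using fun k : Fin (C.n + 2) => hclose k (Nat.le_of_lt_succ k.2)
  let ι : L →+* Polynomial L := Polynomial.C
  let τ' : (Polynomial L)⟦X⟧ := X ^ s * PowerSeries.map ι U
  -- A new variable is added to the constant term of `ξ`: generically `u e₁` then has order exactly
  -- `s`, while the value `0` returns the original jet. The discrepancies `z` are carried along
  -- unchanged.
  let ξ' : (Polynomial L)⟦X⟧ := PowerSeries.map ι ξ + PowerSeries.C Polynomial.X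
  let Φ : Γ → (Polynomial L)⟦X⟧ := fun u => chartFun β h 0 τ' ξ' 0 u +
    X ^ (m + 1 - s) * C.onGens (fun k => PowerSeries.map ι (z k)) u
  have hΦ : IsJet m Φ := (isJet_chartFun_of_nonneg hnn hβ).add_perturbation (by omega)
    (hdc _ _ (dvd_mul_right _ _)) (C.onGens_zero _) (C.onGens_add _)
  let ev : Polynomial L →ₐ[K] L := (Polynomial.aeval (0 : L)).restrictScalars K
  have evι : (ev : Polynomial L →+* L).comp ι = RingHom.id L := by
    ext y
    simp [ev, ι]
  have evmap : ∀ f : L⟦X⟧, PowerSeries.map (ev : Polynomial L →+* L) (PowerSeries.map ι f) = f := by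
    intro f
    rw [← RingHom.comp_apply, ← PowerSeries.map_comp, evι, PowerSeries.map_id]
    rfl
  have hker0 : hφ.eval K = ev.comp (hΦ.eval K) := by
    rw [← IsJet.eval_map]
    refine IsJet.eval_congr _ _ (hφ.close_of_gens C (hΦ.map _) fun k hk => ?_)
    have hon := C.onGens_u (fun k => PowerSeries.map ι (z k)) ⟨k, Nat.lt_succ_of_le hk⟩
    have hz' := hz ⟨k, Nat.lt_succ_of_le hk⟩
    simp only at hon hz'
    have e : PowerSeries.map (ev : Polynomial L →+* L) (Φ (C.u k)) = φ (C.u k) := by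
      have e1 : PowerSeries.map (ev : Polynomial L →+* L) τ' = X ^ s * U := by
        simp only [τ', map_mul, map_pow, map_X, evmap]
      have e2 : PowerSeries.map (ev : Polynomial L →+* L) ξ' = ξ := by
        simp only [ξ', map_add, evmap]
        simp [ev]
      simp only [Φ]
      rw [hon, map_add, map_chartFun, e1, e2, map_zero, map_mul, evmap, map_pow, map_X, ← hz']
      ring
    rw [e, sub_self]
    exact dvd_zero _
  let L' := FractionRing (Polynomial L)
  let inc : Polynomial L →ₐ[K] L' := IsScalarTower.toAlgHom K (Polynomial L) L'
  have hinc : Function.Injective inc := IsFractionRing.injective (Polynomial L) L'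
  refine ⟨L', inferInstance, inferInstance, _, hΦ.map (inc : Polynomial L →+* L'), ?_, ?_, ?_, ?_⟩
  · intro k hk
    have h1 : (X : (Polynomial L)⟦X⟧) ^ s ∣ Φ (C.u k) :=
      dvd_add (hdc _ _ (dvd_mul_right _ _) _ (C.u_ne_zero hk))
        ((pow_dvd_pow _ (by omega)).mul_right _)
    simpa using _root_.map_dvd (PowerSeries.map (inc : Polynomial L →+* L')) h1
  · intro h1
    have h2 := X_pow_dvd_iff.1 h1 s (Nat.lt_succ_self s)
    rw [coeff_map] at h2
    have h3 : coeff s (Φ (C.u e₀)) = 0 := hinc (h2.trans (map_zero inc).symm)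
    simp only [Φ] at h3
    rw [val0, map_add, coeff_X_pow_mul', coeff_X_pow_mul', if_pos le_rfl, if_neg (by omega),
      Nat.sub_self, coeff_map, add_zero] at h3
    exact hU0 (Polynomial.C_injective (by simpa [ι] using h3))
  · intro h1
    have h2 := X_pow_dvd_iff.1 h1 s (Nat.lt_succ_self s)
    rw [coeff_map] at h2
    have h3 : coeff s (Φ (C.u e₁)) = 0 := hinc (h2.trans (map_zero inc).symm)
    simp only [Φ] at h3
    rw [val1, map_add, mul_assoc, coeff_X_pow_mul', coeff_X_pow_mul', if_pos le_rfl,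
      if_neg (by omega), Nat.sub_self, add_zero, coeff_zero_eq_constantCoeff_apply, map_mul] at h3
    rcases mul_eq_zero.1 h3 with h4 | h4
    · rw [← coeff_zero_eq_constantCoeff_apply, coeff_map] at h4
      exact hU0 (Polynomial.C_injective (by simpa [ι] using h4))
    · have h5 : Polynomial.C (constantCoeff ξ) + Polynomial.X = (0 : Polynomial L) := by
        rw [← h4, map_add]
        rw [← coeff_zero_eq_constantCoeff_apply, ← coeff_zero_eq_constantCoeff_apply, coeff_map]
        simp [ι]
      have h6 := congrArg (Polynomial.coeff · 1) h5
      simp at h6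
  · intro y hy
    have h1 : hΦ.eval K y = 0 := by
      have h2 : (hΦ.map (inc : Polynomial L →+* L')).eval K y = 0 := hy
      rw [hΦ.eval_map, AlgHom.comp_apply] at h2
      exact hinc (h2.trans (map_zero inc).symm)
    refine RingHom.mem_ker.2 ?_
    rw [hker0, AlgHom.comp_apply, h1, map_zero]

end ToricJets

/-! ### The closures of the canonical families cover the fibre -/

namespace ToricJets

open PowerSeries

universe w

variable {Γ : Type*} [AddCommMonoid Γ] {C : HJChain Γ} {m s : ℕ}
variable {K : Type*} [Field K]

/-- The indices of the irreducible components: each family once. -/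
structure CanonIndex (C : HJChain Γ) (m s j a : ℕ) : Prop extends FamIndex C m s j a where
  canon : (j = 0 ∧ a = s) ∨ s < a

lemma canonIndex_zero (hs1 : 1 ≤ s) (hs : 2 * s ≤ m + 1) : CanonIndex C m s 0 s where
  lt_n := C.n_pos
  one_le := hs1
  two_mul_le := hs
  le_a := le_rfl
  a_le := Nat.le_mul_of_pos_right _ (by have := C.two_le (0 + 1); omega)
  a_le' := by omega
  canon := Or.inl ⟨rfl, rfl⟩

/-- Jets whose minimal order is attained at `u (j + 1)` but not at `u j`. -/
lemma exists_famPrime_le_of_interior {L : Type*} [Field L] [Algebra K L] {φ : Γ → L⟦X⟧}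
    (hs1 : 1 ≤ s) (hs : 2 * s ≤ m) (hφ : IsJet m φ)
    (hd : ∀ k ≤ C.n + 1, (X : L⟦X⟧) ^ s ∣ φ (C.u k)) {j : ℕ} (hj : j < C.n)
    (hc : ¬ (X : L⟦X⟧) ^ (s + 1) ∣ φ (C.u (j + 1))) (hl : (X : L⟦X⟧) ^ (s + 1) ∣ φ (C.u j)) :
    ∃ (j a : ℕ) (hI : CanonIndex C m s j a),
      famPrime K hI.toFamIndex ≤ RingHom.ker (hφ.eval K) := by
  obtain ⟨U, hU, hU0⟩ := exists_eq_X_pow_mul (hd (j + 1) (by omega)) hc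
  -- Compare orders in the relation at `u (j + 1)`: the power on the right has order exactly `s *
  -- C.c (j + 1)`, and the left side has order at least `a + s`.
  have hbound : ∀ a, a + s ≤ m + 1 → (X : L⟦X⟧) ^ a ∣ φ (C.u j) →
      a ≤ s * (C.c (j + 1) - 1) := by
    intro a ha hdv
    have h1 := hφ.rel C hj
    have h2 : (X : L⟦X⟧) ^ (a + s) ∣ φ (C.u j) * φ (C.u (j + 2)) := by
      rw [pow_add]; exact mul_dvd_mul hdv (hd _ (by omega))
    have h3 : (X : L⟦X⟧) ^ (a + s) ∣ φ (C.u (j + 1)) ^ C.c (j + 1) := by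
      have := dvd_sub h2 ((pow_dvd_pow X ha).trans h1)
      rwa [sub_sub_cancel] at this
    have h4 : a + s ≤ s * C.c (j + 1) := by
      by_contra! hlt
      rw [hU, mul_pow, ← pow_mul] at h3
      refine not_X_pow_succ_dvd (U := U ^ C.c (j + 1)) ?_ _ ((pow_dvd_pow X hlt).trans h3)
      rw [map_pow]
      exact pow_ne_zero _ hU0
    rw [Nat.mul_sub, mul_one]
    omega
  -- If `u j` vanishes to the visible precision, its order is replaced by the cap `m + 1 - s`, where
  -- a family imposes no exact order.
  by_cases hall : (X : L⟦X⟧) ^ (m + 1 - s) ∣ φ (C.u j)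
  · have hI : CanonIndex C m s j (m + 1 - s) :=
      { lt_n := hj, one_le := hs1, two_mul_le := by omega, le_a := by omega,
        a_le := hbound _ (by omega) hall, a_le' := by omega, canon := Or.inr (by omega) }
    exact ⟨_, _, hI, famPrime_le_of_contact hI.toFamIndex hs hφ hd hc hall (by omega)⟩
  · classical
    have hex : ∃ a, ¬ (X : L⟦X⟧) ^ (a + 1) ∣ φ (C.u j) :=
      ⟨m - s, by rwa [show m - s + 1 = m + 1 - s by omega]⟩
    set a := Nat.find hex with ha
    have h1 : ¬ (X : L⟦X⟧) ^ (a + 1) ∣ φ (C.u j) := Nat.find_spec hex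
    have h2 : s < a := by
      by_contra! hle
      exact h1 ((pow_dvd_pow X (by omega)).trans hl)
    have h3 : (X : L⟦X⟧) ^ a ∣ φ (C.u j) := by
      have := Nat.find_min hex (m := a - 1) (by omega)
      rwa [not_not, show a - 1 + 1 = a by omega] at this
    have h4 : a ≤ m - s := Nat.find_min' hex (by rwa [show m - s + 1 = m + 1 - s by omega])
    have hI : CanonIndex C m s j a :=
      { lt_n := hj, one_le := hs1, two_mul_le := by omega, le_a := by omega,
        a_le := hbound _ (by omega) h3, a_le' := by omega, canon := Or.inr h2 }
    exact ⟨_, _, hI, famPrime_le_of_contact hI.toFamIndex hs hφ hd hc h3 fun _ => h1⟩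

/-- Take the first generator of order `s`. If it is not `u 0`, its left neighbour has order greater
than `s`, which gives an index with `s < a`; if it is `u 0`, a deformation leads to the index with
`j = 0` and `a = s`. -/
lemma exists_famPrime_le_of_le_n {L : Type w} [Field L] [Algebra K L] {φ : Γ → L⟦X⟧}
    (hs1 : 1 ≤ s) (hs : 2 * s ≤ m) (hφ : IsJet m φ)
    (hd : ∀ k ≤ C.n + 1, (X : L⟦X⟧) ^ s ∣ φ (C.u k))
    (hex : ∃ k ≤ C.n, ¬ (X : L⟦X⟧) ^ (s + 1) ∣ φ (C.u k)) :
    ∃ (j a : ℕ) (hI : CanonIndex C m s j a),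
      famPrime K hI.toFamIndex ≤ RingHom.ker (hφ.eval K) := by
  classical
  obtain ⟨hk, hc⟩ := Nat.find_spec hex
  have hmin := fun j => Nat.find_min hex (m := j)
  rcases hk0 : Nat.find hex with _ | j
  · rw [hk0] at hc
    obtain ⟨L', _, _, φ', hφ', hd', hc0, hc1, hle⟩ :=
      exists_deformation (K := K) hs hφ hd (e₀ := 0) (e₁ := 1) (by omega) (by omega)
        (β := C.b 0) (h := C.h 0) C.b_zero_nonneg (fun u hu => C.one_le_h (Nat.zero_le _) hu)
        (C.b_self 0 (by omega)) (C.b_succ 0 (by omega)) (C.h_self (by omega))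
        (C.h_succ (i := 0) (by omega))
        (fun ψ hψ hdψ hcan h0 h1 k hk => by
          have := hφ.close_right C hψ (by omega) hd hdψ hcan h0 h1 k (by omega)
          rwa [zero_add] at this) hc
    have hI : CanonIndex C m s 0 s := canonIndex_zero hs1 (by omega)
    exact ⟨_, _, hI, (famPrime_le_of_contact hI.toFamIndex hs hφ' hd' hc1 (hd' _ (by omega))
      fun _ => hc0).trans hle⟩
  · rw [hk0] at hc hk hmin
    have hl := hmin j (Nat.lt_succ_self j)
    have hl' : (X : L⟦X⟧) ^ (s + 1) ∣ φ (C.u j) := by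
      by_contra hcon
      exact hl ⟨by omega, hcon⟩
    exact exists_famPrime_le_of_interior hs1 hs hφ hd hk hc hl'

/-- Every jet whose minimal order on the generators is `s` lies in the closure of a family with
that `s`. -/
lemma exists_famPrime_le_of_order {L : Type w} [Field L] [Algebra K L] {φ : Γ → L⟦X⟧}
    (hs1 : 1 ≤ s) (hs : 2 * s ≤ m) (hφ : IsJet m φ)
    (hd : ∀ k ≤ C.n + 1, (X : L⟦X⟧) ^ s ∣ φ (C.u k))
    (hex : ∃ k ≤ C.n + 1, ¬ (X : L⟦X⟧) ^ (s + 1) ∣ φ (C.u k)) :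
    ∃ (j a : ℕ) (hI : CanonIndex C m s j a),
      famPrime K hI.toFamIndex ≤ RingHom.ker (hφ.eval K) := by
  obtain ⟨k, hk, hc⟩ := hex
  rcases Nat.lt_or_ge C.n k with h | h
  · obtain rfl : k = C.n + 1 := by omega
    have hn := C.n_pos
    -- At the right end, the deformation makes `u n` minimal as well and so reduces to the previous
    -- case.
    obtain ⟨L', _, _, φ', hφ', hd', hc0, hc1, hle⟩ :=
      exists_deformation (K := K) hs hφ hd (e₀ := C.n + 1) (e₁ := C.n) (by omega) (by omega)
        (β := -C.b (C.n + 1)) (h := C.h C.n) (fun u => by simpa using C.b_last_nonpos u)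
        (fun u hu => C.one_le_h le_rfl hu)
        (by simp [C.b_self (C.n + 1) le_rfl]) (by simp [C.b_pred C.n le_rfl])
        (C.h_succ le_rfl) (C.h_self le_rfl)
        (fun ψ hψ hdψ hcan h0 h1 k hk => by
          have := hφ.close_left C hψ (by omega) hd hdψ le_rfl hcan h0 h1 (C.n + 1 - k) (by omega)
          rwa [show C.n + 1 - (C.n + 1 - k) = k by omega] at this) hc
    obtain ⟨j, a, hI, hle'⟩ :=
      exists_famPrime_le_of_le_n (K := K) hs1 hs hφ' hd' ⟨C.n, le_rfl, hc1⟩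
    exact ⟨j, a, hI, hle'.trans hle⟩
  · exact exists_famPrime_le_of_le_n hs1 hs hφ hd ⟨k, h, hc⟩

/-- Use the minimal order on the generators as `s`. If it exceeds `m / 2`, all relations between
generators are invisible, and the jet belongs to the closure of the family with the largest `s`,
namely `(m + 1) / 2`. -/
lemma exists_famPrime_le {L : Type w} [Field L] [Algebra K L] {φ : Γ → L⟦X⟧} (hm : 1 ≤ m)
    (hφ : IsJet m φ) (hd : ∀ k ≤ C.n + 1, (X : L⟦X⟧) ∣ φ (C.u k)) :
    ∃ (s j a : ℕ) (hI : CanonIndex C m s j a),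
      famPrime K hI.toFamIndex ≤ RingHom.ker (hφ.eval K) := by
  classical
  by_cases hall : ∀ k ≤ C.n + 1, (X : L⟦X⟧) ^ (m + 1 - (m + 1) / 2) ∣ φ (C.u k)
  · have hI : CanonIndex C m ((m + 1) / 2) 0 ((m + 1) / 2) :=
      canonIndex_zero (by omega) (by omega)
    exact ⟨_, _, _, hI, famPrime_le_of_X_pow_dvd hI.toFamIndex hφ hall⟩
  · have hex : ∃ s, ∃ k ≤ C.n + 1, ¬ (X : L⟦X⟧) ^ (s + 1) ∣ φ (C.u k) := by
      push Not at hall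
      obtain ⟨k, hk, h⟩ := hall
      exact ⟨m + 1 - (m + 1) / 2 - 1, k, hk,
        by rwa [show m + 1 - (m + 1) / 2 - 1 + 1 = m + 1 - (m + 1) / 2 by omega]⟩
    have h1 := Nat.find_spec hex
    have hmin := fun j => Nat.find_min hex (m := j)
    have hdv : ∀ k ≤ C.n + 1, (X : L⟦X⟧) ^ Nat.find hex ∣ φ (C.u k) := by
      intro k hk
      rcases h0 : Nat.find hex with _ | s
      · simp
      · by_contra hcon
        exact hmin s (by omega) ⟨k, hk, hcon⟩
    have hs1 : 1 ≤ Nat.find hex := by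
      by_contra! h0
      obtain ⟨k, hk, h2⟩ := h1
      rw [show Nat.find hex + 1 = 1 by omega, pow_one] at h2
      exact h2 (hd k hk)
    have hs2 : 2 * Nat.find hex ≤ m := by
      by_contra! h0
      refine hall fun k hk => (pow_dvd_pow X ?_).trans (hdv k hk)
      omega
    obtain ⟨j, a, hI, hle⟩ := exists_famPrime_le_of_order (K := K) hs1 hs2 hφ hdv h1
    exact ⟨_, j, a, hI, hle⟩

end ToricJets

/-! ### Transcendence degrees of the families -/

namespace ToricJets

open PowerSeries

section Trdeg

universe u

variable {K : Type*} [Field K] {R : Type*} [CommRing R] [Algebra K R]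
  {B C : Type u} [CommRing B] [CommRing C] [Algebra K B] [Algebra K C] [IsDomain B] [IsDomain C]

/-- If `ker f ≤ ker g` is a proper inclusion and `C` is algebraic over the image of `g`, then `C`
has smaller transcendence degree than `B`. -/
lemma trdeg_add_one_le (f : R →ₐ[K] B) (g : R →ₐ[K] C) (hker : RingHom.ker f ≤ RingHom.ker g)
    {x : R} (hgx : g x = 0) (hfx : f x ≠ 0)
    (halg : Algebra.IsAlgebraic (Algebra.adjoin K (Set.range g)) C) :
    Algebra.trdeg K C + 1 ≤ Algebra.trdeg K B := by
  -- A transcendence basis of `C` is taken inside the image of `g` and lifted to `R`. Because `ker f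
  -- ≤ ker g`, its image under `f` is still independent.
  obtain ⟨t, ht, htb⟩ := exists_isTranscendenceBasis_subset (R := K) (Set.range g)
  choose r hr using fun i : t => ht i.2
  have hlift : ∀ F : MvPolynomial t K, g (MvPolynomial.aeval r F) = 0 → F = 0 := by
    intro F hF
    rw [MvPolynomial.comp_aeval_apply] at hF
    simp only [hr] at hF
    exact algebraicIndependent_iff.1 htb.1 F hF
  have hind : AlgebraicIndependent K fun i => f (r i) := by
    refine algebraicIndependent_iff.2 fun F hF => hlift F (hker ?_)
    rw [← MvPolynomial.comp_aeval_apply] at hF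
    exact hF
  -- An algebraic equation for `f x` may be assumed to have nonzero constant term. Transported to
  -- `g`, where `x` becomes `0`, it says that this constant term comes from the zero polynomial.
  have htr : Transcendental (Algebra.adjoin K (Set.range fun i => f (r i))) (f x) := by
    intro hal
    obtain ⟨q, hq0, hq⟩ :=
      hal.exists_nonzero_coeff_and_aeval_eq_zero (mem_nonZeroDivisors_of_ne_zero hfx)
    have hcoef : ∀ k, ∃ F : MvPolynomial t K, f (MvPolynomial.aeval r F) = q.coeff k := by
      intro k
      obtain ⟨F, hF⟩ := (SetLike.ext_iff.1
        (Algebra.adjoin_range_eq_range_aeval K fun i => f (r i)) _).1 (q.coeff k).2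
      exact ⟨F, by rw [MvPolynomial.comp_aeval_apply]; exact hF⟩
    choose F hF using hcoef
    have h1 : f (∑ k ∈ Finset.range (q.natDegree + 1), MvPolynomial.aeval r (F k) * x ^ k) = 0 := by
      rw [Polynomial.aeval_eq_sum_range] at hq
      rw [map_sum, ← hq]
      refine Finset.sum_congr rfl fun k _ => ?_
      rw [map_mul, map_pow, hF]
      rfl
    have h2 : g (∑ k ∈ Finset.range (q.natDegree + 1), MvPolynomial.aeval r (F k) * x ^ k) = 0 :=
      hker h1
    rw [Finset.sum_range_succ', map_add, map_sum, Finset.sum_eq_zero, zero_add, pow_zero,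
      mul_one] at h2
    · have h3 := hF 0
      rw [hlift _ h2, map_zero, map_zero] at h3
      exact hq0 (Subtype.ext h3.symm)
    · intro k _
      rw [map_mul, map_pow, hgx, zero_pow (Nat.succ_ne_zero k), mul_zero]
  have := ((hind.option_iff_transcendental (f x)).2 htr).cardinalMk_le_trdeg
  rwa [Cardinal.mk_option, htb.cardinalMk_eq_trdeg] at this

end Trdeg

section Coefficients

variable {A : Type*} [CommRing A] {S : Subring A}

/-- The first `N` coefficients of `f` lie in the subring `S`. -/
def CoeffsIn (S : Subring A) (N : ℕ) (f : A⟦X⟧) : Prop := ∀ k < N, coeff k f ∈ S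

lemma CoeffsIn.mono {N N' : ℕ} {f : A⟦X⟧} (h : CoeffsIn S N f) (hN : N' ≤ N) : CoeffsIn S N' f :=
  fun k hk => h k (hk.trans_le hN)

lemma CoeffsIn.congr {N : ℕ} {f g : A⟦X⟧} (h : CoeffsIn S N f) (hfg : (X : A⟦X⟧) ^ N ∣ g - f) :
    CoeffsIn S N g := fun k hk => by
  rw [coeff_eq_of_X_pow_dvd_sub hfg hk]; exact h k hk

lemma CoeffsIn.sub {N : ℕ} {f g : A⟦X⟧} (hf : CoeffsIn S N f) (hg : CoeffsIn S N g) :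
    CoeffsIn S N (f - g) := fun k hk => by
  rw [map_sub]; exact S.sub_mem (hf k hk) (hg k hk)

lemma CoeffsIn.add {N : ℕ} {f g : A⟦X⟧} (hf : CoeffsIn S N f) (hg : CoeffsIn S N g) :
    CoeffsIn S N (f + g) := fun k hk => by
  rw [map_add]; exact S.add_mem (hf k hk) (hg k hk)

lemma CoeffsIn.mul {N : ℕ} {f g : A⟦X⟧} (hf : CoeffsIn S N f) (hg : CoeffsIn S N g) :
    CoeffsIn S N (f * g) := fun k hk => by
  rw [coeff_mul]
  refine S.sum_mem fun x hx => ?_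
  have := Finset.HasAntidiagonal.mem_antidiagonal.1 hx
  exact S.mul_mem (hf _ (by omega)) (hg _ (by omega))

lemma CoeffsIn.one (N : ℕ) : CoeffsIn S N (1 : A⟦X⟧) := fun k _ => by
  rw [coeff_one]; split_ifs
  exacts [S.one_mem, S.zero_mem]

lemma CoeffsIn.X_pow (N d : ℕ) : CoeffsIn S N (X ^ d : A⟦X⟧) := fun k _ => by
  rw [coeff_X_pow]; split_ifs
  exacts [S.one_mem, S.zero_mem]

lemma CoeffsIn.pow {N : ℕ} {f : A⟦X⟧} (hf : CoeffsIn S N f) (d : ℕ) : CoeffsIn S N (f ^ d) := by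
  induction d with
  | zero => simpa using CoeffsIn.one N
  | succ d ih => rw [pow_succ]; exact ih.mul hf

lemma CoeffsIn.of_X_pow_mul {N d : ℕ} {f : A⟦X⟧} (h : CoeffsIn S N (X ^ d * f)) :
    CoeffsIn S (N - d) f := fun k hk => by
  have := h (k + d) (by omega)
  rwa [coeff_X_pow_mul] at this

/-- Division of power series coefficient by coefficient: each new coefficient of `g` appears
multiplied by the nonzero constant term of `f`, and `S` permits division by it. -/
lemma CoeffsIn.of_mul (hS : ∀ b w, b ∈ S → b ≠ 0 → b * w ∈ S → w ∈ S) {N : ℕ} {f g : A⟦X⟧}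
    (hf : CoeffsIn S N f) (hf0 : constantCoeff f ≠ 0) (h : CoeffsIn S N (f * g)) :
    CoeffsIn S N g := by
  intro k
  induction k using Nat.strong_induction_on with
  | _ k ih =>
  intro hk
  refine hS (coeff 0 f) _ (hf 0 (by omega)) (by simpa using hf0) ?_
  have h1 := h k hk
  rw [coeff_mul, ← Finset.add_sum_erase _ _ (a := (0, k)) (by simp)] at h1
  refine (S.add_mem_cancel_right (S.sum_mem fun x hx => ?_)).1 h1
  obtain ⟨hx1, hx2⟩ := Finset.mem_erase.1 hx
  have hx3 := Finset.HasAntidiagonal.mem_antidiagonal.1 hx2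
  have hx4 : x.1 ≠ 0 := fun h0 => hx1 (Prod.ext h0 (by simpa [h0] using hx3))
  exact S.mul_mem (hf _ (by omega)) (ih _ (by omega) (by omega))

lemma CoeffsIn.finSeries {N : ℕ} {f : Fin N → A} (h : CoeffsIn S N (finSeries f)) (N' : ℕ) :
    CoeffsIn S N' (ToricJets.finSeries f) := fun k _ => by
  by_cases hk : k < N
  · exact h k hk
  · simp [ToricJets.finSeries, hk, S.zero_mem]

lemma CoeffsIn.finSeries_of_monicSeries {N : ℕ} {f : Fin N → A}
    (h : CoeffsIn S N (monicSeries f)) : CoeffsIn S N (ToricJets.finSeries f) := by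
  have := h.sub (CoeffsIn.X_pow N N)
  rwa [monicSeries, add_sub_cancel_right] at this

lemma CoeffsIn.monicSeries {N : ℕ} {f : Fin N → A} (h : CoeffsIn S N (monicSeries f)) (N' : ℕ) :
    CoeffsIn S N' (ToricJets.monicSeries f) :=
  (h.finSeries_of_monicSeries.finSeries N').add (CoeffsIn.X_pow _ _)

end Coefficients

section Generation

variable {Γ : Type*} [AddCommMonoid Γ] {C : HJChain Γ} {m s j a : ℕ} {A : Type*} [CommRing A]

/-- The coefficients of the jets of a family generate all the parameters. -/
lemma famVars_mem {S : Subring A} (hS : ∀ b w, b ∈ S → b ≠ 0 → b * w ∈ S → w ∈ S)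
    (hI : FamIndex C m s j a) {p : FamVars C m s a → A} {W' : A⟦X⟧} (hW : famW p * W' = 1)
    (hU0 : constantCoeff (famU p) ≠ 0) [Nontrivial A]
    (h : ∀ k ≤ C.n + 1, CoeffsIn S (m + 1) (famFun j p W' (C.u k))) (v : FamVars C m s a) :
    p v ∈ S := by
  have hj := hI.lt_n
  have h2s := hI.two_mul_le
  have hsa := hI.le_a
  have ha' := hI.a_le'
  have ha := hI.a_le
  -- Below degree `m + 1 - s` the free top coefficients are not seen, so the chart parameters can be
  -- recovered first.
  have hchart : ∀ k ≤ C.n + 1, CoeffsIn S (m + 1 - s) (famChart j p W' (C.u k)) := fun k hk =>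
    ((h k hk).mono (by omega)).congr (by
      rw [famFun, sub_add_cancel_left, dvd_neg]
      exact dvd_mul_right _ _)
  have hU : ∀ N, CoeffsIn S N (famU p) := by
    have h1 := hchart (j + 1) (by omega)
    rw [famChart_center hI, famTau] at h1
    exact (h1.of_X_pow_mul.mono (by omega) : CoeffsIn S (m + 1 - 2 * s) (famU p)).monicSeries
  have hWs : ∀ N, CoeffsIn S N (famW p) := by
    have h1 := hchart j (by omega)
    rw [famChart_left hI, famTau, famEta, show X ^ s * famU p * (X ^ (a - s) * famW p) =
      X ^ s * (X ^ (a - s) * (famU p * famW p)) by ring] at h1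
    have h2 := CoeffsIn.of_mul hS (hU _) hU0 h1.of_X_pow_mul.of_X_pow_mul
    exact (h2.mono (by omega) : CoeffsIn S (m + 1 - s - a) (famW p)).monicSeries
  have hWu : IsUnit (constantCoeff (famW p)) :=
    isUnit_iff_constantCoeff.1 (IsUnit.of_mul_eq_one _ hW)
  have hW's : ∀ N, CoeffsIn S N W' := fun N =>
    CoeffsIn.of_mul hS (hWs N) hWu.ne_zero (by rw [hW]; exact CoeffsIn.one N)
  have hV : ∀ N, CoeffsIn S N (famV p) := by
    have h1 := hchart (j + 2) (by omega)
    rw [famChart_right hI, famTau, mul_assoc] at h1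
    have h2 := CoeffsIn.of_mul hS (hU _) hU0 h1.of_X_pow_mul
    rw [famXi] at h2
    have h3 := h2.sub (((CoeffsIn.X_pow _ (s * (C.c (j + 1) - 1) - a)).mul
      ((hU _).pow (C.c (j + 1) - 2))).mul (hW's _))
    rw [add_sub_cancel_left] at h3
    exact (h3.of_X_pow_mul.mono (by omega) : CoeffsIn S (a - s) (famV p)).finSeries
  have hξ : ∀ N, CoeffsIn S N (famXi j p W') := fun N =>
    (((CoeffsIn.X_pow _ _).mul ((hU _).pow _)).mul (hW's _)).add ((CoeffsIn.X_pow _ _).mul (hV _))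
  have hτ : ∀ N, CoeffsIn S N (famTau p) := fun N => (CoeffsIn.X_pow _ _).mul (hU _)
  have hη : ∀ N, CoeffsIn S N (famEta p) := fun N => (CoeffsIn.X_pow _ _).mul (hWs _)
  -- With all chart parameters in `S`, the chart can be subtracted in every degree and the top
  -- coefficients remain.
  have hZ : ∀ k : Fin (C.n + 2), CoeffsIn S s (famZ p k) := by
    intro k
    have h1 : CoeffsIn S (m + 1) (famChart j p W' (C.u k)) := by
      unfold famChart chartFun
      split_ifs
      · exact ((hτ _).pow _).mul ((hξ _).pow _)
      · exact ((hτ _).pow _).mul ((hη _).pow _)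
    have h2 := (h k (Nat.le_of_lt_succ k.2)).sub h1
    rw [famFun, add_sub_cancel_left, C.onGens_u] at h2
    exact h2.of_X_pow_mul.mono (by omega)
  rcases v with (k | k) | (k | ⟨k, l⟩)
  · have := hU _ k k.2
    rwa [famU, coeff_monicSeries] at this
  · have := hWs _ k k.2
    rwa [famW, coeff_monicSeries] at this
  · have := hV _ k k.2
    rwa [famV, coeff_finSeries] at this
  · have := hZ k l l.2
    rwa [famZ, coeff_finSeries] at this

variable {K : Type*} [Field K]

lemma famGen_ne_zero (v : FamVars C m s a) : famGen C m s a K v ≠ 0 := by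
  intro h
  refine MvPolynomial.X_ne_zero (R := K) v (IsLocalization.injective (FamRing C m s a K)
    (powers_le_nonZeroDivisors_of_noZeroDivisors (famDenom_ne_zero C m s a K)) ?_)
  rw [map_zero]
  exact h

lemma constantCoeff_famU_famGen_ne_zero : constantCoeff (famU (famGen C m s a K)) ≠ 0 := by
  unfold famU
  rcases Nat.eq_zero_or_pos (m + 1 - 2 * s) with h0 | h0
  · simp [monicSeries_zero _ h0]
  · rw [constantCoeff_monicSeries_of_pos _ h0]
    exact famGen_ne_zero _

/-- Elements algebraic over the image form a ring closed under division by its nonzero elements, so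
`famVars_mem` puts all parameters in it. No dimension is lost in passing from the parameters to the
jet. -/
lemma isAlgebraic_famRing (hI : FamIndex C m s j a) :
    Algebra.IsAlgebraic (Algebra.adjoin K (Set.range (famEval K hI))) (FamRing C m s a K) := by
  set E := Algebra.adjoin K (Set.range (famEval K hI))
  set S := Subalgebra.algebraicClosure E (FamRing C m s a K)
  have hdiv : ∀ b w, b ∈ S → b ≠ 0 → b * w ∈ S → w ∈ S := fun b w hb hb0 hbw =>
    IsAlgebraic.of_mul (mem_nonZeroDivisors_of_ne_zero hb0) hb hbw
  have hE : ∀ y ∈ E, y ∈ S := fun y hy => isAlgebraic_algebraMap (⟨y, hy⟩ : E)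
  have hgen : ∀ v, famGen C m s a K v ∈ S := by
    intro v
    refine famVars_mem (S := S.toSubring) hdiv hI (famW_mul_famInv C m s a K)
      constantCoeff_famU_famGen_ne_zero (fun k _ i hi => ?_) v
    refine hE _ (Algebra.subset_adjoin ⟨monoCoord K (C.u k) ⟨i, hi⟩, ?_⟩)
    exact IsJet.eval_monoCoord _ _ _
  have hpoly : ∀ y : MvPolynomial (FamVars C m s a) K, algebraMap _ (FamRing C m s a K) y ∈ S := by
    intro y
    induction y using MvPolynomial.induction_on with
    | C c =>
      refine hE _ ?_
      have : algebraMap (MvPolynomial (FamVars C m s a) K) (FamRing C m s a K)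
          (MvPolynomial.C c) = algebraMap K _ c := by
        rw [IsScalarTower.algebraMap_apply K (MvPolynomial (FamVars C m s a) K) (FamRing C m s a K)]
        rfl
      rw [this]
      exact E.algebraMap_mem c
    | add y z hy hz => rw [map_add]; exact S.add_mem hy hz
    | mul_X y v hy => rw [map_mul]; exact S.mul_mem hy (hgen v)
  refine ⟨fun w => ?_⟩
  obtain ⟨⟨y, d⟩, hyd⟩ :=
    IsLocalization.surj (Submonoid.powers (famDenom C m s a K)) w
  refine hdiv (algebraMap _ _ (d : MvPolynomial (FamVars C m s a) K)) w (hpoly _) ?_ ?_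
  · exact (IsLocalization.map_units (FamRing C m s a K) d).ne_zero
  · rw [mul_comm, hyd]
    exact hpoly y

/-- Under the index conditions the number of variables is `2 (m + 1) + (n - 2) s`: independent of
`j` and `a`, and nondecreasing in `s` exactly when `n ≥ 2`. -/
lemma trdeg_famRing : Algebra.trdeg K (FamRing C m s a K) = Fintype.card (FamVars C m s a) := by
  have hle := powers_le_nonZeroDivisors_of_noZeroDivisors (famDenom_ne_zero C m s a K)
  have := IsLocalization.isAlgebraic (R := MvPolynomial (FamVars C m s a) K)
    (S := FamRing C m s a K) (Submonoid.powers (famDenom C m s a K))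
  have hinj : FaithfulSMul (MvPolynomial (FamVars C m s a) K) (FamRing C m s a K) :=
    (faithfulSMul_iff_algebraMap_injective _ _).2 (IsLocalization.injective _ hle)
  have h := trdeg_add_eq K (MvPolynomial (FamVars C m s a) K)
    (A := FamRing C m s a K)
  rw [← h, trdeg_eq_zero (R := MvPolynomial (FamVars C m s a) K), add_zero, MvPolynomial.trdeg_of_isDomain]
  simp

end Generation
end ToricJets

/-! ### Incomparability of the canonical families -/

namespace ToricJets

open PowerSeries

variable {Γ : Type*} [AddCommMonoid Γ] {C : HJChain Γ} {m s j a s' j' a' : ℕ}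

section Vanishing

variable {A : Type*} [CommRing A] {p : FamVars C m s a → A} {W' : A⟦X⟧}

/-- To the left of the centre `b (j + 1)` is at most `-1`, so the chart contains a factor `η` of
order `a - s` besides a factor `τ`. -/
lemma X_pow_dvd_famFun_of_le (hI : FamIndex C m s j a) {k : ℕ} (hk : k ≤ j) :
    (X : A⟦X⟧) ^ a ∣ famFun j p W' (C.u k) := by
  have hj := hI.lt_n
  have hsa := hI.le_a
  have ha' := hI.a_le'
  refine dvd_add ?_ ((pow_dvd_pow _ (by omega)).mul_right _)
  have h1 := C.b_u_le_neg_one (i := j + 1) (k := k) (by omega) (by omega)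
  have h2 := C.one_le_h_u (i := j) (k := k) (by omega) (by omega)
  rw [famChart, chartFun, if_neg (by omega), C.h_add_mul hj]
  have e : (X : A⟦X⟧) ^ a = X ^ s * X ^ (a - s) := by rw [← pow_add, Nat.add_sub_of_le hsa]
  rw [e]
  exact mul_dvd_mul ((dvd_mul_right _ _).trans (dvd_pow_self _ (by omega)))
    ((dvd_mul_right _ _).trans (dvd_pow_self _ (by omega)))

/-- The two summands of `ξ` bound the order of `u (j + 2)` from below by `min (s c) (m + 1) - a`;
increasing `a` by one lowers this bound by one. -/
lemma X_pow_dvd_famFun_right (hI : FamIndex C m s j a) {N : ℕ}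
    (h1 : N + a ≤ s * C.c (j + 1)) (h2 : N + a ≤ m + 1) :
    (X : A⟦X⟧) ^ N ∣ famFun j p W' (C.u (j + 2)) := by
  have hsa := hI.le_a
  have ha := hI.a_le
  have ha' := hI.a_le'
  refine dvd_add ?_ ((pow_dvd_pow _ (by omega)).mul_right _)
  rw [famChart_right hI, famTau, famXi, mul_assoc, mul_left_comm, mul_add]
  rw [Nat.mul_sub, mul_one] at ha ⊢
  have h2 := Nat.le_mul_of_pos_right s (show 0 < C.c (j + 1) by have := C.two_le (j + 1); omega)
  refine (dvd_add ?_ ?_).mul_left _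
  · rw [mul_assoc, ← mul_assoc, ← pow_add]
    exact (pow_dvd_pow _ (by omega)).mul_right _
  · rw [← mul_assoc, ← pow_add]
    exact (pow_dvd_pow _ (by omega)).mul_right _

/-- Far to the right of the centre the exponent of `τ` is already at least `c (j' + 1) - 1` by
`C.sub_one_le_h_u`. -/
lemma X_pow_dvd_famFun_of_lt (hj : j < j') (hj' : j' < C.n) {N : ℕ}
    (h1 : N ≤ s * (C.c (j' + 1) - 1)) (h2 : N + s ≤ m + 1) :
    (X : A⟦X⟧) ^ N ∣ famFun j p W' (C.u (j' + 2)) := by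
  refine dvd_add ?_ ((pow_dvd_pow _ (by omega)).mul_right _)
  have h3 := C.one_le_b_u (i := j + 1) (k := j' + 2) (by omega) (by omega)
  have h4 : (C.c (j' + 1) : ℤ) - 1 ≤ C.h (j + 1) (C.u (j' + 2)) :=
    C.sub_one_le_h_u (i := j + 1) (k := j' + 1) (by omega) (by omega)
  have h5 : C.c (j' + 1) - 1 ≤ (C.h (j + 1) (C.u (j' + 2))).toNat := by omega
  rw [famChart, chartFun, if_pos (by omega)]
  refine Dvd.dvd.mul_right ?_ _
  rw [famTau, mul_pow, ← pow_mul]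
  exact (pow_dvd_pow _ (h1.trans (Nat.mul_le_mul_left _ h5))).mul_right _

end Vanishing

section Point

variable (K : Type*) [Field K]

/-- A rational member of a family with the smallest possible orders. -/
noncomputable def famPoint (C : HJChain Γ) (m s j a : ℕ) : FamVars C m s a → K :=
  Sum.elim (Sum.elim (fun k => coeff (k : ℕ) (1 : K⟦X⟧)) fun k => coeff (k : ℕ) (1 : K⟦X⟧))
    -- `V` is nonzero only if its summand in `ξ` has strictly smaller order than the other one. In
    -- the case of equality it is set to zero, which avoids cancellation of leading terms.
    (Sum.elim (fun k => if m + 1 < s * C.c (j + 1) then coeff (k : ℕ) (1 : K⟦X⟧) else 0)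
      fun _ => 0)

variable {K}

lemma constantCoeff_monicSeries_one (N : ℕ) :
    constantCoeff (monicSeries fun k : Fin N => coeff (k : ℕ) (1 : K⟦X⟧)) = 1 := by
  rcases Nat.eq_zero_or_pos N with h0 | h0
  · simp [monicSeries_zero _ h0]
  · rw [constantCoeff_monicSeries_of_pos _ h0]
    simp

lemma constantCoeff_famU_famPoint : constantCoeff (famU (famPoint K C m s j a)) = 1 :=
  constantCoeff_monicSeries_one _

lemma constantCoeff_famW_famPoint : constantCoeff (famW (famPoint K C m s j a)) = 1 :=
  constantCoeff_monicSeries_one _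

lemma exists_famW_famPoint_inv : ∃ W' : K⟦X⟧, famW (famPoint K C m s j a) * W' = 1 ∧
    constantCoeff W' = 1 := by
  obtain ⟨W', hW'⟩ := (isUnit_of_constantCoeff_ne_zero (U := famW (famPoint K C m s j a))
    (by rw [constantCoeff_famW_famPoint]; exact one_ne_zero)).exists_right_inv
  refine ⟨W', hW', ?_⟩
  have := congrArg constantCoeff hW'
  rwa [map_mul, constantCoeff_famW_famPoint, one_mul, map_one] at this

lemma coeff_X_pow_mul_add {A : Type*} [CommRing A] {i N : ℕ} (hi : i < N) (U z : A⟦X⟧) :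
    coeff i (X ^ i * U + X ^ N * z) = constantCoeff U := by
  have h1 : coeff i (X ^ N * z) = 0 := X_pow_dvd_iff.1 (dvd_mul_right _ _) i hi
  have h2 := coeff_X_pow_mul U i 0
  rw [zero_add] at h2
  rw [map_add, h1, add_zero, h2, coeff_zero_eq_constantCoeff_apply]

/-- A coordinate fails to vanish generically as soon as it is nonzero at one member of the family;
`famPoint` serves as that member below. -/
lemma monoCoord_notMem_famPrime (hI : FamIndex C m s j a) {A : Type*} [CommRing A] [Algebra K A]
    {p : FamVars C m s a → A} {W' : A⟦X⟧} (hW : famW p * W' = 1) {u : Γ} {i : Fin (m + 1)}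
    (h : coeff (i : ℕ) (famFun j p W' u) ≠ 0) : monoCoord K u i ∉ famPrime K hI := fun hmem => by
  have := famPrime_le_ker_famFun hI hW hmem
  rw [RingHom.mem_ker, IsJet.eval_monoCoord] at this
  exact h this

lemma monoCoord_mem_famPrime (hI : FamIndex C m s j a) {u : Γ} {i : Fin (m + 1)} {N : ℕ}
    (hi : (i : ℕ) < N)
    (h : (X : (FamRing C m s a K)⟦X⟧) ^ N ∣
      famFun j (famGen C m s a K) (famInv C m s a K) u) : monoCoord K u i ∈ famPrime K hI := by
  refine RingHom.mem_ker.2 ?_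
  rw [famEval, IsJet.eval_monoCoord]
  exact X_pow_dvd_iff.1 h _ hi

lemma monoCoord_center_notMem (hI : FamIndex C m s j a) (hs : 2 * s ≤ m) :
    monoCoord K (C.u (j + 1)) ⟨s, by omega⟩ ∉ famPrime K hI := by
  obtain ⟨W', hW', -⟩ := exists_famW_famPoint_inv (K := K) (C := C) (m := m) (s := s) (j := j) (a := a)
  refine monoCoord_notMem_famPrime hI hW' ?_
  rw [famFun, famChart_center hI, famTau, coeff_X_pow_mul_add (by simp only; omega),
    constantCoeff_famU_famPoint]
  exact one_ne_zero

lemma monoCoord_left_notMem (hI : FamIndex C m s j a) (ha : a + s < m + 1) :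
    monoCoord K (C.u j) ⟨a, by omega⟩ ∉ famPrime K hI := by
  obtain ⟨W', hW', -⟩ := exists_famW_famPoint_inv (K := K) (C := C) (m := m) (s := s) (j := j) (a := a)
  refine monoCoord_notMem_famPrime hI hW' ?_
  have hsa := hI.le_a
  have e : famTau (famPoint K C m s j a) * famEta (famPoint K C m s j a) =
      X ^ a * (famU (famPoint K C m s j a) * famW (famPoint K C m s j a)) := by
    have : (X : K⟦X⟧) ^ a = X ^ s * X ^ (a - s) := by rw [← pow_add, Nat.add_sub_of_le hsa]
    rw [this, famTau, famEta]; ring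
  rw [famFun, famChart_left hI, e, coeff_X_pow_mul_add (by simp only; omega), map_mul,
    constantCoeff_famU_famPoint, constantCoeff_famW_famPoint, one_mul]
  exact one_ne_zero

/-- The lower bound of `X_pow_dvd_famFun_right` is attained. The condition `s < a` ensures that
`famV` has a constant coefficient, which is needed when `s c > m + 1`. -/
lemma monoCoord_right_notMem (hI : FamIndex C m s j a) (ha : s < a)
    (hb : min (s * C.c (j + 1)) (m + 1) - a < m + 1) :
    monoCoord K (C.u (j + 2)) ⟨min (s * C.c (j + 1)) (m + 1) - a, hb⟩ ∉ famPrime K hI := by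
  obtain ⟨W', hW', hW'1⟩ :=
    exists_famW_famPoint_inv (K := K) (C := C) (m := m) (s := s) (j := j) (a := a)
  refine monoCoord_notMem_famPrime hI hW' ?_
  have ha1 := hI.a_le
  have ha' := hI.a_le'
  have h2 := Nat.le_mul_of_pos_right s (show 0 < C.c (j + 1) by have := C.two_le (j + 1); omega)
  rw [famFun, famChart_right hI, famTau, famXi]
  rw [Nat.mul_sub, mul_one] at ha1 ⊢
  set p := famPoint K C m s j a with hp
  rcases le_or_gt (s * C.c (j + 1)) (m + 1) with h | h
  · have hV : famV p = 0 := by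
      ext k
      simp [famV, finSeries, hp, famPoint, h.not_gt]
    have e : X ^ s * famU p * (X ^ (s * C.c (j + 1) - s - a) * famU p ^ (C.c (j + 1) - 2) * W' +
        X ^ (m + 1 - s - a) * famV p) =
        X ^ (min (s * C.c (j + 1)) (m + 1) - a) * (famU p ^ (C.c (j + 1) - 2) * famU p * W') := by
      rw [hV, min_eq_left h, show s * C.c (j + 1) - a = s + (s * C.c (j + 1) - s - a) by omega,
        pow_add]
      ring
    rw [e, coeff_X_pow_mul_add (by simp only; omega)]
    simp [hW'1, hp, constantCoeff_famU_famPoint]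
  · have hV : constantCoeff (famV p) = 1 := by
      simp [famV, finSeries, hp, famPoint, h, ← coeff_zero_eq_constantCoeff_apply, ha]
    have e : X ^ s * famU p * (X ^ (s * C.c (j + 1) - s - a) * famU p ^ (C.c (j + 1) - 2) * W' +
        X ^ (m + 1 - s - a) * famV p) =
        X ^ (min (s * C.c (j + 1)) (m + 1) - a) * (famU p * famV p +
          X ^ (s * C.c (j + 1) - (m + 1)) * famU p ^ (C.c (j + 1) - 2) * famU p * W') := by
      rw [min_eq_right h.le, show m + 1 - a = s + (m + 1 - s - a) by omega,
        show s * C.c (j + 1) - s - a = (m + 1 - s - a) + (s * C.c (j + 1) - (m + 1)) by omega,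
        pow_add, pow_add]
      ring
    rw [e, coeff_X_pow_mul_add (by simp only; omega)]
    rw [map_add, map_mul, hV]
    simp [hp, constantCoeff_famU_famPoint, (Nat.sub_pos_of_lt h).ne']

/-- Distinct canonical indices give incomparable primes. -/
lemma CanonIndex.eq_of_famPrime_le (hI : CanonIndex C m s j a) (hI' : CanonIndex C m s' j' a')
    (hn : 2 ≤ C.n ∨ s = s') (hle : famPrime K hI.toFamIndex ≤ famPrime K hI'.toFamIndex) :
    s = s' ∧ j = j' ∧ a = a' := by
  have h2s := hI.two_mul_le
  have h2s' := hI'.two_mul_le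
  have hsa := hI.le_a
  have hsa' := hI'.le_a
  have ha := hI.a_le'
  have ha' := hI'.a_le'
  have hj := hI.lt_n
  have hj' := hI'.lt_n
  rcases lt_trichotomy s s' with hss | rfl | hss
  -- Were the family with larger `s'` in the closure, it would be properly contained in it, since `u
  -- (j + 1)` has order `s` on the other family; its dimension is not smaller, a contradiction.
  · exfalso
    have hn2 : 2 ≤ C.n := hn.resolve_right hss.ne
    have h1 := trdeg_add_one_le (famEval K hI.toFamIndex) (famEval K hI'.toFamIndex) hle
      (x := monoCoord K (C.u (j + 1)) ⟨s, by omega⟩)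
      (monoCoord_mem_famPrime hI'.toFamIndex hss
        (X_pow_dvd_famFun hI'.toFamIndex (C.u_ne_zero (by omega))))
      (monoCoord_center_notMem hI.toFamIndex (by omega))
      (isAlgebraic_famRing hI'.toFamIndex)
    rw [trdeg_famRing, trdeg_famRing] at h1
    simp only [Fintype.card_sum, Fintype.card_prod, Fintype.card_fin] at h1
    have h2 : (m + 1 - 2 * s' + (m + 1 - s' - a') + (a' - s' + (C.n + 2) * s')) + 1 ≤
      m + 1 - 2 * s + (m + 1 - s - a) + (a - s + (C.n + 2) * s) := by exact_mod_cast h1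
    obtain ⟨d, hd⟩ : ∃ d, C.n = d + 2 := ⟨C.n - 2, by omega⟩
    rw [hd] at h2
    have h3 : d * s ≤ d * s' := Nat.mul_le_mul_left _ hss.le
    have h4 : (d + 2 + 2) * s = d * s + 4 * s := by ring
    have h5 : (d + 2 + 2) * s' = d * s' + 4 * s' := by ring
    omega
  · refine ⟨rfl, ?_⟩
    -- If `2 * s = m + 1`, the bounds force `a = s`, and the canonical choice leaves only `j = 0`.
    rcases Nat.lt_or_ge m (2 * s) with hs | hs
    · have := hI.canon
      have := hI'.canon
      omega
    rcases lt_trichotomy j j' with hjj | rfl | hjj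
    -- On the family `j` the generator `u (j' + 2)` has order at least `min (s (c - 1)) (m + 1 -
    -- s)`; on the family `j'` its order is smaller, because `a' > s`.
    · exfalso
      have hlt : s < a' := hI'.canon.resolve_left (by omega)
      have ha1' := hI'.a_le
      have h2 := Nat.le_mul_of_pos_right s
        (show 0 < C.c (j' + 1) by have := C.two_le (j' + 1); omega)
      rw [Nat.mul_sub, mul_one] at ha1'
      refine monoCoord_right_notMem (K := K) hI'.toFamIndex hlt (by omega)
        (hle (monoCoord_mem_famPrime hI.toFamIndex (Nat.lt_succ_self _)
          (X_pow_dvd_famFun_of_lt hjj hj' ?_ ?_)))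
      · rw [Nat.mul_sub, mul_one]; simp only; omega
      · simp only; omega
    · refine ⟨rfl, ?_⟩
      -- The orders of `u j` and of `u (j + 2)` vary in opposite directions with `a`, so each
      -- direction of inclusion is excluded by one of them.
      rcases lt_trichotomy a a' with haa | rfl | haa
      · exfalso
        have ha1' := hI'.a_le
        have h2 := Nat.le_mul_of_pos_right s
          (show 0 < C.c (j + 1) by have := C.two_le (j + 1); omega)
        rw [Nat.mul_sub, mul_one] at ha1'
        refine monoCoord_right_notMem (K := K) hI'.toFamIndex (by omega) (by omega)
          (hle (monoCoord_mem_famPrime hI.toFamIndex (Nat.lt_succ_self _)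
            (X_pow_dvd_famFun_right hI.toFamIndex ?_ ?_)))
        · simp only; omega
        · simp only; omega
      · rfl
      · exact absurd (hle (monoCoord_mem_famPrime hI.toFamIndex haa
          (X_pow_dvd_famFun_of_le hI.toFamIndex le_rfl)))
          (monoCoord_left_notMem hI'.toFamIndex (by omega))
    -- Here `u (j' + 1)` lies at or to the left of `u j`, hence has order at least `a > s` on the
    -- first family but order `s` on the second.
    · have hlt : s < a := hI.canon.resolve_left (by omega)
      exact absurd (hle (monoCoord_mem_famPrime hI.toFamIndex hlt
        (X_pow_dvd_famFun_of_le hI.toFamIndex (k := j' + 1) hjj)))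
        (monoCoord_center_notMem hI'.toFamIndex hs)
  · exact absurd (hle (monoCoord_mem_famPrime hI.toFamIndex hss
      (X_pow_dvd_famFun hI.toFamIndex (C.u_ne_zero (by omega)))))
      (monoCoord_center_notMem hI'.toFamIndex (by omega))

end Point

end ToricJets

/-! ### The hypersurface case: deformations of jets of `x y = z ^ c` -/

namespace ToricJets

universe w

section Factorization

open Polynomial

/-- A factorization of the reduction of a product of linear factors lifts. -/
lemma exists_add_of_prod_eq_mul {O D : Type*} [CommRing D] [IsDomain D] (π : O → D)
    (R : Multiset O) {f g : D[X]} (hf : f.Monic) (hg : g.Monic)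
    (h : (R.map fun r => X - C (π r)).prod = f * g) :
    ∃ R₁ R₂ : Multiset O, R = R₁ + R₂ ∧ (R₁.map fun r => X - C (π r)).prod = f ∧
      (R₂.map fun r => X - C (π r)).prod = g := by
  induction R using Multiset.induction_on generalizing f g with
  | empty =>
    rw [Multiset.map_zero, Multiset.prod_zero] at h
    refine ⟨0, 0, by simp, ?_, ?_⟩
    · simpa using (hf.eq_one_of_isUnit (IsUnit.of_mul_eq_one _ h.symm)).symm
    · simpa using (hg.eq_one_of_isUnit (IsUnit.of_mul_eq_one _ ((mul_comm g f).trans h.symm))).symm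
  | cons r R ih =>
    rw [Multiset.map_cons, Multiset.prod_cons] at h
    have h0 : (X - C (π r)) ≠ 0 := X_sub_C_ne_zero _
    rcases (prime_X_sub_C (π r)).dvd_or_dvd (Dvd.intro _ h) with ⟨f', rfl⟩ | ⟨g', rfl⟩
    · rw [mul_assoc] at h
      obtain ⟨R₁, R₂, rfl, h1, h2⟩ :=
        ih ((monic_X_sub_C _).of_mul_monic_left hf) hg (mul_left_cancel₀ h0 h)
      exact ⟨r ::ₘ R₁, R₂, by simp, by simp [h1], h2⟩
    · rw [mul_left_comm] at h
      obtain ⟨R₁, R₂, rfl, h1, h2⟩ :=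
        ih hf ((monic_X_sub_C _).of_mul_monic_left hg) (mul_left_cancel₀ h0 h)
      exact ⟨R₁, r ::ₘ R₂, by simp, h1, by simp [h2]⟩

/-- Roots of a monic polynomial are integral over its coefficient ring, so it splits before passing
to the field. -/
lemma exists_integral_roots {A Ω : Type*} [CommRing A] [Field Ω] [IsAlgClosed Ω] [Algebra A Ω]
    {H : A[X]} (hH : H.Monic) : ∃ R : Multiset (integralClosure A Ω),
      H.map (algebraMap A (integralClosure A Ω)) = (R.map fun r => X - C r).prod := by
  have hroot : ∀ r ∈ (H.map (algebraMap A Ω)).roots, r ∈ integralClosure A Ω := by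
    intro r hr
    have := (mem_roots (hH.map (algebraMap A Ω)).ne_zero).1 hr
    exact ⟨H, hH, by rwa [IsRoot, eval_map] at this⟩
  obtain ⟨R, hR⟩ : ∃ R : Multiset (integralClosure A Ω),
      R.map (algebraMap _ Ω) = (H.map (algebraMap A Ω)).roots :=
    ⟨(H.map (algebraMap A Ω)).roots.pmap Subtype.mk hroot, by
      rw [Multiset.map_pmap]; exact (Multiset.pmap_eq_map _ _ _ _).trans (Multiset.map_id _)⟩
  refine ⟨R, map_injective (algebraMap (integralClosure A Ω) Ω) Subtype.coe_injective ?_⟩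
  rw [Polynomial.map_map, ← IsScalarTower.algebraMap_eq,
    (IsAlgClosed.splits _).eq_prod_roots_of_monic (hH.map (algebraMap A Ω)), ← hR,
    Polynomial.map_multiset_prod, Multiset.map_map, Multiset.map_map]
  congr 1
  refine Multiset.map_congr rfl fun r _ => ?_
  simp

/-- Take `a` to be the order of `x`, but at most `c - 1`, so that both factors keep at least one
power of the variable. -/
lemma exists_exponents {L : Type*} [Field L] {c : ℕ} (hc : 2 ≤ c) {x y : L[X]} (hx0 : x ≠ 0)
    (hx : X ∣ x) (hy : X ∣ y) (hxy : X ^ c ∣ x * y) :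
    ∃ a b, 1 ≤ a ∧ 1 ≤ b ∧ a + b = c ∧ X ^ a ∣ x ∧ X ^ b ∣ y := by
  obtain ⟨x', hx', hx'X⟩ := exists_eq_pow_rootMultiplicity_mul_and_not_dvd x hx0 0
  rw [C_0, sub_zero] at hx' hx'X
  set p := rootMultiplicity 0 x
  have hp : 1 ≤ p := by
    by_contra! h
    rw [Nat.lt_one_iff.1 h, pow_zero, one_mul] at hx'
    exact hx'X (hx' ▸ hx)
  have hxp : X ^ p ∣ x := ⟨x', hx'⟩
  rcases Nat.lt_or_ge p (c - 1) with h | h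
  · refine ⟨p, c - p, hp, by omega, by omega, hxp, ?_⟩
    rw [hx', mul_assoc, show c = p + (c - p) by omega, pow_add,
      mul_dvd_mul_iff_left (pow_ne_zero _ X_ne_zero)] at hxy
    exact prime_X.pow_dvd_of_dvd_mul_left _ hx'X hxy
  · exact ⟨c - 1, 1, by omega, le_rfl, by omega, (pow_dvd_pow _ h).trans hxp, by rwa [pow_one]⟩

/-- A jet `x y = z ^ c` with polynomial coordinates deforms together with `z + λ X`. -/
lemma exists_polynomial_deformation {L : Type w} [Field L] {c m : ℕ} (hc : 2 ≤ c) (hcm : c ≤ m)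
    {x y z : L[X]} (hx : x.Monic) (hy : y.Monic) (hz : z.natDegree ≤ m)
    (hdeg : c * m < x.natDegree + y.natDegree) (hXx : X ∣ x) (hXy : X ∣ y) (hXz : X ∣ z)
    (hxyz : X ^ (m + 1) ∣ x * y - z ^ c) :
    ∃ (O : Type w) (_ : CommRing O) (_ : IsDomain O) (D : Type w) (_ : Field D)
      (i : L →+* O) (π : O →+* D) (μ : O) (x' y' : O[X]), μ ≠ 0 ∧ π μ = 0 ∧ X ∣ x' ∧ X ∣ y' ∧
      x'.map π = x.map (π.comp i) ∧ y'.map π = y.map (π.comp i) ∧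
      X ^ (m + 1) ∣ x' * y' - (z.map i + C μ * X) ^ c := by
  -- The inner variable of `L[X][X]` is the deformation parameter `λ`. `O` is the integral closure
  -- of `L[λ]` in an algebraically closed field, and a maximal ideal `Q` of `O` above `(λ)` gives
  -- the specialization `λ = 0`.
  let Ω := AlgebraicClosure (FractionRing L[X])
  let O := integralClosure L[X] Ω
  have hinj : Function.Injective (algebraMap L[X] O) := by
    have h1 : Function.Injective (algebraMap L[X] Ω) := by
      rw [IsScalarTower.algebraMap_eq L[X] (FractionRing L[X]) Ω]
      exact (algebraMap (FractionRing L[X]) Ω).injective.comp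
        (IsFractionRing.injective L[X] (FractionRing L[X]))
    exact fun p q h => h1 (congrArg Subtype.val h)
  have hmax : (Ideal.span {(X : L[X])}).IsMaximal :=
    PrincipalIdealRing.isMaximal_of_irreducible irreducible_X
  obtain ⟨Q, hQ, hQc⟩ := Ideal.exists_ideal_over_maximal_of_isIntegral (S := O)
    (Ideal.span {(X : L[X])}) (by
      rw [(RingHom.injective_iff_ker_eq_bot _).1 hinj]; exact bot_le)
  let _ : Field (O ⧸ Q) := Ideal.Quotient.field Q
  let π : O →+* O ⧸ Q := Ideal.Quotient.mk Q
  let i : L →+* O := (algebraMap L[X] O).comp C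
  let μ : O := algebraMap L[X] O X
  have hμ : π μ = 0 := by
    refine Ideal.Quotient.eq_zero_iff_mem.2 ?_
    have : (X : L[X]) ∈ Ideal.comap (algebraMap L[X] O) Q := by
      rw [hQc]; exact Ideal.mem_span_singleton_self _
    exact this
  -- `G` is what `x y` must become when `z` moves to `z + λ X`. The degree hypothesis keeps it
  -- monic, it remains divisible by `X ^ c`, and at `λ = 0` it is `x y`.
  let G : L[X][X] := (x * y).map C + ((z.map C + C X * X) ^ c - (z.map C) ^ c)
  have hGm : G.Monic := by
    refine ((hx.mul hy).map _).add_of_left ?_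
    refine degree_lt_degree ?_
    rw [(hx.mul hy).natDegree_map, hx.natDegree_mul hy]
    refine lt_of_le_of_lt ?_ hdeg
    have h1 : (z.map C : L[X][X]).natDegree ≤ m := natDegree_map_le.trans hz
    have h2 : (C X * X : L[X][X]).natDegree ≤ m :=
      (natDegree_C_mul_le _ _).trans (natDegree_X_le.trans (by omega))
    have h3 := natDegree_sub_le_of_le
      (natDegree_pow_le_of_le c (natDegree_add_le_of_le h1 h2)) (natDegree_pow_le_of_le c h1)
    simpa using h3
  have hGe : G = (x * y - z ^ c).map C + (z.map C + C X * X) ^ c := by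
    simp only [G, Polynomial.map_sub, Polynomial.map_pow]; ring
  have hGX : X ^ c ∣ G := by
    rw [hGe]
    refine dvd_add ?_ (pow_dvd_pow_of_dvd (dvd_add ?_ (dvd_mul_left _ _)) c)
    · have := Polynomial.map_dvd C ((pow_dvd_pow X (by omega : c ≤ m + 1)).trans hxyz)
      simpa using this
    · simpa using Polynomial.map_dvd C hXz
  obtain ⟨H, hH⟩ := hGX
  have hHm : H.Monic := (monic_X_pow c).of_mul_monic_left (hH ▸ hGm)
  obtain ⟨R, hR⟩ := exists_integral_roots (Ω := Ω) hHm
  -- The factor `X ^ c` is shared between `x` and `y` so that both deformed factors still vanish at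
  -- the origin.
  obtain ⟨a, b, ha, hb, hab, ⟨x₁, hx₁⟩, ⟨y₁, hy₁⟩⟩ := exists_exponents hc hx.ne_zero hXx hXy (by
    have h1 : X ^ c ∣ z ^ c := pow_dvd_pow_of_dvd hXz c
    have := dvd_add ((pow_dvd_pow X (by omega : c ≤ m + 1)).trans hxyz) h1
    simpa using this)
  have hx₁m : x₁.Monic := (monic_X_pow a).of_mul_monic_left (hx₁ ▸ hx)
  have hy₁m : y₁.Monic := (monic_X_pow b).of_mul_monic_left (hy₁ ▸ hy)
  have hHD : (R.map fun r => X - C (π r)).prod = x₁.map (π.comp i) * y₁.map (π.comp i) := by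
    have h1 : (R.map fun r => X - C (π r)).prod =
        (H.map (algebraMap L[X] O)).map π := by
      rw [hR, Polynomial.map_multiset_prod, Multiset.map_map]
      congr 1
      refine Multiset.map_congr rfl fun r _ => ?_
      simp
    have h2 : (G.map (algebraMap L[X] O)).map π = (x * y).map (π.comp i) := by
      simp only [G, Polynomial.map_add, Polynomial.map_sub, Polynomial.map_pow, Polynomial.map_mul,
        map_C, map_X, Polynomial.map_map]
      rw [show π ((algebraMap L[X] O) X) = 0 from hμ, C_0, zero_mul, add_zero, sub_self, add_zero]
    refine mul_left_cancel₀ (pow_ne_zero c (X_ne_zero (R := O ⧸ Q))) ?_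
    rw [h1, ← Polynomial.map_mul, ← hab]
    rw [hH, ← hab, hx₁, hy₁] at h2
    simp only [Polynomial.map_mul, Polynomial.map_pow, map_X] at h2 ⊢
    rw [h2]; ring
  -- The roots of the cofactor are distributed according to the factorization modulo `Q`; the
  -- resulting factors over `O` deform `x` and `y`.
  obtain ⟨R₁, R₂, hRR, hR₁, hR₂⟩ :=
    exists_add_of_prod_eq_mul π R (hx₁m.map _) (hy₁m.map _) hHD
  have hred : ∀ R : Multiset O, ((R.map fun r => X - C r).prod).map π =
      (R.map fun r => X - C (π r)).prod := by
    intro R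
    rw [Polynomial.map_multiset_prod, Multiset.map_map]
    congr 1
    refine Multiset.map_congr rfl fun r _ => ?_
    simp
  refine ⟨O, inferInstance, inferInstance, O ⧸ Q, inferInstance, i, π, μ,
    X ^ a * (R₁.map fun r => X - C r).prod, X ^ b * (R₂.map fun r => X - C r).prod, ?_, hμ,
    (dvd_pow_self _ (by omega)).mul_right _, (dvd_pow_self _ (by omega)).mul_right _, ?_, ?_, ?_⟩
  · exact fun h0 => X_ne_zero (hinj (h0.trans (map_zero _).symm))
  · rw [Polynomial.map_mul, hred, hR₁, hx₁]; simp
  · rw [Polynomial.map_mul, hred, hR₂, hy₁]; simp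
  · have e : X ^ a * (R₁.map fun r => X - C r).prod * (X ^ b * (R₂.map fun r => X - C r).prod) =
        G.map (algebraMap L[X] O) := by
      rw [hH, Polynomial.map_mul, hR, hRR, Multiset.map_add, Multiset.prod_add, ← hab]
      simp only [Polynomial.map_pow, map_X]
      ring
    have e2 : G.map (algebraMap L[X] O) - (z.map i + C μ * X) ^ c = (x * y - z ^ c).map i := by
      rw [hGe]
      simp only [Polynomial.map_add, Polynomial.map_sub, Polynomial.map_pow, Polynomial.map_mul,
        map_C, map_X, Polynomial.map_map]
      rw [show (algebraMap L[X] O).comp C = i from rfl, show algebraMap L[X] O X = μ from rfl]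
      ring
    rw [e, e2]
    simpa using Polynomial.map_dvd i hxyz

end Factorization

section Specialization

open PowerSeries

variable {L : Type w} [Field L]

lemma X_pow_dvd_sub_coe_trunc (N : ℕ) (f : L⟦X⟧) :
    (X : L⟦X⟧) ^ N ∣ f - (trunc N f : Polynomial L) := by
  rw [X_pow_dvd_iff]
  intro k hk
  rw [map_sub, Polynomial.coeff_coe, coeff_trunc, if_pos hk, sub_self]

lemma X_pow_dvd_coe_iff {A : Type*} [CommRing A] {N : ℕ} {f : Polynomial A} :
    (X : A⟦X⟧) ^ N ∣ (f : A⟦X⟧) ↔ Polynomial.X ^ N ∣ f := by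
  rw [X_pow_dvd_iff, Polynomial.X_pow_dvd_iff]
  simp only [Polynomial.coeff_coe]

/-- A jet `x y = z ^ c` with `ord z ≥ 2` is a specialization of jets with `ord z = 1`. -/
lemma exists_series_deformation {c m : ℕ} (hc : 2 ≤ c) {x y z : L⟦X⟧}
    (hx : X ∣ x) (hy : X ∣ y) (hz : X ^ 2 ∣ z) (hxyz : (X : L⟦X⟧) ^ (m + 1) ∣ x * y - z ^ c) :
    ∃ (O : Type w) (_ : CommRing O) (_ : IsDomain O) (D : Type w) (_ : Field D)
      (i : L →+* O) (π : O →+* D) (x' y' z' : O⟦X⟧), X ∣ x' ∧ X ∣ y' ∧ X ∣ z' ∧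
      coeff 1 z' ≠ 0 ∧ (X : O⟦X⟧) ^ (m + 1) ∣ x' * y' - z' ^ c ∧
      (X : D⟦X⟧) ^ (m + 1) ∣ PowerSeries.map π x' - PowerSeries.map (π.comp i) x ∧
      (X : D⟦X⟧) ^ (m + 1) ∣ PowerSeries.map π y' - PowerSeries.map (π.comp i) y ∧
      (X : D⟦X⟧) ^ (m + 1) ∣ PowerSeries.map π z' - PowerSeries.map (π.comp i) z := by
  have hz1 : X ∣ z := (dvd_pow_self X two_ne_zero).trans hz
  have hcoeff : coeff 1 z = 0 := X_pow_dvd_iff.1 hz 1 (by norm_num)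
  -- For `m < c` the power `z ^ c` vanishes modulo `X ^ (m + 1)`, so `z` can move while `x` and `y`
  -- stay fixed. Only `m ≥ c` requires factorization.
  rcases Nat.lt_or_ge m c with hmc | hcm
  · have hzc : (X : L⟦X⟧) ^ (m + 1) ∣ z ^ c :=
      (pow_dvd_pow _ hmc).trans (pow_dvd_pow_of_dvd hz1 c)
    have hxy : (X : L⟦X⟧) ^ (m + 1) ∣ x * y := by simpa using dvd_add hxyz hzc
    have hmap : ∀ {f : L⟦X⟧} {N : ℕ}, (X : L⟦X⟧) ^ N ∣ f →
        (X : (Polynomial L)⟦X⟧) ^ N ∣ PowerSeries.map Polynomial.C f := fun h => by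
      simpa using map_dvd (PowerSeries.map Polynomial.C) h
    have hid : (Polynomial.evalRingHom (0 : L)).comp Polynomial.C = RingHom.id L := by
      ext a; simp
    have hred : ∀ f : L⟦X⟧, PowerSeries.map (Polynomial.evalRingHom (0 : L))
        (PowerSeries.map Polynomial.C f) = f := by
      intro f; ext k; simp
    have hz' : X ∣ PowerSeries.map Polynomial.C z +
        PowerSeries.C (Polynomial.X : Polynomial L) * X :=
      dvd_add (by simpa using hmap (N := 1) (by rwa [pow_one])) (dvd_mul_left _ _)
    refine ⟨Polynomial L, inferInstance, inferInstance, L, inferInstance, Polynomial.C,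
      Polynomial.evalRingHom 0, PowerSeries.map Polynomial.C x, PowerSeries.map Polynomial.C y,
      PowerSeries.map Polynomial.C z + PowerSeries.C Polynomial.X * X, ?_, ?_, hz', ?_, ?_, ?_, ?_,
      ?_⟩
    · simpa using hmap (N := 1) (by rwa [pow_one])
    · simpa using hmap (N := 1) (by rwa [pow_one])
    · rw [map_add, coeff_map, hcoeff, map_zero, zero_add, coeff_C_mul, coeff_one_X, mul_one]
      exact Polynomial.X_ne_zero
    · refine dvd_sub ?_ ((pow_dvd_pow _ hmc).trans (pow_dvd_pow_of_dvd hz' c))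
      rw [← map_mul]; exact hmap hxy
    · rw [hred, hid]; simp
    · rw [hred, hid]; simp
    · rw [map_add, hred, hid]; simp
  -- A leading term `X ^ N`, invisible modulo `X ^ (m + 1)`, makes the truncations of `x` and `y`
  -- monic of degree large enough to dominate `(z + λ X) ^ c`.
  · set N := c * m + m + 1 with hN
    have hdeg : ∀ f : L⟦X⟧, (trunc (m + 1) f).degree < (N : WithBot ℕ) := fun f =>
      (degree_trunc_lt f (m + 1)).trans_le (by
        have : m + 1 ≤ N := by omega
        exact_mod_cast this)
    have hmonic : ∀ f : L⟦X⟧, (Polynomial.X ^ N + trunc (m + 1) f).Monic := fun f =>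
      Polynomial.monic_X_pow_add (hdeg f)
    have hnat : ∀ f : L⟦X⟧, (Polynomial.X ^ N + trunc (m + 1) f).natDegree = N := fun f => by
      rw [Polynomial.natDegree_add_eq_left_of_degree_lt
        (by rw [Polynomial.degree_X_pow]; exact hdeg f), Polynomial.natDegree_X_pow]
    have hclose : ∀ f : L⟦X⟧, (X : L⟦X⟧) ^ (m + 1) ∣
        f - (Polynomial.X ^ N + trunc (m + 1) f : Polynomial L) := fun f => by
      rw [Polynomial.coe_add, Polynomial.coe_pow, Polynomial.coe_X, ← sub_sub, sub_right_comm]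
      exact dvd_sub (X_pow_dvd_sub_coe_trunc _ _) (pow_dvd_pow _ (by omega))
    have hX : ∀ {f g : L⟦X⟧}, X ∣ f → (X : L⟦X⟧) ^ (m + 1) ∣ f - g → X ∣ g := fun hf hfg => by
      have := dvd_sub hf ((dvd_pow_self X (Nat.succ_ne_zero m)).trans hfg)
      rwa [sub_sub_cancel] at this
    have hXp : ∀ {f : L⟦X⟧} {g : Polynomial L}, X ∣ f → (X : L⟦X⟧) ^ (m + 1) ∣ f - g →
        Polynomial.X ∣ g := fun {f g} hf hfg => by
      have := hX hf hfg
      rw [← pow_one (X : L⟦X⟧), X_pow_dvd_coe_iff, pow_one] at this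
      exact this
    have hpoly : Polynomial.X ^ (m + 1) ∣ (Polynomial.X ^ N + trunc (m + 1) x) *
        (Polynomial.X ^ N + trunc (m + 1) y) - (trunc (m + 1) z) ^ c := by
      rw [← X_pow_dvd_coe_iff, Polynomial.coe_sub, Polynomial.coe_mul, Polynomial.coe_pow]
      have e1 := (hclose x).mul_right y
      have e2 := (hclose y).mul_left ((Polynomial.X ^ N + trunc (m + 1) x : Polynomial L) : L⟦X⟧)
      have e3 := (X_pow_dvd_sub_coe_trunc (m + 1) z).trans
        (sub_dvd_pow_sub_pow z (trunc (m + 1) z : Polynomial L) c)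
      have := dvd_add (dvd_sub (dvd_sub hxyz e1) e2) e3
      convert this using 1
      ring
    obtain ⟨O, _, _, D, _, i, π, μ, x', y', hμ, hμ0, hx', hy', hxx', hyy', hrel⟩ :=
      exists_polynomial_deformation hc hcm (hmonic x) (hmonic y)
        (Nat.le_of_lt_succ (natDegree_trunc_lt z m))
        (by rw [hnat, hnat]; omega) (hXp hx (hclose x)) (hXp hy (hclose y))
        (hXp hz1 (X_pow_dvd_sub_coe_trunc _ z)) hpoly
    have hred : ∀ {f : L⟦X⟧} {f' : Polynomial O} {g : Polynomial L},
        (X : L⟦X⟧) ^ (m + 1) ∣ f - g → f'.map π = g.map (π.comp i) →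
        (X : D⟦X⟧) ^ (m + 1) ∣ PowerSeries.map π f' - PowerSeries.map (π.comp i) f := by
      intro f f' g hfg hfg'
      rw [← Polynomial.polynomial_map_coe, hfg', Polynomial.polynomial_map_coe, ← map_sub,
        ← neg_sub f, map_neg, dvd_neg]
      simpa using map_dvd (PowerSeries.map (π.comp i)) hfg
    have hXc : ∀ {f : Polynomial O}, Polynomial.X ∣ f → (X : O⟦X⟧) ∣ f := fun {f} h => by
      rw [← pow_one (X : O⟦X⟧), X_pow_dvd_coe_iff, pow_one]; exact h
    refine ⟨O, inferInstance, inferInstance, D, inferInstance, i, π, x', y',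
      ((trunc (m + 1) z).map i + Polynomial.C μ * Polynomial.X : Polynomial O), hXc hx', hXc hy',
      hXc ?_, ?_, ?_, hred (hclose x) hxx', hred (hclose y) hyy',
      hred (X_pow_dvd_sub_coe_trunc _ z) ?_⟩
    · refine dvd_add ?_ (dvd_mul_left _ _)
      simpa using Polynomial.map_dvd i (hXp hz1 (X_pow_dvd_sub_coe_trunc (m + 1) z))
    · rw [Polynomial.coeff_coe, Polynomial.coeff_add, Polynomial.coeff_map, coeff_trunc, hcoeff]
      simpa using hμ
    · rw [← Polynomial.coe_mul, ← Polynomial.coe_pow, ← Polynomial.coe_sub, X_pow_dvd_coe_iff]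
      exact hrel
    · rw [Polynomial.map_add, Polynomial.map_map, Polynomial.map_mul, Polynomial.map_C, hμ0]
      simp

variable {Γ : Type*} [AddCommMonoid Γ] {C : HJChain Γ} {m : ℕ} {K : Type*} [Field K] [Algebra K L]
  {φ : Γ → L⟦X⟧}

/-- A jet over a domain which specializes to `φ` gives a jet over a field specializing to `φ`. -/
lemma IsJet.exists_field_specialization (hφ : IsJet m φ) {O : Type w} [CommRing O] [IsDomain O]
    {D : Type w} [Field D] (i : L →+* O) (π : O →+* D) {Φ : Γ → O⟦X⟧} (hΦ : IsJet m Φ)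
    (h : ∀ k ≤ C.n + 1, (X : D⟦X⟧) ^ (m + 1) ∣
      PowerSeries.map π (Φ (C.u k)) - PowerSeries.map (π.comp i) (φ (C.u k))) :
    ∃ (L' : Type w) (_ : Field L') (_ : Algebra K L') (inc : O →+* L'),
      Function.Injective inc ∧
      RingHom.ker ((hΦ.map inc).eval K) ≤ RingHom.ker (hφ.eval K) := by
  let _ : Algebra K O := (i.comp (algebraMap K L)).toAlgebra
  let _ : Algebra K D := ((π.comp i).comp (algebraMap K L)).toAlgebra
  let inc : O →ₐ[K] FractionRing O := IsScalarTower.toAlgHom K O (FractionRing O)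
  have hinc : Function.Injective inc := IsFractionRing.injective O (FractionRing O)
  let πₐ : O →ₐ[K] D := { π with commutes' := fun _ => rfl }
  let j : L →ₐ[K] D := { π.comp i with commutes' := fun _ => rfl }
  refine ⟨FractionRing O, inferInstance, inferInstance, (inc : O →+* FractionRing O), hinc, ?_⟩
  have h1 : (hΦ.map (πₐ : O →+* D)).eval K = (hφ.map (j : L →+* D)).eval K :=
    IsJet.eval_congr _ _ ((hΦ.map _).close_of_gens C (hφ.map _) h)
  rw [hΦ.eval_map πₐ, hφ.eval_map j] at h1
  intro g hg
  have h2 : (hΦ.map (inc : O →+* FractionRing O)).eval K g = 0 := hg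
  rw [hΦ.eval_map inc, AlgHom.comp_apply] at h2
  have h3 : hΦ.eval K g = 0 := hinc (h2.trans (_root_.map_zero inc).symm)
  have h4 := DFunLike.congr_fun h1 g
  rw [AlgHom.comp_apply, AlgHom.comp_apply, h3, _root_.map_zero] at h4
  exact RingHom.mem_ker.2 ((map_eq_zero_iff j (j : L →+* D).injective).1 h4.symm)

/-- Jets of `x y = z ^ c`. -/
lemma exists_isJet_of_rel {A : Type*} [CommRing A] (hn : C.n = 1) {x y z : A⟦X⟧}
    (h : (X : A⟦X⟧) ^ (m + 1) ∣ x * y - z ^ C.c 1) :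
    ∃ φ : Γ → A⟦X⟧, IsJet m φ ∧ φ (C.u 0) = x ∧ φ (C.u 1) = z ∧ φ (C.u 2) = y := by
  have hrel : ∀ u, -C.b 2 u + C.c 1 * C.b 1 u = C.b 0 u := fun u => by
    have := C.b_rel 0 (by omega) u
    rw [zero_add] at this
    linarith
  have hlast : ∀ u, C.b 2 u ≤ 0 := fun u => by
    have := C.b_last_nonpos u; rwa [hn] at this
  -- For `n = 1` the whole surface is one chart: `τ = z`, the exponents of `z` in the two branches
  -- are `-b 2` and `-b 2 + c b 1 = b 0`, and the chart equation is `x y = z ^ c` itself.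
  refine ⟨chartFun (C.b 1) (-C.b 2) (C.c 1) z y x, ⟨by simp [chartFun_zero], fun u v =>
    dvd_chartFun_add_sub_mul (fun u => ?_) (fun u => ?_) (fun u v _ _ => ?_) u v⟩, ?_, ?_, ?_⟩
  · simpa using hlast u
  · rw [AddMonoidHom.neg_apply, hrel]; exact C.b_zero_nonneg u
  · rw [mul_comm y]; exact h.mul_left _
  · have h1 := C.b_pred 0 (by omega)
    have h2 := hrel (C.u 0)
    rw [C.b_self 0 (by omega)] at h2
    rw [zero_add] at h1
    rw [chartFun, if_neg (by omega), AddMonoidHom.neg_apply, h2, h1]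
    simp
  · have h1 := C.b_self 1 (by omega)
    have h2 := C.b_pred 1 (by omega)
    rw [chartFun, if_pos (by omega), AddMonoidHom.neg_apply, h1, h2]
    simp
  · have h1 : C.b 1 (C.u 2) = 1 := C.b_succ 1 (by omega)
    have h2 := C.b_self 2 (by omega)
    rw [chartFun, if_pos (by omega), AddMonoidHom.neg_apply, h1, h2]
    simp

/-- For a hypersurface `x y = z ^ c`, the families with `s = 1` suffice. -/
lemma exists_famPrime_le_of_n_eq_one (hn : C.n = 1) (hm : 1 ≤ m) (hφ : IsJet m φ)
    (hd : ∀ k ≤ C.n + 1, (X : L⟦X⟧) ∣ φ (C.u k)) :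
    ∃ (j a : ℕ) (hI : CanonIndex C m 1 j a),
      famPrime K hI.toFamIndex ≤ RingHom.ker (hφ.eval K) := by
  rcases Nat.lt_or_ge m 2 with h2 | h2
  · obtain ⟨s, j, a, hI, hle⟩ := exists_famPrime_le (K := K) hm hφ hd
    have h3 := hI.one_le
    have h4 := hI.two_mul_le
    obtain rfl : s = 1 := by omega
    exact ⟨j, a, hI, hle⟩
  by_cases hz : (X : L⟦X⟧) ^ 2 ∣ φ (C.u 1)
  · obtain ⟨O, _, _, D, _, i, π, x', y', z', hx', hy', hz', hz1, hrel, hxx, hyy, hzz⟩ :=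
      exists_series_deformation (C.two_le 1) (hd 0 (by omega)) (hd 2 (by omega)) hz
        (hφ.rel C (j := 0) (by omega))
    obtain ⟨Φ, hΦ, h0, h1, h2'⟩ := exists_isJet_of_rel hn hrel
    have hgens : ∀ {P : ℕ → Prop}, P 0 → P 1 → P 2 → ∀ k ≤ C.n + 1, P k := by
      intro P p0 p1 p2 k hk
      rw [hn] at hk
      interval_cases k <;> assumption
    obtain ⟨L', _, _, inc, hinc, hle⟩ := hφ.exists_field_specialization (K := K) (C := C) i π hΦ
      (hgens (by rw [h0]; exact hxx) (by rw [h1]; exact hzz) (by rw [h2']; exact hyy))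
    have hdΦ : ∀ k ≤ C.n + 1, X ∣ Φ (C.u k) :=
      hgens (by rwa [h0]) (by rwa [h1]) (by rwa [h2'])
    obtain ⟨j, a, hI, hle'⟩ := exists_famPrime_le_of_order (K := K) le_rfl (by omega)
      (hΦ.map inc) (C := C) (fun k hk => by
        simpa using map_dvd (PowerSeries.map inc) (hdΦ k hk))
      ⟨1, by omega, fun hcon => hz1 (hinc (by
        have := X_pow_dvd_iff.1 hcon 1 (by norm_num)
        rwa [coeff_map, h1, ← map_zero inc] at this))⟩
    exact ⟨j, a, hI, hle'.trans hle⟩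
  · exact exists_famPrime_le_of_order (K := K) le_rfl (by omega) hφ
      (fun k hk => by rw [pow_one]; exact hd k hk) ⟨1, by omega, hz⟩

end Specialization

end ToricJets

/-! ### Irreducible components of the fibre and the fibre of `1`-jets -/

namespace ToricJets

section Topology

/-- A space covered by the closures of finitely many points, none of which lies in the closure of
another. -/
lemma irreducibleComponents_eq_range {X ι : Type*} [TopologicalSpace X] [Finite ι] (g : ι → X)
    (hcov : ∀ x, ∃ i, x ∈ closure {g i}) (hanti : ∀ i j, g j ∈ closure {g i} → i = j) :
    irreducibleComponents X = Set.range fun i => closure {g i} := by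
  classical
  have hsub : ∀ T : Set X, IsIrreducible T → ∃ i, T ⊆ closure {g i} := by
    intro T hT
    obtain ⟨_, hz, hTz⟩ := isIrreducible_iff_sUnion_isClosed.1 hT
      (Set.finite_range fun i => closure {g i}).toFinset
      (by
        intro z hz
        obtain ⟨i, rfl⟩ := (Set.Finite.mem_toFinset _).1 hz
        exact isClosed_closure)
      (fun x _ => by
        obtain ⟨i, hi⟩ := hcov x
        exact ⟨_, by simp, hi⟩)
    obtain ⟨i, rfl⟩ := (Set.Finite.mem_toFinset _).1 hz
    exact ⟨i, hTz⟩
  ext T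
  constructor
  · intro hT
    obtain ⟨i, hi⟩ := hsub T hT.prop
    exact ⟨i, (hT.le_of_ge isIrreducible_singleton.closure hi).antisymm hi⟩
  · rintro ⟨i, rfl⟩
    refine ⟨isIrreducible_singleton.closure, fun T hT hle => ?_⟩
    obtain ⟨j, hj⟩ := hsub T hT
    obtain rfl := hanti j i (hj (hle (subset_closure rfl)))
    exact hj

lemma ncard_irreducibleComponents {X ι : Type*} [TopologicalSpace X] [Finite ι] (g : ι → X)
    (hcov : ∀ x, ∃ i, x ∈ closure {g i}) (hanti : ∀ i j, g j ∈ closure {g i} → i = j) :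
    (irreducibleComponents X).ncard = Nat.card ι := by
  have hinj : Function.Injective fun i => closure {g i} := fun i j hij =>
    hanti i j (by rw [show closure {g i} = closure {g j} from hij]; exact subset_closure rfl)
  rw [irreducibleComponents_eq_range g hcov hanti, ← Set.image_univ,
    Set.ncard_image_of_injective _ hinj, Set.ncard_univ]

lemma mem_closure_singleton_subtype {R : Type*} [CommRing R] {Z : Set (PrimeSpectrum R)}
    {P Q : Z} : Q ∈ closure {P} ↔ P.1.asIdeal ≤ Q.1.asIdeal := by
  rw [closure_subtype, Set.image_singleton, ← PrimeSpectrum.le_iff_mem_closure]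
  rfl

end Topology

section Points

open PowerSeries

universe v w

variable {K : Type v} [Field K] {m : ℕ}

/-- Every point of the jet scheme is the kernel of a jet over a field. -/
lemma exists_isJet_ker_eval_eq {Γ : Type w} [AddCommMonoid Γ]
    (P : Ideal (JetAlgebra K (AddMonoidAlgebra K Γ) m)) [P.IsPrime] :
    ∃ (L : Type max v w) (_ : Field L) (_ : Algebra K L) (φ : Γ → L⟦X⟧) (hφ : IsJet m φ),
      RingHom.ker (hφ.eval K) = P := by
  let _ : Algebra K P.ResidueField :=
    ((algebraMap (JetAlgebra K (AddMonoidAlgebra K Γ) m) P.ResidueField).comp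
      (algebraMap K _)).toAlgebra
  obtain ⟨φ, hφ, h⟩ := exists_isJet (K := K)
    ({ algebraMap (JetAlgebra K (AddMonoidAlgebra K Γ) m) P.ResidueField with
      commutes' := fun _ => rfl } :
        JetAlgebra K (AddMonoidAlgebra K Γ) m →ₐ[K] P.ResidueField)
  refine ⟨P.ResidueField, inferInstance, inferInstance, φ, hφ, ?_⟩
  rw [h]
  exact Ideal.ker_algebraMap_residueField P

variable {p q : ℕ}

/-- Modulo the nonconstant monomials every element is a constant, so the ideal is maximal. -/
lemma eq_originIdeal {J : Ideal (ToricRing K p q)} (hJ : J ≠ ⊤) (h : originIdeal K p q ≤ J) :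
    J = originIdeal K p q := by
  have key : ∀ f : ToricRing K p q,
      f - AddMonoidAlgebra.single 0 (f.coeff 0) ∈ originIdeal K p q := by
    intro f
    induction f using AddMonoidAlgebra.induction_linear with
    | zero => simp
    | add f g hf hg =>
      have := Ideal.add_mem _ hf hg
      simp only [AddMonoidAlgebra.coeff_add, Finsupp.add_apply, AddMonoidAlgebra.single_add]
      convert this using 1
      abel
    | single u a =>
      rcases eq_or_ne u 0 with rfl | hu
      · simp
      · have h1 : AddMonoidAlgebra.single u (1 : K) ∈ originIdeal K p q :=
          Ideal.subset_span ⟨u, hu, rfl⟩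
        have h2 := Ideal.mul_mem_left _ (AddMonoidAlgebra.single 0 a) h1
        simpa [AddMonoidAlgebra.single_mul_single, hu] using h2
  refine le_antisymm (fun f hf => ?_) h
  have h1 : AddMonoidAlgebra.single 0 (f.coeff 0) ∈ J := by
    have := J.sub_mem hf (h (key f))
    rwa [sub_sub_cancel] at this
  have h2 : f.coeff 0 = 0 := by
    by_contra h0
    refine hJ ((Ideal.eq_top_iff_one J).2 ?_)
    have := J.mul_mem_left (AddMonoidAlgebra.single 0 (f.coeff 0)⁻¹) h1
    rw [AddMonoidAlgebra.single_mul_single, inv_mul_cancel₀ h0] at this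
    simpa [AddMonoidAlgebra.one_def] using this
  have := key f
  rwa [h2, AddMonoidAlgebra.single_zero, sub_zero] at this

lemma mem_jetFiber {P : PrimeSpectrum (JetAlgebra K (ToricRing K p q) m)} :
    P ∈ jetFiber K p q m ↔ ∀ u : dualSemigroup p q, u ≠ 0 → monoCoord K u 0 ∈ P.asIdeal := by
  constructor
  · intro h u hu
    have h1 : AddMonoidAlgebra.single u (1 : K) ∈ originIdeal K p q :=
      Ideal.subset_span ⟨u, hu, rfl⟩
    rw [← show _ = originIdeal K p q from h] at h1
    exact h1
  · intro h
    refine eq_originIdeal (PrimeSpectrum.comap _ P).2.ne_top (Ideal.span_le.2 ?_)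
    rintro _ ⟨u, hu, rfl⟩
    exact h u hu

/-- The jets centred at the torus-fixed point. -/
lemma exists_isJet_of_mem_jetFiber {P : PrimeSpectrum (JetAlgebra K (ToricRing K p q) m)}
    (hP : P ∈ jetFiber K p q m) :
    ∃ (L : Type v) (_ : Field L) (_ : Algebra K L) (φ : dualSemigroup p q → L⟦X⟧)
      (hφ : IsJet m φ), RingHom.ker (hφ.eval K) = P.asIdeal ∧ ∀ u, u ≠ 0 → X ∣ φ u := by
  obtain ⟨L, _, _, φ, hφ, h⟩ := exists_isJet_ker_eval_eq P.asIdeal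
  refine ⟨L, inferInstance, inferInstance, φ, hφ, h, fun u hu => ?_⟩
  have h1 := mem_jetFiber.1 hP u hu
  rw [← h, RingHom.mem_ker, IsJet.eval_monoCoord] at h1
  exact X_dvd_iff.2 (by simpa using h1)

lemma ker_eval_mem_jetFiber {A : Type*} [CommRing A] [IsDomain A] [Algebra K A]
    {φ : dualSemigroup p q → A⟦X⟧} (hφ : IsJet m φ) (h : ∀ u, u ≠ 0 → X ∣ φ u) :
    (⟨RingHom.ker (hφ.eval K), RingHom.ker_isPrime _⟩ :
      PrimeSpectrum (JetAlgebra K (ToricRing K p q) m)) ∈ jetFiber K p q m := by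
  refine mem_jetFiber.2 fun u hu => RingHom.mem_ker.2 ?_
  rw [IsJet.eval_monoCoord]
  simpa using X_dvd_iff.1 (h u hu)

variable (C : HJChain (dualSemigroup p q))

/-- The canonical indices, restricted to `s = 1` for hypersurfaces. -/
def componentIndices {Γ : Type*} [AddCommMonoid Γ] (C : HJChain Γ) (m : ℕ) : Set (ℕ × ℕ × ℕ) :=
  {t | CanonIndex C m t.1 t.2.1 t.2.2 ∧ (2 ≤ C.n ∨ t.1 = 1)}

lemma finite_componentIndices {Γ : Type*} [AddCommMonoid Γ] (C : HJChain Γ) (m : ℕ) :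
    (componentIndices C m).Finite := by
  refine ((Set.finite_Iic (m + 1)).prod ((Set.finite_Iic C.n).prod (Set.finite_Iic (m + 1)))).subset ?_
  rintro ⟨s, j, a⟩ ⟨h, -⟩
  have h1 := h.lt_n
  have h2 := h.a_le'
  simp only at h1 h2
  simp only [Set.mem_prod, Set.mem_Iic]
  omega

/-- The generic point of a component. -/
noncomputable def componentPoint (K : Type v) [Field K] (m : ℕ) (t : componentIndices C m) :
    jetFiber K p q m :=
  ⟨⟨famPrime K t.2.1.toFamIndex, inferInstance⟩, ker_eval_mem_jetFiber
    (isJet_famFun t.2.1.toFamIndex (famW_mul_famInv C m _ _ K)) fun _ hu =>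
      (dvd_pow_self _ (by have := t.2.1.one_le; omega)).trans
        (X_pow_dvd_famFun t.2.1.toFamIndex hu)⟩

lemma exists_mem_closure_componentPoint (hm : 1 ≤ m) (P : jetFiber K p q m) :
    ∃ t, P ∈ closure {componentPoint C K m t} := by
  obtain ⟨L, _, _, φ, hφ, hker, hX⟩ := exists_isJet_of_mem_jetFiber P.2
  have hd : ∀ k ≤ C.n + 1, X ∣ φ (C.u k) := fun k hk => hX _ (C.u_ne_zero hk)
  have hn := C.n_pos
  rcases Nat.lt_or_ge C.n 2 with h | h
  · obtain ⟨j, a, hI, hle⟩ := exists_famPrime_le_of_n_eq_one (K := K) (by omega) hm hφ hd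
    exact ⟨⟨(1, j, a), hI, Or.inr rfl⟩, mem_closure_singleton_subtype.2 (hle.trans hker.le)⟩
  · obtain ⟨s, j, a, hI, hle⟩ := exists_famPrime_le (K := K) hm hφ hd
    exact ⟨⟨(s, j, a), hI, Or.inl h⟩, mem_closure_singleton_subtype.2 (hle.trans hker.le)⟩

lemma eq_of_mem_closure_componentPoint (t t' : componentIndices C m)
    (h : componentPoint C K m t' ∈ closure {componentPoint C K m t}) : t = t' := by
  have h1 := mem_closure_singleton_subtype.1 h
  obtain ⟨h2, h3, h4⟩ := t.2.1.eq_of_famPrime_le t'.2.1 (by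
    rcases t.2.2 with h | h
    · exact Or.inl h
    · rcases t'.2.2 with h' | h'
      · exact Or.inl h'
      · exact Or.inr (h.trans h'.symm)) h1
  exact Subtype.ext (Prod.ext h2 (Prod.ext h3 h4))

lemma numComponents_eq (hm : 1 ≤ m) : numComponents K p q m = (componentIndices C m).ncard := by
  have := (finite_componentIndices C m).to_subtype
  rw [numComponents, ncard_irreducibleComponents _ (exists_mem_closure_componentPoint C hm)
    (eq_of_mem_closure_componentPoint C)]
  rfl

/-- The jet `u ↦ 0` (`u ≠ 0`). -/
lemma exists_isJet_zero {Γ : Type*} [AddCommMonoid Γ] (C : HJChain Γ) (m : ℕ) (A : Type*)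
    [CommRing A] : ∃ φ : Γ → A⟦X⟧, IsJet m φ ∧ ∀ u, u ≠ 0 → φ u = 0 :=
  ⟨chartFun (C.b 0) (C.h 0) 0 0 0 0,
    isJet_chartFun_of_nonneg (fun u => C.h_nonneg (Nat.zero_le _) u) C.b_zero_nonneg,
    fun u hu => zero_dvd_iff.1 (dvd_chartFun (fun u hu => C.one_le_h (Nat.zero_le _) hu)
      (fun u hu => by simpa using C.one_le_h (Nat.zero_le _) hu) dvd_rfl hu)⟩

lemma finite_irreducibleComponents (C : HJChain (dualSemigroup p q)) (m : ℕ) : (irreducibleComponents (jetFiber K p q m)).Finite := by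
  rcases Nat.eq_zero_or_pos m with rfl | hm
  -- For `m = 0` the families are not available; every jet in the fibre is the base change of the
  -- constant one, so the fibre is the closure of one point.
  · obtain ⟨φ₀, hφ₀, h0⟩ := exists_isJet_zero C 0 K
    let P₀ : jetFiber K p q 0 := ⟨_, ker_eval_mem_jetFiber (K := K) hφ₀ fun u hu => by
      rw [h0 u hu]; exact dvd_zero _⟩
    rw [irreducibleComponents_eq_range (fun _ : Unit => P₀) (fun P => ⟨(), ?_⟩)
      (fun _ _ _ => rfl)]
    · exact Set.finite_range _
    · obtain ⟨L, _, _, φ, hφ, hker, hX⟩ := exists_isJet_of_mem_jetFiber P.2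
      refine mem_closure_singleton_subtype.2 ?_
      rw [← hker]
      have h1 : hφ.eval K = (Algebra.ofId K L).comp (hφ₀.eval K) := by
        rw [← hφ₀.eval_map]
        refine IsJet.eval_congr _ _ fun u => ?_
        rcases eq_or_ne u 0 with rfl | hu
        · exact hφ.close_zero (hφ₀.map _) le_rfl
        · rw [h0 u hu, map_zero, sub_zero, zero_add, pow_one]
          exact hX u hu
      intro g hg
      have h2 : hφ₀.eval K g = 0 := hg
      rw [RingHom.mem_ker, h1, AlgHom.comp_apply, h2, map_zero]
  · have := (finite_componentIndices C m).to_subtype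
    rw [irreducibleComponents_eq_range _ (exists_mem_closure_componentPoint C hm)
      (eq_of_mem_closure_componentPoint C)]
    exact Set.finite_range _

/-- The generic `1`-jet at the torus-fixed point. -/
lemma exists_isJet_universal {Γ : Type*} [AddCommMonoid Γ] (C : HJChain Γ) (K : Type*) [Field K] :
    ∃ φ : Γ → (MvPolynomial (Fin (C.n + 2)) K)⟦X⟧, IsJet 1 φ ∧ (∀ u, u ≠ 0 → X ∣ φ u) ∧
      ∀ k : Fin (C.n + 2), φ (C.u k) = X * PowerSeries.C (MvPolynomial.X k) := by
  obtain ⟨φ₀, hφ₀, h0⟩ := exists_isJet_zero C 1 (MvPolynomial (Fin (C.n + 2)) K)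
  let z : Fin (C.n + 2) → (MvPolynomial (Fin (C.n + 2)) K)⟦X⟧ :=
    fun k => PowerSeries.C (MvPolynomial.X k)
  refine ⟨fun u => φ₀ u + X ^ (1 + 1 - 1) * C.onGens z u,
    hφ₀.add_perturbation (by norm_num) (fun u hu => by rw [h0 u hu]; exact dvd_zero _)
      (C.onGens_zero _) (C.onGens_add _), fun u hu => ?_, fun k => ?_⟩
  · simp only [h0 u hu]; simp
  · simp only
    rw [h0 _ (C.u_ne_zero (Nat.le_of_lt_succ k.2)), C.onGens_u]; simp [z]

/-- Products of two nonzero elements have order at least two, so for `m = 1` no relation is visible.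
The first-order coefficients of the generators are free coordinates and the fibre is, as a space, an
affine space. -/
lemma exists_jetFiber_one_eq : ∃ ev : JetAlgebra K (ToricRing K p q) 1 →ₐ[K]
    MvPolynomial (Fin (C.n + 2)) K, Function.Surjective ev ∧
      jetFiber K p q 1 = PrimeSpectrum.zeroLocus (RingHom.ker ev) := by
  obtain ⟨φ, hφ, hX, hu⟩ := exists_isJet_universal C K
  refine ⟨hφ.eval K, ?_, ?_⟩
  · rw [← AlgHom.range_eq_top, ← top_le_iff, ← MvPolynomial.adjoin_range_X, Algebra.adjoin_le_iff]
    rintro _ ⟨k, rfl⟩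
    refine ⟨monoCoord K (C.u k) 1, ?_⟩
    exact (hφ.eval_monoCoord _ _).trans (by rw [hu]; simp)
  · ext P
    rw [PrimeSpectrum.mem_zeroLocus, SetLike.coe_subset_coe]
    constructor
    · intro hP
      obtain ⟨L, _, _, ψ, hψ, hker, hXψ⟩ := exists_isJet_of_mem_jetFiber hP
      rw [← hker]
      let θ : MvPolynomial (Fin (C.n + 2)) K →ₐ[K] L :=
        MvPolynomial.aeval fun k => coeff 1 (ψ (C.u k))
      have h1 : hψ.eval K = θ.comp (hφ.eval K) := by
        rw [← hφ.eval_map]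
        refine IsJet.eval_congr _ _ (hψ.close_of_gens C (hφ.map _) fun k hk => ?_)
        have h2 := hu ⟨k, Nat.lt_succ_of_le hk⟩
        simp only at h2
        rw [h2, X_pow_dvd_iff]
        intro i hi
        have h3 := X_dvd_iff.1 (hXψ _ (C.u_ne_zero hk))
        interval_cases i
        · simp [h3]
        · simp [θ]
      intro g hg
      have h2 : hφ.eval K g = 0 := hg
      rw [RingHom.mem_ker, h1, AlgHom.comp_apply, h2, map_zero]
    · exact fun h => mem_jetFiber.2 fun u hu => h (mem_jetFiber.1 (ker_eval_mem_jetFiber hφ hX) u hu)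

lemma topologicalKrullDim_jetFiber_one :
    topologicalKrullDim (jetFiber K p q 1) = ((C.n + 2 : ℕ) : WithBot ℕ∞) := by
  obtain ⟨ev, hev, h⟩ := exists_jetFiber_one_eq (K := K) C
  have hemb := PrimeSpectrum.isClosedEmbedding_comap_of_surjective _
    (ev : JetAlgebra K (ToricRing K p q) 1 →+* MvPolynomial (Fin (C.n + 2)) K) hev
  have hrange : Set.range (PrimeSpectrum.comap (ev : JetAlgebra K (ToricRing K p q) 1 →+*
      MvPolynomial (Fin (C.n + 2)) K)) = jetFiber K p q 1 := by
    rw [h]; exact range_comap_of_surjective _ _ hev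
  rw [← hrange, ← hemb.isEmbedding.toHomeomorph.isHomeomorph.topologicalKrullDim_eq,
    PrimeSpectrum.topologicalKrullDim_eq_ringKrullDim,
    MvPolynomial.ringKrullDim_of_isNoetherianRing, ringKrullDim_eq_zero_of_field]
  simp

lemma componentDims_one : componentDims K p q 1 = {((C.n + 2 : ℕ) : WithBot ℕ∞)} := by
  have h : irreducibleComponents (jetFiber K p q 1) = {Set.univ} := by
    obtain ⟨ev, hev, h⟩ := exists_jetFiber_one_eq (K := K) C
    have hmem : ∀ P ∈ jetFiber K p q 1, RingHom.ker ev ≤ P.asIdeal := fun P hP => by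
      rw [h] at hP; exact hP
    let P₀ : jetFiber K p q 1 := ⟨⟨RingHom.ker ev, RingHom.ker_isPrime _⟩, by
      rw [h]; exact le_refl (RingHom.ker ev)⟩
    have hcl : ∀ P, P ∈ closure {P₀} := fun P => mem_closure_singleton_subtype.2 (hmem _ P.2)
    rw [irreducibleComponents_eq_range (fun _ : Unit => P₀) (fun P => ⟨(), hcl P⟩)
      (fun _ _ _ => rfl), Set.range_const, Set.eq_univ_of_forall hcl]
  ext d
  simp only [componentDims, h, Set.mem_singleton_iff, exists_eq_left, Set.mem_ofPred_eq]
  rw [(Homeomorph.Set.univ _).isHomeomorph.topologicalKrullDim_eq,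
    topologicalKrullDim_jetFiber_one C, eq_comm]

end Points

end ToricJets

/-! ### Counting components and recovering the continued fraction -/

namespace ToricJets

section Counting

variable {Γ : Type*} [AddCommMonoid Γ] {C : HJChain Γ} {m : ℕ}

/-- For each `s` there is the index with `j = 0` and `a = s`; beyond it, each `j` admits precisely
the `a > s` up to the smaller of the two upper bounds. -/
lemma ncard_canonIndex (T : Finset ℕ) (hT : ∀ s ∈ T, 1 ≤ s ∧ 2 * s ≤ m + 1) :
    {t : ℕ × ℕ × ℕ | t.1 ∈ T ∧ CanonIndex C m t.1 t.2.1 t.2.2}.ncard =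
      ∑ s ∈ T, (1 + ∑ j ∈ Finset.range C.n, (min (s * (C.c (j + 1) - 1)) (m + 1 - s) - s)) := by
  classical
  let B : ℕ → Finset (Σ _ : ℕ, ℕ) := fun s =>
    (Finset.range C.n).sigma fun j => Finset.Ioc s (min (s * (C.c (j + 1) - 1)) (m + 1 - s))
  let F : Finset (Σ _ : ℕ, Σ _ : ℕ, ℕ) := T.sigma fun s => insert ⟨0, s⟩ (B s)
  let f : (Σ _ : ℕ, Σ _ : ℕ, ℕ) → ℕ × ℕ × ℕ := fun x => (x.1, x.2.1, x.2.2)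
  have hf : Function.Injective f := by
    rintro ⟨s, j, a⟩ ⟨s', j', a'⟩ h
    simp only [f, Prod.mk.injEq] at h
    obtain ⟨rfl, rfl, rfl⟩ := h
    rfl
  have hset : {t : ℕ × ℕ × ℕ | t.1 ∈ T ∧ CanonIndex C m t.1 t.2.1 t.2.2} = ↑(F.image f) := by
    ext ⟨s, j, a⟩
    have hiff : (s, j, a) ∈ F.image f ↔ (⟨s, j, a⟩ : Σ _ : ℕ, Σ _ : ℕ, ℕ) ∈ F := by
      rw [show (s, j, a) = f ⟨s, j, a⟩ from rfl, hf.mem_finset_image]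
    rw [Finset.mem_coe, hiff]
    simp only [F, B, Finset.mem_sigma, Finset.mem_insert, Finset.mem_range, Finset.mem_Ioc,
      Set.mem_ofPred_eq, Sigma.mk.injEq, heq_eq_eq, le_min_iff]
    refine and_congr_right fun hs => ?_
    obtain ⟨h1, h2⟩ := hT s hs
    constructor
    · intro h
      have h3 := h.lt_n
      have h4 := h.a_le
      have h5 := h.a_le'
      rcases h.canon with ⟨rfl, rfl⟩ | h6
      · exact Or.inl ⟨rfl, rfl⟩
      · exact Or.inr ⟨h3, h6, h4, by omega⟩
    · rintro (⟨rfl, rfl⟩ | ⟨h3, h4, h5, h6⟩)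
      · exact canonIndex_zero h1 h2
      · exact { lt_n := h3, one_le := h1, two_mul_le := h2, le_a := h4.le, a_le := h5,
                a_le' := by omega, canon := Or.inr h4 }
  rw [hset, Set.ncard_coe_finset, Finset.card_image_of_injective _ hf, Finset.card_sigma]
  refine Finset.sum_congr rfl fun s _ => ?_
  rw [Finset.card_insert_of_notMem (by simp [B]), Finset.card_sigma, add_comm]
  simp

lemma ncard_componentIndices (hn : 2 ≤ C.n) :
    (componentIndices C m).ncard = ∑ s ∈ Finset.Icc 1 ((m + 1) / 2),
      (1 + ∑ j ∈ Finset.range C.n, (min (s * (C.c (j + 1) - 1)) (m + 1 - s) - s)) := by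
  rw [← ncard_canonIndex (C := C) (m := m) _ fun s hs => by
    rw [Finset.mem_Icc] at hs; omega]
  congr 1
  ext t
  simp only [componentIndices, Set.mem_ofPred_eq, Finset.mem_Icc, hn, true_or, and_true]
  refine ⟨fun h => ⟨?_, h⟩, fun h => h.2⟩
  have h1 := h.one_le
  have h2 := h.two_mul_le
  omega

lemma ncard_componentIndices_of_n_eq_one (hn : C.n = 1) (hm : C.c 1 ≤ m) :
    (componentIndices C m).ncard = C.c 1 - 1 := by
  have hc := C.two_le 1
  have h : componentIndices C m =
      {t : ℕ × ℕ × ℕ | t.1 ∈ ({1} : Finset ℕ) ∧ CanonIndex C m t.1 t.2.1 t.2.2} := by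
    ext t
    simp [componentIndices, hn, and_comm]
  rw [h, ncard_canonIndex _ fun s hs => by rw [Finset.mem_singleton] at hs; omega]
  rw [Finset.sum_singleton, hn, Finset.sum_range_one, one_mul, zero_add,
    min_eq_left (by omega)]
  omega

/-- The case distinction switches at `s c ≤ m` and the minimum at `s c ≤ m + 1`; for `s c = m + 1`
the two values agree. -/
lemma contactCount_sub_one {c m s : ℕ} (hc : 2 ≤ c) (hs : 2 * s ≤ m + 1) :
    contactCount c m s - 1 = ((min (s * (c - 1)) (m + 1 - s) - s : ℕ) : ℤ) := by
  obtain ⟨d, rfl⟩ : ∃ d, c = d + 2 := ⟨c - 2, by omega⟩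
  have e1 : s * (d + 2 - 1) = s * d + s := by
    rw [show d + 2 - 1 = d + 1 by omega]; ring
  have e2 : s * (d + 2) = s * d + 2 * s := by ring
  simp only [contactCount, Nat.le_div_iff_mul_le (show 0 < d + 2 by omega), e1, e2]
  push_cast
  split_ifs with h
  · rw [min_eq_left (by omega), Nat.add_sub_cancel]
    push_cast; ring
  · rw [min_eq_right (by omega)]
    omega

lemma sum_range_getD (cs : List ℕ) (f : ℕ → ℤ) :
    ∑ j ∈ Finset.range cs.length, f (cs.getD j 2) = (cs.map f).sum := by
  induction cs with
  | nil => simp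
  | cons c cs ih =>
    rw [List.length_cons, Finset.sum_range_succ', List.map_cons, List.sum_cons, add_comm]
    simp only [List.getD_cons_zero, List.getD_cons_succ, ih]

end Counting

section Surface

variable {K : Type*} [Field K] {p q m : ℕ} {cs : List ℕ}

lemma numComponents_eq_trialCount (hp : 0 < p) (hcop : Nat.Coprime p q)
    (hcs : IsHJExpansion cs ((q : ℚ) / (p : ℚ))) (hn : 2 ≤ cs.length) (hm : 1 ≤ m) :
    (numComponents K p q m : ℤ) = trialCount (cs.length + 2) cs m := by
  rw [numComponents_eq (dualChain hp hcop hcs) hm, ncard_componentIndices hn, trialCount]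
  push_cast [Nat.cast_sum]
  refine Finset.sum_congr rfl fun s hs => ?_
  rw [Finset.mem_Icc] at hs
  have h1 : ((cs.length : ℤ) + 2 - 2 - (cs.length : ℤ)) = 0 := by ring
  rw [Multiset.coe_card, h1, zero_mul, add_zero, Multiset.map_coe, Multiset.sum_coe,
    ← sum_range_getD]
  congr 1
  refine Finset.sum_congr rfl fun j hj => ?_
  have h2 := (dualChain hp hcop hcs).two_le (j + 1)
  rw [dualChain_c] at h2 ⊢
  rw [contactCount_sub_one h2 (by omega)]

lemma numComponents_of_singleton {c : ℕ} (hp : 0 < p) (hcop : Nat.Coprime p q)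
    (hcs : IsHJExpansion [c] ((q : ℚ) / (p : ℚ))) (hm : c ≤ m) :
    numComponents K p q m = c - 1 := by
  have hc : 2 ≤ c := hcs.2.1 c (by simp)
  rw [numComponents_eq (dualChain hp hcop hcs) (by omega)]
  exact ncard_componentIndices_of_n_eq_one rfl hm

end Surface

section Recovery

/-- The number of components lost by replacing an unknown entry by `c`. -/
def contactLoss (c m : ℕ) : ℤ :=
  ∑ s ∈ Finset.Icc 1 ((m + 1) / 2), ((m : ℤ) + 1 - 2 * s - (contactCount c m s - 1))

lemma contactLoss_eq (c m : ℕ) (hc : 0 < c) : contactLoss c m =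
    ∑ s ∈ Finset.Icc 1 ((m + 1) / 2), if s * c ≤ m then (m : ℤ) + 1 - s * c else 0 := by
  refine Finset.sum_congr rfl fun s _ => ?_
  simp only [contactCount, Nat.le_div_iff_mul_le hc]
  split_ifs <;> ring

lemma contactLoss_nonneg {c : ℕ} (m : ℕ) (hc : 0 < c) : 0 ≤ contactLoss c m := by
  rw [contactLoss_eq c m hc]
  refine Finset.sum_nonneg fun s _ => ?_
  split_ifs with h
  · have : (s * c : ℤ) ≤ m := by exact_mod_cast h
    linarith
  · exact le_rfl

lemma contactLoss_of_lt {c m : ℕ} (h : m < c) : contactLoss c m = 0 := by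
  rw [contactLoss_eq c m (by omega)]
  refine Finset.sum_eq_zero fun s hs => if_neg ?_
  have := Nat.le_mul_of_pos_left c (Finset.mem_Icc.1 hs).1
  omega

/-- Only `s = 1` satisfies `s c ≤ c`, and it contributes `(c + 1) - c`. -/
lemma contactLoss_self {c : ℕ} (hc : 0 < c) : contactLoss c c = 1 := by
  rw [contactLoss_eq c c hc, Finset.sum_eq_single 1]
  · simp
  · intro s hs h1
    rw [if_neg]
    have := Nat.mul_le_mul_right c (show 2 ≤ s by have := (Finset.mem_Icc.1 hs).1; omega)
    omega
  · intro h
    simp only [Finset.mem_Icc] at h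
    omega

lemma contactLoss_pos {c m : ℕ} (hc : 0 < c) (h : c ≤ m) : 0 < contactLoss c m := by
  rw [contactLoss_eq c m hc]
  refine Finset.sum_pos' (fun s _ => ?_) ⟨1, by simp only [Finset.mem_Icc]; omega, ?_⟩
  · split_ifs with h
    · have : (s * c : ℤ) ≤ m := by exact_mod_cast h
      linarith
    · exact le_rfl
  · rw [one_mul, if_pos h]
    have : (c : ℤ) ≤ m := by exact_mod_cast h
    push_cast
    linarith

/-- The summands are affine in the multiset: each known entry replaces one default term `m + 1 - 2
s` by its contact count minus one. -/
lemma trialCount_sub (e : ℕ) (L T : Multiset ℕ) (m : ℕ) :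
    trialCount e L m - trialCount e (L + T) m = (T.map fun c => contactLoss c m).sum := by
  induction T using Multiset.induction_on with
  | empty => simp
  | cons c T ih =>
    have h : trialCount e (L + T) m - trialCount e (c ::ₘ (L + T)) m = contactLoss c m := by
      unfold trialCount contactLoss
      rw [← Finset.sum_sub_distrib]
      refine Finset.sum_congr rfl fun s _ => ?_
      simp only [Multiset.map_cons, Multiset.sum_cons, Multiset.card_cons]
      push_cast
      ring
    rw [Multiset.map_cons, Multiset.sum_cons, ← ih, Multiset.add_cons, ← h]
    ring

variable {e : ℕ} {N : ℕ → ℕ} {L M : Multiset ℕ}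

/-- With `T` the multiset of missing entries, the excess of the trial count is the sum of the losses
over `T`. It vanishes below the least entry of `T` and there counts its copies, so a step adjoins
all of them. -/
lemma recoverStep_spec (hN : ∀ m, 1 ≤ m → (N m : ℤ) = trialCount e M m)
    (hM : ∀ c ∈ M, 2 ≤ c) (he : Multiset.card M = e - 2) (hL : L ≤ M) :
    recoverStep e N L ≤ M ∧ (L ≠ M → Multiset.card L < Multiset.card (recoverStep e N L)) := by
  classical
  by_cases hLM : L = M
  · subst hLM
    rw [recoverStep, if_pos he]
    exact ⟨le_rfl, fun h => absurd rfl h⟩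
  obtain ⟨T, rfl⟩ := Multiset.le_iff_exists_add.1 hL
  have hT0 : T ≠ 0 := by rintro rfl; simp at hLM
  have hT : ∀ c ∈ T, 2 ≤ c := fun c hc => hM c (Multiset.mem_add.2 (Or.inr hc))
  have hsub : ∀ m, 1 ≤ m → trialCount e L m - N m = (T.map fun c => contactLoss c m).sum :=
    fun m hm => by rw [hN m hm, trialCount_sub]
  have hcard : Multiset.card L ≠ e - 2 := by
    rw [← he, Multiset.card_add]
    have := Multiset.card_pos.2 hT0
    omega
  have hzero : ∀ m, (∀ c ∈ T, m < c) → (T.map fun c => contactLoss c m).sum = 0 := fun m h =>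
    Multiset.sum_eq_zero fun x hx => by
      obtain ⟨c, hc, rfl⟩ := Multiset.mem_map.1 hx
      exact contactLoss_of_lt (h c hc)
  obtain ⟨c₀, hc₀, hmin⟩ : ∃ c ∈ T, ∀ c' ∈ T, c ≤ c' := by
    obtain ⟨c, hc⟩ := Multiset.exists_mem_of_ne_zero hT0
    obtain ⟨c, hc, h⟩ := Finset.exists_min_image T.toFinset id ⟨c, by simpa using hc⟩
    exact ⟨c, by simpa using hc, fun c' hc' => h c' (by simpa using hc')⟩
  have hc₂ := hT c₀ hc₀
  obtain ⟨T', hT'⟩ := Multiset.exists_cons_of_mem hc₀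
  have hnext : nextEntry e N L = c₀ := by
    refine (IsLeast.csInf_eq ⟨⟨by omega, ?_⟩, ?_⟩)
    · rw [← sub_pos, hsub c₀ (by omega), hT', Multiset.map_cons, Multiset.sum_cons]
      refine add_pos_of_pos_of_nonneg (contactLoss_pos (by omega) le_rfl)
        (Multiset.sum_nonneg fun x hx => ?_)
      obtain ⟨c, hc, rfl⟩ := Multiset.mem_map.1 hx
      exact contactLoss_nonneg _ (by
        have := hT c (hT' ▸ Multiset.mem_cons_of_mem hc)
        omega)
    · rintro m ⟨hm, hlt⟩
      rw [← sub_pos, hsub m hm] at hlt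
      by_contra! h
      rw [hzero m fun c hc => h.trans_le (hmin c hc)] at hlt
      exact lt_irrefl _ hlt
  have hcount : trialCount e L c₀ - N c₀ = (T.count c₀ : ℤ) := by
    rw [hsub c₀ (by omega)]
    have : ∀ c ∈ T, contactLoss c c₀ = if c₀ = c then 1 else 0 := by
      intro c hc
      split_ifs with h
      · rw [← h]; exact contactLoss_self (by omega)
      · exact contactLoss_of_lt (lt_of_le_of_ne (hmin c hc) h)
    rw [Multiset.map_congr rfl this]
    clear hc₀ hcard hzero hT hT0 hsub hmin hT' this hN hM he hL hLM
    induction T using Multiset.induction_on with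
    | empty => simp
    | cons c T ih =>
      rw [Multiset.map_cons, Multiset.sum_cons, ih, Multiset.count_cons]
      split_ifs <;> push_cast <;> ring
  have hstep : recoverStep e N L = L + Multiset.replicate (T.count c₀) c₀ := by
    rw [recoverStep, if_neg hcard, hnext, hcount, Int.toNat_natCast]
  rw [hstep]
  refine ⟨add_le_add_right (Multiset.le_count_iff_replicate_le.1 le_rfl) _, fun _ => ?_⟩
  have := Multiset.count_pos.2 hc₀
  rw [Multiset.card_add, Multiset.card_replicate]
  omega

/-- Every step before completion adds at least one entry and never leaves `M`, so `e - 2` steps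
suffice. -/
lemma iterate_recoverStep (hN : ∀ m, 1 ≤ m → (N m : ℤ) = trialCount e M m)
    (hM : ∀ c ∈ M, 2 ≤ c) (he : Multiset.card M = e - 2) : (recoverStep e N)^[e - 2] 0 = M := by
  have key : ∀ k, (recoverStep e N)^[k] 0 ≤ M ∧
      ((recoverStep e N)^[k] 0 = M ∨ k ≤ Multiset.card ((recoverStep e N)^[k] 0)) := by
    intro k
    induction k with
    | zero => exact ⟨Multiset.zero_le _, Or.inr (Nat.zero_le _)⟩
    | succ k ih =>
      rw [Function.iterate_succ_apply']
      obtain ⟨h1, h2⟩ := recoverStep_spec hN hM he ih.1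
      refine ⟨h1, ?_⟩
      by_cases h : (recoverStep e N)^[k] 0 = M
      · rw [h, recoverStep, if_pos he]; exact Or.inl rfl
      · have := h2 h
        have := ih.2.resolve_left h
        exact Or.inr (by omega)
  obtain ⟨h1, h2⟩ := key (e - 2)
  rcases h2 with h2 | h2
  · exact h2
  · exact Multiset.eq_of_le_of_card_le h1 (by rw [he]; exact h2)

lemma recoverEntries_three {c : ℕ} (hc : 1 ≤ c) (hN : ∀ m, c ≤ m → N m = c - 1) :
    recoverEntries 3 N = {c} := by
  have h : {n : ℕ | ∀ᶠ m in Filter.atTop, N m = n} = {c - 1} := by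
    ext n
    have h1 : ∀ᶠ m in Filter.atTop, N m = c - 1 := Filter.eventually_atTop.2 ⟨c, hN⟩
    refine ⟨fun hn => ?_, fun hn => ?_⟩
    · obtain ⟨m, h2, h3⟩ := (h1.and hn).exists
      exact h3.symm.trans h2
    · rw [Set.mem_singleton_iff.1 hn]; exact h1
  rw [recoverEntries, if_pos rfl, h, csInf_singleton, Nat.sub_add_cancel hc]

/-- The entries of the continued fraction are recovered from the numbers of components. -/
lemma recoverEntries_eq {K : Type*} [Field K] {p q : ℕ} {cs : List ℕ} (hp : 0 < p)
    (hcop : Nat.Coprime p q) (hcs : IsHJExpansion cs ((q : ℚ) / (p : ℚ)))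
    (hN : ∀ m, 1 ≤ m → numComponents K p q m = N m) :
    recoverEntries (cs.length + 2) N = (cs : Multiset ℕ) := by
  match cs, hcs with
  | [], hcs => exact absurd rfl hcs.1
  | [c], hcs =>
    have hc : 2 ≤ c := hcs.2.1 c (by simp)
    exact recoverEntries_three (by omega) fun m hm => by
      rw [← hN m (by omega), numComponents_of_singleton hp hcop hcs hm]
  | c :: d :: l, hcs =>
    rw [recoverEntries, if_neg (by simp)]
    refine iterate_recoverStep (fun m hm => ?_) (fun c hc => hcs.2.1 c hc) (by simp)
    rw [← hN m hm]
    exact numComponents_eq_trialCount hp hcop hcs (by simp) hm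

end Recovery

end ToricJets

theorem corollary4p15 (K : Type*) [Field K] :
    (∀ (p q : ℕ) (cs : List ℕ), 0 < p → p < q → Nat.Coprime p q →
      ToricJets.IsHJExpansion cs ((q : ℚ) / (p : ℚ)) →
        (∀ m : ℕ, (irreducibleComponents (ToricJets.jetFiber K p q m)).Finite) ∧
        ∃ e : ℕ, topologicalKrullDim (ToricJets.jetFiber K p q 1) = (e : WithBot ℕ∞) ∧
          cs.length + 2 = e ∧
          ToricJets.recoverEntries e (ToricJets.numComponents K p q) = (cs : Multiset ℕ)) ∧
    (∀ (p q p' q' : ℕ) (cs cs' : List ℕ),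
      0 < p → p < q → Nat.Coprime p q → ToricJets.IsHJExpansion cs ((q : ℚ) / (p : ℚ)) →
      0 < p' → p' < q' → Nat.Coprime p' q' → ToricJets.IsHJExpansion cs' ((q' : ℚ) / (p' : ℚ)) →
      (∀ m : ℕ, 1 ≤ m → ToricJets.numComponents K p q m = ToricJets.numComponents K p' q' m) →
      (∀ m : ℕ, 1 ≤ m → ToricJets.componentDims K p q m = ToricJets.componentDims K p' q' m) →
        (cs : Multiset ℕ) = (cs' : Multiset ℕ)) := by
  refine ⟨fun p q cs hp _ hcop hcs => ⟨?_, cs.length + 2, ?_, rfl, ?_⟩,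
    fun p q p' q' cs cs' hp _ hcop hcs hp' _ hcop' hcs' hN hd => ?_⟩
  · exact ToricJets.finite_irreducibleComponents (ToricJets.dualChain hp hcop hcs)
  · exact ToricJets.topologicalKrullDim_jetFiber_one (ToricJets.dualChain hp hcop hcs)
  · exact ToricJets.recoverEntries_eq hp hcop hcs fun _ _ => rfl
  -- The recovery procedure needs `e` as input; the dimensions for `m = 1` show that it is the same
  -- for both surfaces.
  · have h1 := hd 1 le_rfl
    rw [ToricJets.componentDims_one (ToricJets.dualChain hp hcop hcs),
      ToricJets.componentDims_one (ToricJets.dualChain hp' hcop' hcs'),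
      Set.singleton_eq_singleton_iff] at h1
    have h2 : cs.length + 2 = cs'.length + 2 := by exact_mod_cast h1
    rw [← ToricJets.recoverEntries_eq (K := K) hp hcop hcs hN,
      ← ToricJets.recoverEntries_eq (K := K) hp' hcop' hcs' fun _ _ => rfl, h2]
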